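/- Let $N,n\ge 1$ be integers and consider the random $N\times n$ matrix $$\Sigma=\frac{1}{\sqrt n}D^{1/2}X\tilde D^{1/2}+A ,$$ where $D$ ($N\times N$) and $\tilde D$ ($n\times n$) are deterministic diagonal matrices with non-negative real diagonal entries, $A$ is a deterministic complex $N\times n$ matrix, and the entries $X_{ij}$ of $X$ are i.i.d. complex random variables with $\mathbb E X_{ij}=0$ and $\mathbb E|X_{ij}|^2=1$. For $z\in\mathbb C\setminus\mathbb R^+$, where $\mathbb R^+=[0,\infty)$, let $\boldsymbol\delta_z=\mathrm{dist}(z,\mathbb R^+)$ and $$Q(z)=(\Sigma\Sigma^*-zI_N)^{-1},\quad \tilde Q(z)=(\Sigma^*\Sigma-zI_n)^{-1},\quad \alpha(z)=\frac1n\mathrm{Tr}\,D\,\mathbb E Q(z),\quad \tilde\alpha(z)=\frac1n\mathrm{Tr}\,\tilde D\,\mathbb E\tilde Q(z),$$ $$R(z)=\Big(-z\big(I_N+\tilde\alpha(z)D\big)+A\big(I_n+\alpha(z)\tilde D\big)^{-1}A^*\Big)^{-1}.$$ Let $\|\cdot\|$ denote the Euclidean norm of vectors and the spectral norm of matrices.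 Fix constants $\ell^->0$, $\ell^+$, $d_{\min}>0$, $d_{\max}$, $\tilde d_{\min}>0$, $\tilde d_{\max}$, $a_{\max}$, an integer $p\ge1$ and a constant $m$. Then there are real polynomials $\Phi_1,\Psi_1,\Phi_2,\Psi_2$ with non-negative coefficients, depending only on these constants, such that the following holds for all $N,n\ge1$ and all models as above that satisfy $$\ell^-\le \frac Nn\le \ell^+,\quad \|A\|\le a_{\max},\quad \|D\|\le d_{\max},\quad \|\tilde D\|\le\tilde d_{\max},\quad \frac1N\mathrm{Tr}\,D\ge d_{\min},\quad \frac1n\mathrm{Tr}\,\tilde D\ge\tilde d_{\min},\quad \mathbb E|X_{ij}|^{8p}\le m,$$ and for every $z\in\mathbb C\setminus\mathbb R^+$: the quantities above are well defined (the matrices to be inverted are invertible and the entries of $Q(z)$ and $\tilde Q(z)$ are integrable), and (i) for all deterministic vectors $u,v\in\mathbb C^N$, $$\big|u^*\big(\mathbb E Q(z)-R(z)\big)v\big|\le\frac1{\sqrt n}\,\Phi_1(|z|)\,\Psi_1\Big(\frac1{\boldsymbol\delta_z}\Big)\|u\|\,\|v\| ;$$ (ii) for every deterministic complex $N\times N$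 matrix $M$, $$\Big|\frac1n\mathrm{Tr}\,M\,\mathbb E Q(z)-\frac1n\mathrm{Tr}\,M R(z)\Big|\le\frac1n\,\Phi_2(|z|)\,\Psi_2\Big(\frac1{\boldsymbol\delta_z}\Big)\|M\| .$$ -/

import Mathlib

open MeasureTheory ProbabilityTheory Matrix
open scoped Matrix.Norms.L2Operator

/-- The closed half-line `ℝ⁺ = [0, ∞)` seen as a subset of `ℂ`. -/
def nonnegAxis : Set ℂ := (fun x : ℝ => (x : ℂ)) '' Set.Ici 0

/-- The distance `δ_z = dist (z, ℝ⁺)`. -/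
noncomputable def deltaZ (z : ℂ) : ℝ := Metric.infDist z nonnegAxis

/-- The diagonal matrix `diag (d i)`, with real entries, seen as a complex matrix. -/
noncomputable def realDiag {k : ℕ} (d : Fin k → ℝ) : Matrix (Fin k) (Fin k) ℂ :=
  Matrix.diagonal fun i => (d i : ℂ)

/-- `Σ = n^{-1/2} D^{1/2} X D̃^{1/2} + A` with `D = diag d` and `D̃ = diag d'`. -/
noncomputable def sigmaMatrix {N n : ℕ} (d : Fin N → ℝ) (d' : Fin n → ℝ)
    (X A : Matrix (Fin N) (Fin n) ℂ) : Matrix (Fin N) (Fin n) ℂ :=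
  ((1 / Real.sqrt n : ℝ) : ℂ) •
    (realDiag (fun i => Real.sqrt (d i)) * X * realDiag (fun j => Real.sqrt (d' j))) + A

/-- The resolvent `Q(z) = (S Sᴴ - z I_N)⁻¹`. -/
noncomputable def resolventMatrix {N n : ℕ} (S : Matrix (Fin N) (Fin n) ℂ) (z : ℂ) :
    Matrix (Fin N) (Fin N) ℂ :=
  (S * Sᴴ - z • (1 : Matrix (Fin N) (Fin N) ℂ))⁻¹

/-- The co-resolvent `Q̃(z) = (Sᴴ S - z I_n)⁻¹`. -/
noncomputable def coresolventMatrix {N n : ℕ} (S : Matrix (Fin N) (Fin n) ℂ) (z : ℂ) :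
    Matrix (Fin n) (Fin n) ℂ :=
  (Sᴴ * S - z • (1 : Matrix (Fin n) (Fin n) ℂ))⁻¹

section Expectations

variable {N n : ℕ} {Ω : Type*} [MeasurableSpace Ω]

/-- The (entrywise) expectation `𝔼 Q(z)`. -/
noncomputable def expResolvent (μ : Measure Ω) (X : Ω → Matrix (Fin N) (Fin n) ℂ)
    (d : Fin N → ℝ) (d' : Fin n → ℝ) (A : Matrix (Fin N) (Fin n) ℂ) (z : ℂ) :
    Matrix (Fin N) (Fin N) ℂ :=
  Matrix.of fun i j => ∫ ω, resolventMatrix (sigmaMatrix d d' (X ω) A) z i j ∂μ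

/-- The (entrywise) expectation `𝔼 Q̃(z)`. -/
noncomputable def expCoresolvent (μ : Measure Ω) (X : Ω → Matrix (Fin N) (Fin n) ℂ)
    (d : Fin N → ℝ) (d' : Fin n → ℝ) (A : Matrix (Fin N) (Fin n) ℂ) (z : ℂ) :
    Matrix (Fin n) (Fin n) ℂ :=
  Matrix.of fun i j => ∫ ω, coresolventMatrix (sigmaMatrix d d' (X ω) A) z i j ∂μ

/-- `α(z) = n⁻¹ Tr D 𝔼 Q(z)`. -/
noncomputable def alphaFn (μ : Measure Ω) (X : Ω → Matrix (Fin N) (Fin n) ℂ)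
    (d : Fin N → ℝ) (d' : Fin n → ℝ) (A : Matrix (Fin N) (Fin n) ℂ) (z : ℂ) : ℂ :=
  (1 / (n : ℂ)) * Matrix.trace (realDiag d * expResolvent μ X d d' A z)

/-- `α̃(z) = n⁻¹ Tr D̃ 𝔼 Q̃(z)`. -/
noncomputable def alphaTildeFn (μ : Measure Ω) (X : Ω → Matrix (Fin N) (Fin n) ℂ)
    (d : Fin N → ℝ) (d' : Fin n → ℝ) (A : Matrix (Fin N) (Fin n) ℂ) (z : ℂ) : ℂ :=
  (1 / (n : ℂ)) * Matrix.trace (realDiag d' * expCoresolvent μ X d d' A z)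

/-- The matrix `I_n + α(z) D̃`. -/
noncomputable def innerR (μ : Measure Ω) (X : Ω → Matrix (Fin N) (Fin n) ℂ)
    (d : Fin N → ℝ) (d' : Fin n → ℝ) (A : Matrix (Fin N) (Fin n) ℂ) (z : ℂ) :
    Matrix (Fin n) (Fin n) ℂ :=
  1 + alphaFn μ X d d' A z • realDiag d'

/-- The matrix `-z (I_N + α̃(z) D) + A (I_n + α(z) D̃)⁻¹ Aᴴ`. -/
noncomputable def preR (μ : Measure Ω) (X : Ω → Matrix (Fin N) (Fin n) ℂ)
    (d : Fin N → ℝ) (d' : Fin n → ℝ) (A : Matrix (Fin N) (Fin n) ℂ) (z : ℂ) :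
    Matrix (Fin N) (Fin N) ℂ :=
  (-z) • (1 + alphaTildeFn μ X d d' A z • realDiag d) + A * (innerR μ X d d' A z)⁻¹ * Aᴴ

/-- `R(z) = (-z (I_N + α̃(z) D) + A (I_n + α(z) D̃)⁻¹ Aᴴ)⁻¹`. -/
noncomputable def matrixR (μ : Measure Ω) (X : Ω → Matrix (Fin N) (Fin n) ℂ)
    (d : Fin N → ℝ) (d' : Fin n → ℝ) (A : Matrix (Fin N) (Fin n) ℂ) (z : ℂ) :
    Matrix (Fin N) (Fin N) ℂ :=
  (preR μ X d d' A z)⁻¹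

/-- The standing assumptions on the model `Σ = n^{-1/2} D^{1/2} X D̃^{1/2} + A` of size `N × n`:
`N / n` lies in `[lmin, lmax]`, the entries of `X` are i.i.d., centred, of variance one and
with `8p`-th absolute moment at most `mom`, `D = diag d` and `D̃ = diag d'` are non-negative,
of spectral norm at most `dmax`, `dmax'` and of normalized trace at least `dmin`, `dmin'`, and
`A` has spectral norm at most `amax`. -/
structure ModelAssumptions (lmin lmax dmin dmax dmin' dmax' amax mom : ℝ) (p : ℕ)
    (μ : Measure Ω) (X : Ω → Matrix (Fin N) (Fin n) ℂ)
    (d : Fin N → ℝ) (d' : Fin n → ℝ) (A : Matrix (Fin N) (Fin n) ℂ) : Prop where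
  n_pos : 0 < n
  ratio_ge : lmin ≤ (N : ℝ) / n
  ratio_le : (N : ℝ) / n ≤ lmax
  measurable_X : ∀ i j, Measurable fun ω => X ω i j
  indep_X : iIndepFun (fun (ij : Fin N × Fin n) ω => X ω ij.1 ij.2) μ
  identDistrib_X : ∀ i j i' j', IdentDistrib (fun ω => X ω i j) (fun ω => X ω i' j') μ μ
  mean_X : ∀ i j, ∫ ω, X ω i j ∂μ = 0
  variance_X : ∀ i j, ∫ ω, ‖X ω i j‖ ^ 2 ∂μ = 1
  integrable_moment_X : ∀ i j, Integrable (fun ω => ‖X ω i j‖ ^ (8 * p)) μ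
  moment_X : ∀ i j, ∫ ω, ‖X ω i j‖ ^ (8 * p) ∂μ ≤ mom
  d_nonneg : ∀ i, 0 ≤ d i
  d'_nonneg : ∀ j, 0 ≤ d' j
  norm_D : ‖realDiag d‖ ≤ dmax
  norm_D' : ‖realDiag d'‖ ≤ dmax'
  trace_D : dmin ≤ (1 / (N : ℝ)) * ∑ i, d i
  trace_D' : dmin' ≤ (1 / (n : ℝ)) * ∑ j, d' j
  norm_A : ‖A‖ ≤ amax

end Expectations

/-- A real polynomial with non-negative coefficients. -/
def HasNonnegCoeffs (P : Polynomial ℝ) : Prop := ∀ k, 0 ≤ P.coeff k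

/-! Write η_j = a_j + y_j for the columns of Σ (column of A plus noise), Q_j for the resolvent
without column j, and q_j = (1 + η_j* Q_j η_j)⁻¹ = -z Q̃_jj. Both estimates come from a single one
in Frobenius duality, |Tr B(𝔼Q - R)| ≤ C ‖B‖_F / √n for every B
(`norm_trace_mul_expResolvent_sub_le`): B = v u* has Frobenius norm ‖u‖‖v‖ and gives (i), while
‖M‖_F ≤ √N ‖M‖ gives (ii). Since R is bounded, it suffices to take K = B R and to bound 𝔼 Tr K(R⁻¹Q
- 1) by ‖K‖_F / √n (`norm_integral_errTrace_le`).

Removing one column at a time gives an exact expansion of Tr K(R⁻¹Q - 1) (`errTrace_eq`), in which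
every term is small for one of three reasons. Some have mean zero given the other columns. Some are
products of two centred quantities, each of order n^(-1/2) in L², because linear and quadratic forms
in a column concentrate when the entries have a fourth moment (`EntryLaw.l2Bound_quadratic`). The
others are differences between a global trace and its mean: Tr D Q has bounded variance by the
Efron–Stein inequality (`l2Bound_trace_D_Q_sub_integral`), and the weighted sum of the q_j is, up to
a factor, the same trace for the transposed model. This is why the scale m is a parameter separate
from the number of columns: a model and its transpose share it.

The n contributions must still add up to n^(-1/2) rather than to a constant, for an arbitrary K.
Cauchy–Schwarz over the columns reduces this to ∑ ‖K a_j‖² = ‖K A‖_F² and to ∑ 𝔼‖a_j* Q_j K‖² ≤ C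
‖K‖_F² (`sum_integral_vecSq_col_vecMul_le`). The latter is not termwise: it is compared with ∑ ‖η_j*
Q K‖² = ‖Σ* Q K‖_F², where Σ* Q is bounded although Σ need not be.

All denominators are controlled by the sign conditions of `ResolventCone`. They hold for c*Qc and
pass to sums and averages, so they apply alike to random weights, averaged weights, α and α̃. They
give |1 + w|⁻¹ ≤ |z|/δ_z and make R⁻¹ coercive with constant δ_z. Every parameter is dominated by
one T = κ(1+|z|)(1+1/δ_z), and constants are absorbed in powers of T, which yields the polynomials.
-/

/-! ### Euclidean and Frobenius norms -/

/-- The squared Euclidean norm of a complex vector. -/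
noncomputable def vecSq {ι : Type*} [Fintype ι] (v : ι → ℂ) : ℝ := ∑ i, ‖v i‖ ^ 2

/-- The squared Frobenius norm of a complex matrix. -/
noncomputable def frobSq {ι κ : Type*} [Fintype ι] [Fintype κ] (B : Matrix ι κ ℂ) : ℝ :=
  ∑ i, ∑ k, ‖B i k‖ ^ 2

section LinearAlgebra

variable {ι κ τ : Type*} [Fintype ι] [Fintype κ] [Fintype τ]

lemma vecSq_nonneg (v : ι → ℂ) : 0 ≤ vecSq v := by unfold vecSq; positivity

lemma frobSq_nonneg (B : Matrix ι κ ℂ) : 0 ≤ frobSq B := by unfold frobSq; positivity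

lemma vecSq_eq_norm_sq (v : ι → ℂ) : vecSq v = ‖WithLp.toLp 2 v‖ ^ 2 := by
  rw [EuclideanSpace.norm_sq_eq]; rfl

lemma vecSq_star (v : ι → ℂ) : vecSq (star v) = vecSq v := by
  simp [vecSq]

lemma vecSq_smul (c : ℂ) (v : ι → ℂ) : vecSq (c • v) = ‖c‖ ^ 2 * vecSq v := by
  simp [vecSq, mul_pow, Finset.mul_sum]

lemma star_dotProduct_self (v : ι → ℂ) : star v ⬝ᵥ v = (vecSq v : ℂ) := by
  simp only [dotProduct, vecSq, Pi.star_apply, RCLike.star_def, Complex.conj_mul']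
  push_cast; rfl

lemma eq_zero_of_vecSq_eq_zero {v : ι → ℂ} (h : vecSq v = 0) : v = 0 := by
  rw [vecSq_eq_norm_sq] at h
  have : WithLp.toLp 2 v = 0 := by simpa using h
  simpa using this

lemma norm_dotProduct_le (u v : ι → ℂ) : ‖u ⬝ᵥ v‖ ≤ √(vecSq u) * √(vecSq v) := by
  calc ‖u ⬝ᵥ v‖ ≤ ∑ i, ‖u i‖ * ‖v i‖ := by
        refine (norm_sum_le _ _).trans_eq ?_
        simp
    _ ≤ _ := Real.sum_mul_le_sqrt_mul_sqrt _ _ _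

lemma norm_dotProduct_sq_le (u v : ι → ℂ) : ‖u ⬝ᵥ v‖ ^ 2 ≤ vecSq u * vecSq v := by
  have h := pow_le_pow_left₀ (norm_nonneg _) (norm_dotProduct_le u v) 2
  rwa [mul_pow, Real.sq_sqrt (vecSq_nonneg u), Real.sq_sqrt (vecSq_nonneg v)] at h

lemma frobSq_eq_sum_row (B : Matrix ι κ ℂ) : frobSq B = ∑ i, vecSq (B i) := rfl

lemma frobSq_eq_sum_col (B : Matrix ι κ ℂ) : frobSq B = ∑ k, vecSq (B.col k) := by
  simp only [frobSq, vecSq, Matrix.col_apply]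
  exact Finset.sum_comm

lemma frobSq_conjTranspose (B : Matrix ι κ ℂ) : frobSq Bᴴ = frobSq B := by
  simp only [frobSq, conjTranspose_apply, norm_star]
  exact Finset.sum_comm

lemma frobSq_vecMulVec (u : ι → ℂ) (v : κ → ℂ) : frobSq (vecMulVec u v) = vecSq u * vecSq v := by
  simp [frobSq, vecSq, vecMulVec_apply, mul_pow, Finset.sum_mul_sum]

lemma vecSq_add_three_le (u v w : ι → ℂ) :
    vecSq (u + v + w) ≤ 3 * (vecSq u + vecSq v + vecSq w) := by
  simp only [vecSq, ← Finset.sum_add_distrib, Finset.mul_sum]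
  refine Finset.sum_le_sum fun i _ => ?_
  have h : ‖(u + v + w) i‖ ≤ ‖u i‖ + ‖v i‖ + ‖w i‖ := norm_add₃_le
  nlinarith [norm_nonneg ((u + v + w) i), sq_nonneg (‖u i‖ - ‖v i‖), sq_nonneg (‖u i‖ - ‖w i‖),
    sq_nonneg (‖v i‖ - ‖w i‖)]

lemma norm_trace_mul_le (B : Matrix ι κ ℂ) (C : Matrix κ ι ℂ) :
    ‖trace (B * C)‖ ≤ √(frobSq B) * √(frobSq C) := by
  have h : trace (B * C) = (fun x : ι × κ => B x.1 x.2) ⬝ᵥ fun x : ι × κ => C x.2 x.1 := by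
    simp [trace, Matrix.mul_apply, dotProduct, Fintype.sum_prod_type]
  rw [h]
  refine (norm_dotProduct_le _ _).trans_eq ?_
  congr 2
  · simp [vecSq, frobSq, Fintype.sum_prod_type]
  · simp [vecSq, frobSq, Fintype.sum_prod_type]
    exact Finset.sum_comm

lemma vecSq_vecMul_le_frobSq (v : ι → ℂ) (B : Matrix ι κ ℂ) :
    vecSq (v ᵥ* B) ≤ vecSq v * frobSq B := by
  rw [frobSq_eq_sum_col, Finset.mul_sum]
  exact Finset.sum_le_sum fun k _ => norm_dotProduct_sq_le v (B.col k)

variable [DecidableEq κ]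

lemma vecSq_mulVec_le (B : Matrix ι κ ℂ) (v : κ → ℂ) : vecSq (B *ᵥ v) ≤ ‖B‖ ^ 2 * vecSq v := by
  have h := Matrix.l2_opNorm_mulVec B (WithLp.toLp 2 v)
  rw [vecSq_eq_norm_sq, vecSq_eq_norm_sq, ← mul_pow]
  exact pow_le_pow_left₀ (norm_nonneg _) h 2

lemma frobSq_mul_le_left (B : Matrix ι κ ℂ) (C : Matrix κ τ ℂ) :
    frobSq (B * C) ≤ ‖B‖ ^ 2 * frobSq C := by
  rw [frobSq_eq_sum_col, frobSq_eq_sum_col, Finset.mul_sum]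
  refine Finset.sum_le_sum fun k _ => ?_
  exact vecSq_mulVec_le B (C.col k)

lemma frobSq_mul_le_right [DecidableEq τ] (B : Matrix ι κ ℂ) (C : Matrix κ τ ℂ) :
    frobSq (B * C) ≤ frobSq B * ‖C‖ ^ 2 := by
  have h := frobSq_mul_le_left Cᴴ Bᴴ
  rwa [← conjTranspose_mul, frobSq_conjTranspose, frobSq_conjTranspose,
    Matrix.l2_opNorm_conjTranspose, mul_comm] at h

lemma frobSq_le_card_mul (B : Matrix ι κ ℂ) : frobSq B ≤ Fintype.card κ * ‖B‖ ^ 2 := by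
  have h := frobSq_mul_le_left B (1 : Matrix κ κ ℂ)
  rw [Matrix.mul_one] at h
  refine h.trans_eq ?_
  rw [mul_comm]
  congr 1
  simp [frobSq, Matrix.one_apply, apply_ite, ite_pow]

lemma vecSq_vecMul_le [DecidableEq ι] (v : ι → ℂ) (B : Matrix ι κ ℂ) :
    vecSq (v ᵥ* B) ≤ vecSq v * ‖B‖ ^ 2 := by
  have h := vecSq_mulVec_le Bᴴ (star v)
  rwa [mulVec_conjTranspose, star_star, vecSq_star, vecSq_star, Matrix.l2_opNorm_conjTranspose,
    mul_comm] at h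

/-- The numerical-range bound for inverses. -/
lemma isUnit_and_norm_inv_le_of_coercive (B : Matrix κ κ ℂ) {c : ℝ} (hc : 0 < c)
    (h : ∀ v : κ → ℂ, c * vecSq v ≤ ‖star v ⬝ᵥ (B *ᵥ v)‖) :
    IsUnit B ∧ ‖B⁻¹‖ ≤ 1 / c := by
  -- By Cauchy–Schwarz the form bound becomes a lower bound on the length of B v, which gives
  -- injectivity, hence invertibility, and then the bound on the inverse.
  have key : ∀ v : κ → ℂ, c * √(vecSq v) ≤ √(vecSq (B *ᵥ v)) := by
    intro v
    by_cases hv : vecSq v = 0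
    · simp [hv]
    have hpos : 0 < √(vecSq v) := Real.sqrt_pos.2 (lt_of_le_of_ne (vecSq_nonneg v) (Ne.symm hv))
    have h1 := (h v).trans (norm_dotProduct_le (star v) (B *ᵥ v))
    rw [vecSq_star] at h1
    have h2 : √(vecSq v) * √(vecSq v) = vecSq v := Real.mul_self_sqrt (vecSq_nonneg v)
    nlinarith
  have hU : IsUnit B := by
    rw [← Matrix.mulVec_injective_iff_isUnit]
    intro u v huv
    have h1 := key (u - v)
    have h0 : B *ᵥ (u - v) = 0 := by rw [Matrix.mulVec_sub]; exact sub_eq_zero.2 huv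
    rw [h0] at h1
    have h2 : vecSq (0 : κ → ℂ) = 0 := by simp [vecSq]
    rw [h2, Real.sqrt_zero] at h1
    have h3 : √(vecSq (u - v)) = 0 :=
      le_antisymm (by nlinarith [Real.sqrt_nonneg (vecSq (u - v))]) (Real.sqrt_nonneg _)
    rw [Real.sqrt_eq_zero (vecSq_nonneg _)] at h3
    exact sub_eq_zero.1 (eq_zero_of_vecSq_eq_zero h3)
  refine ⟨hU, ?_⟩
  rw [Matrix.l2_opNorm_def]
  refine ContinuousLinearMap.opNorm_le_bound _ (by positivity) fun x => ?_
  have h1 := key (B⁻¹ *ᵥ x.ofLp)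
  rw [Matrix.mulVec_mulVec, Matrix.mul_nonsing_inv _ ((Matrix.isUnit_iff_isUnit_det _).1 hU),
    Matrix.one_mulVec, vecSq_eq_norm_sq, vecSq_eq_norm_sq, Real.sqrt_sq (norm_nonneg _),
    Real.sqrt_sq (norm_nonneg _)] at h1
  rw [div_mul_eq_mul_div, one_mul, le_div_iff₀ hc, mul_comm]
  exact h1

end LinearAlgebra

/-! ### Complex numbers outside the half-line -/

lemma deltaZ_pos {z : ℂ} (hz : z ∉ nonnegAxis) : 0 < deltaZ z := by
  have hcl : IsClosed nonnegAxis := Complex.isometry_ofReal.isClosedEmbedding.isClosedMap _ isClosed_Ici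
  exact (hcl.notMem_iff_infDist_pos ⟨0, 0, by simp⟩).1 hz

lemma deltaZ_le {z : ℂ} {x : ℝ} (hx : 0 ≤ x) : deltaZ z ≤ ‖(x : ℂ) - z‖ := by
  rw [norm_sub_rev, ← dist_eq_norm]
  exact Metric.infDist_le_dist_of_mem ⟨x, hx, rfl⟩

lemma deltaZ_le_norm (z : ℂ) : deltaZ z ≤ ‖z‖ := by
  simpa using deltaZ_le (z := z) le_rfl

lemma deltaZ_le_abs_im {z : ℂ} (hz : 0 ≤ z.re) : deltaZ z ≤ |z.im| := by
  refine (deltaZ_le hz).trans_eq ?_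
  have : (z.re : ℂ) - z = -(z.im : ℂ) * Complex.I := by
    apply Complex.ext <;> simp
  rw [this]; simp

/-- The sign conditions shared by all averages of `c* (H - z)⁻¹ c` with `H` positive. -/
structure ResolventCone (z w : ℂ) : Prop where
  im_nonneg : 0 ≤ z.im * w.im
  im_mul_nonneg : 0 ≤ z.im * (z * w).im
  re_nonneg : z.re < 0 → 0 ≤ w.re
  re_mul_nonpos : z.re < 0 → (z * w).re ≤ 0

namespace ResolventCone

variable {z w w' : ℂ}

lemma zero : ResolventCone z 0 := by constructor <;> simp

lemma add (h : ResolventCone z w) (h' : ResolventCone z w') : ResolventCone z (w + w') where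
  im_nonneg := by rw [Complex.add_im, mul_add]; exact add_nonneg h.1 h'.1
  im_mul_nonneg := by rw [mul_add, Complex.add_im, mul_add]; exact add_nonneg h.2 h'.2
  re_nonneg hz := by rw [Complex.add_re]; exact add_nonneg (h.3 hz) (h'.3 hz)
  re_mul_nonpos hz := by rw [mul_add, Complex.add_re]; exact add_nonpos (h.4 hz) (h'.4 hz)

lemma ofReal_mul (h : ResolventCone z w) {c : ℝ} (hc : 0 ≤ c) : ResolventCone z (c * w) where
  im_nonneg := by
    rw [Complex.im_ofReal_mul, mul_left_comm]; exact mul_nonneg hc h.1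
  im_mul_nonneg := by
    rw [mul_left_comm, Complex.im_ofReal_mul, mul_left_comm]; exact mul_nonneg hc h.2
  re_nonneg hz := by rw [Complex.re_ofReal_mul]; exact mul_nonneg hc (h.3 hz)
  re_mul_nonpos hz := by
    rw [mul_left_comm, Complex.re_ofReal_mul]; exact mul_nonpos_of_nonneg_of_nonpos hc (h.4 hz)

lemma sum {ι : Type*} (s : Finset ι) {f : ι → ℂ} (h : ∀ i ∈ s, ResolventCone z (f i)) :
    ResolventCone z (∑ i ∈ s, f i) :=
  Finset.sum_induction _ _ (fun _ _ => add) zero h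

/-- For fixed z each of the four conditions is the nonnegativity of a real-linear functional of w,
and such functionals commute with the integral. -/
lemma integral {Ω : Type*} [MeasurableSpace Ω] {μ : Measure Ω} {f : Ω → ℂ} (hf : Integrable f μ)
    (h : ∀ ω, ResolventCone z (f ω)) : ResolventCone z (∫ ω, f ω ∂μ) := by
  have key : ∀ L : ℂ →L[ℝ] ℝ, (∀ ω, 0 ≤ L (f ω)) → 0 ≤ L (∫ ω, f ω ∂μ) := fun L hL => by
    rw [← L.integral_comp_comm hf]; exact integral_nonneg hL
  refine ⟨?_, ?_, fun hz => ?_, fun hz => ?_⟩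
  · exact key (z.im • Complex.imCLM) fun ω => (h ω).1
  · exact key (z.im • Complex.imCLM ∘L ContinuousLinearMap.mul ℝ ℂ z) fun ω => (h ω).2
  · exact key Complex.reCLM fun ω => (h ω).3 hz
  · have := key (-(Complex.reCLM ∘L ContinuousLinearMap.mul ℝ ℂ z)) fun ω => by
      simpa using (h ω).4 hz
    simpa using this

/-- Here zw = a z - b |z|², so Im w = b Im z, Im zw = a Im z, Re w = a - b Re z and Re zw = a Re z -
b |z|². -/
lemma of_eq_sub {a b : ℝ} (ha : 0 ≤ a) (hb : 0 ≤ b) (h : w = a - (starRingEnd ℂ) z * b) :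
    ResolventCone z w := by
  subst h
  refine ⟨?_, ?_, fun hz => ?_, fun hz => ?_⟩ <;> simp <;>
    nlinarith [mul_nonneg ha (sq_nonneg z.im), mul_nonneg hb (sq_nonneg z.im),
      mul_nonneg hb (sq_nonneg z.re)]

/-- If Re z ≥ 0, then Im zw has the sign of Im z, so |Im z(1 + w)| ≥ |Im z| ≥ δ_z. If Re z < 0, then
Re w ≥ 0 gives |1 + w| ≥ 1, and δ_z ≤ |z|. -/
lemma deltaZ_le_norm_mul (h : ResolventCone z w) : deltaZ z ≤ ‖z‖ * ‖1 + w‖ := by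
  rcases le_or_gt 0 z.re with hz | hz
  · refine (deltaZ_le_abs_im hz).trans ?_
    rw [← norm_mul]
    refine le_trans ?_ (Complex.abs_im_le_norm _)
    have h2 := h.2
    rw [mul_add, mul_one, Complex.add_im]
    apply sq_le_sq.1
    nlinarith [sq_nonneg (z*w).im]
  · have h3 := h.3 hz
    have h1 : 1 ≤ ‖1 + w‖ := by
      refine le_trans ?_ (Complex.re_le_norm _)
      simpa using h3
    calc deltaZ z ≤ ‖z‖ := deltaZ_le_norm z
      _ ≤ _ := le_mul_of_one_le_right (norm_nonneg _) h1

lemma one_add_ne_zero (h : ResolventCone z w) (hz : z ∉ nonnegAxis) : 1 + w ≠ 0 := by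
  intro h0
  have := h.deltaZ_le_norm_mul
  rw [h0, norm_zero, mul_zero] at this
  exact absurd (deltaZ_pos hz) (not_lt.2 this)

lemma norm_inv_one_add_le (h : ResolventCone z w) (hz : z ∉ nonnegAxis) :
    ‖(1 + w)⁻¹‖ ≤ ‖z‖ / deltaZ z := by
  have hp : 0 < ‖1 + w‖ := norm_pos_iff.2 (h.one_add_ne_zero hz)
  rw [norm_inv, le_div_iff₀ (deltaZ_pos hz), inv_mul_le_iff₀ hp, mul_comm]
  exact h.deltaZ_le_norm_mul

end ResolventCone

/-! ### Resolvents -/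

section Resolvent

variable {N n : ℕ} {z : ℂ}

lemma star_dotProduct_gram_sub_mulVec (S : Matrix (Fin N) (Fin n) ℂ) (z : ℂ) (v : Fin N → ℂ) :
    star v ⬝ᵥ ((S * Sᴴ - z • (1 : Matrix (Fin N) (Fin N) ℂ)) *ᵥ v) =
      (vecSq (Sᴴ *ᵥ v) : ℂ) - z * (vecSq v : ℂ) := by
  rw [Matrix.sub_mulVec, dotProduct_sub, Matrix.smul_mulVec, Matrix.one_mulVec, dotProduct_smul,
    star_dotProduct_self, smul_eq_mul, ← Matrix.mulVec_mulVec, ← star_dotProduct_self (Sᴴ *ᵥ v),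
    Matrix.dotProduct_mulVec, Matrix.star_mulVec, conjTranspose_conjTranspose]

lemma deltaZ_mul_le {a b : ℝ} (ha : 0 ≤ a) (hb : 0 ≤ b) :
    deltaZ z * b ≤ ‖(a : ℂ) - z * (b : ℂ)‖ := by
  rcases hb.eq_or_lt with rfl | hb
  · simp
  have h : (a : ℂ) - z * (b : ℂ) = (((a / b : ℝ) : ℂ) - z) * (b : ℂ) := by
    have : (b : ℂ) ≠ 0 := by exact_mod_cast hb.ne'
    push_cast; field_simp
  rw [h, norm_mul, Complex.norm_real, Real.norm_of_nonneg hb.le]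
  gcongr
  exact deltaZ_le (by positivity)

lemma gram_sub_isUnit_and_norm_le (hz : z ∉ nonnegAxis) (S : Matrix (Fin N) (Fin n) ℂ) :
    IsUnit (S * Sᴴ - z • (1 : Matrix (Fin N) (Fin N) ℂ)) ∧
      ‖resolventMatrix S z‖ ≤ 1 / deltaZ z := by
  refine isUnit_and_norm_inv_le_of_coercive _ (deltaZ_pos hz) fun v => ?_
  rw [star_dotProduct_gram_sub_mulVec]
  exact deltaZ_mul_le (vecSq_nonneg _) (vecSq_nonneg _)

lemma norm_resolvent_le (hz : z ∉ nonnegAxis) (S : Matrix (Fin N) (Fin n) ℂ) :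
    ‖resolventMatrix S z‖ ≤ 1 / deltaZ z := (gram_sub_isUnit_and_norm_le hz S).2

lemma resolvent_mul_gram_sub (hz : z ∉ nonnegAxis) (S : Matrix (Fin N) (Fin n) ℂ) :
    resolventMatrix S z * (S * Sᴴ - z • (1 : Matrix (Fin N) (Fin N) ℂ)) = 1 :=
  Matrix.nonsing_inv_mul _ ((Matrix.isUnit_iff_isUnit_det _).1 (gram_sub_isUnit_and_norm_le hz S).1)

lemma gram_sub_mul_resolvent (hz : z ∉ nonnegAxis) (S : Matrix (Fin N) (Fin n) ℂ) :
    (S * Sᴴ - z • (1 : Matrix (Fin N) (Fin N) ℂ)) * resolventMatrix S z = 1 :=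
  Matrix.mul_nonsing_inv _ ((Matrix.isUnit_iff_isUnit_det _).1 (gram_sub_isUnit_and_norm_le hz S).1)

lemma gram_mul_resolvent (hz : z ∉ nonnegAxis) (S : Matrix (Fin N) (Fin n) ℂ) :
    S * Sᴴ * resolventMatrix S z = 1 + z • resolventMatrix S z := by
  have h := gram_sub_mul_resolvent hz S
  rw [sub_mul, smul_mul_assoc, one_mul] at h
  rw [← h]; abel

lemma resolvent_mul_gram (hz : z ∉ nonnegAxis) (S : Matrix (Fin N) (Fin n) ℂ) :
    resolventMatrix S z * (S * Sᴴ) = 1 + z • resolventMatrix S z := by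
  have h := resolvent_mul_gram_sub hz S
  rw [mul_sub, mul_smul_comm, mul_one] at h
  rw [← h]; abel

lemma norm_one_add_smul_resolvent_le (hz : z ∉ nonnegAxis) (S : Matrix (Fin N) (Fin n) ℂ) :
    ‖1 + z • resolventMatrix S z‖ ≤ 1 + ‖z‖ / deltaZ z := by
  have h1 : ‖(1 : Matrix (Fin N) (Fin N) ℂ)‖ ≤ 1 := by
    rw [← Matrix.diagonal_one, Matrix.l2_opNorm_diagonal]
    exact (pi_norm_le_iff_of_nonneg zero_le_one).2 fun i => by simp
  refine (norm_add_le _ _).trans (add_le_add h1 ?_)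
  rw [norm_smul, div_eq_mul_one_div]
  gcongr
  exact norm_resolvent_le hz S

/-- (S*Q)*(S*Q) = Q*(SS*Q) = Q*(1 + zQ), so the bound does not involve the norm of S, which is
random and unbounded. -/
lemma norm_conjTranspose_mul_resolvent_sq_le (hz : z ∉ nonnegAxis)
    (S : Matrix (Fin N) (Fin n) ℂ) :
    ‖Sᴴ * resolventMatrix S z‖ ^ 2 ≤ (1 / deltaZ z) * (1 + ‖z‖ / deltaZ z) := by
  rw [sq, ← Matrix.l2_opNorm_conjTranspose_mul_self, conjTranspose_mul, conjTranspose_conjTranspose,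
    Matrix.mul_assoc, ← Matrix.mul_assoc S, gram_mul_resolvent hz]
  refine (norm_mul_le _ _).trans ?_
  rw [Matrix.l2_opNorm_conjTranspose]
  have := deltaZ_pos hz
  gcongr
  · exact norm_resolvent_le hz S
  · exact norm_one_add_smul_resolvent_le hz S

lemma norm_resolvent_mul_sq_le (hz : z ∉ nonnegAxis) (S : Matrix (Fin N) (Fin n) ℂ) :
    ‖resolventMatrix S z * S‖ ^ 2 ≤ (1 / deltaZ z) * (1 + ‖z‖ / deltaZ z) := by
  rw [← Matrix.l2_opNorm_conjTranspose, sq, ← Matrix.l2_opNorm_conjTranspose_mul_self,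
    conjTranspose_conjTranspose, conjTranspose_mul,
    Matrix.mul_assoc, ← Matrix.mul_assoc S, ← Matrix.mul_assoc, resolvent_mul_gram hz]
  refine (norm_mul_le _ _).trans ?_
  rw [Matrix.l2_opNorm_conjTranspose, mul_comm]
  have := deltaZ_pos hz
  gcongr
  · exact norm_resolvent_le hz S
  · exact norm_one_add_smul_resolvent_le hz S

/-- With v = Qc, c*Qc is the conjugate of v*(SS* - z)v = ‖S*v‖² - z‖v‖². -/
lemma resolventCone_dotProduct (hz : z ∉ nonnegAxis) (S : Matrix (Fin N) (Fin n) ℂ)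
    (c : Fin N → ℂ) : ResolventCone z (star c ⬝ᵥ (resolventMatrix S z *ᵥ c)) := by
  set v := resolventMatrix S z *ᵥ c with hv
  have hc : c = (S * Sᴴ - z • (1 : Matrix (Fin N) (Fin N) ℂ)) *ᵥ v := by
    rw [hv, Matrix.mulVec_mulVec, gram_sub_mul_resolvent hz, Matrix.one_mulVec]
  refine ResolventCone.of_eq_sub (vecSq_nonneg (Sᴴ *ᵥ v)) (vecSq_nonneg v) ?_
  have h := congrArg star (star_dotProduct_gram_sub_mulVec S z v)
  rw [← hc, Matrix.star_dotProduct, star_star] at h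
  rw [h]
  simp

lemma resolventCone_apply (hz : z ∉ nonnegAxis) (S : Matrix (Fin N) (Fin n) ℂ) (i : Fin N) :
    ResolventCone z (resolventMatrix S z i i) := by
  simpa using resolventCone_dotProduct hz S (Pi.single i 1)

lemma coresolvent_eq (S : Matrix (Fin N) (Fin n) ℂ) (z : ℂ) :
    coresolventMatrix S z = resolventMatrix Sᴴ z := by
  rw [coresolventMatrix, resolventMatrix, conjTranspose_conjTranspose]

/-- The transpose is preferred to the adjoint here because it keeps the law of the entries, whereas
the adjoint would conjugate it. -/
lemma coresolvent_eq_transpose (S : Matrix (Fin N) (Fin n) ℂ) (z : ℂ) :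
    coresolventMatrix S z = (resolventMatrix Sᵀ z)ᵀ := by
  rw [coresolventMatrix, resolventMatrix, Matrix.transpose_nonsing_inv]
  congr 1
  rw [transpose_sub, transpose_mul, transpose_smul, transpose_one, transpose_transpose]
  congr 2

lemma smul_coresolvent (hz : z ∉ nonnegAxis) (S : Matrix (Fin N) (Fin n) ℂ) :
    z • coresolventMatrix S z = Sᴴ * resolventMatrix S z * S - 1 := by
  have h1 : (Sᴴ * resolventMatrix S z * S - 1) * (Sᴴ * S - z • (1 : Matrix (Fin n) (Fin n) ℂ)) =
      z • (1 : Matrix (Fin n) (Fin n) ℂ) := by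
    have h2 : Sᴴ * resolventMatrix S z * S * (Sᴴ * S) =
        Sᴴ * S + z • (Sᴴ * resolventMatrix S z * S) := by
      calc Sᴴ * resolventMatrix S z * S * (Sᴴ * S)
          = Sᴴ * (resolventMatrix S z * (S * Sᴴ)) * S := by simp only [Matrix.mul_assoc]
        _ = _ := by rw [resolvent_mul_gram hz]; simp [Matrix.mul_add, Matrix.add_mul]
    rw [sub_mul, mul_sub, h2]
    simp
  have h3 := gram_sub_mul_resolvent hz Sᴴ
  rw [conjTranspose_conjTranspose, ← coresolvent_eq] at h3
  calc z • coresolventMatrix S z = (z • (1 : Matrix (Fin n) (Fin n) ℂ)) * coresolventMatrix S z := by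
        simp
    _ = _ := by rw [← h1, mul_assoc, h3, mul_one]

lemma continuous_resolvent (hz : z ∉ nonnegAxis) :
    Continuous fun S : Matrix (Fin N) (Fin n) ℂ => resolventMatrix S z := by
  rw [continuous_iff_continuousAt]
  intro S
  have hU := (gram_sub_isUnit_and_norm_le hz S).1
  simp only [resolventMatrix, Matrix.nonsing_inv_eq_ringInverse]
  have h1 : ContinuousAt Ring.inverse (S * Sᴴ - z • (1 : Matrix (Fin N) (Fin N) ℂ)) := by
    obtain ⟨u, hu⟩ := hU
    rw [← hu]
    exact NormedRing.inverse_continuousAt u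
  have h2 : Continuous fun S : Matrix (Fin N) (Fin n) ℂ =>
      S * Sᴴ - z • (1 : Matrix (Fin N) (Fin N) ℂ) := by fun_prop
  exact ContinuousAt.comp (f := fun S : Matrix (Fin N) (Fin n) ℂ =>
      S * Sᴴ - z • (1 : Matrix (Fin N) (Fin N) ℂ)) h1 h2.continuousAt

/-! ### Removing one column -/

lemma gram_eq_updateCol_add (S : Matrix (Fin N) (Fin n) ℂ) (j : Fin n) :
    S * Sᴴ = S.updateCol j 0 * (S.updateCol j 0)ᴴ + vecMulVec (S.col j) (star (S.col j)) := by
  ext i k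
  simp only [Matrix.mul_apply, conjTranspose_apply, Matrix.add_apply, vecMulVec_apply,
    Matrix.updateCol_apply, Matrix.col_apply, Pi.star_apply]
  rw [← Finset.add_sum_erase _ _ (Finset.mem_univ j),
    ← Finset.add_sum_erase (Finset.univ) (fun x => (if x = j then (0 : Fin N → ℂ) i else S i x) *
      star (if x = j then (0 : Fin N → ℂ) k else S k x)) (Finset.mem_univ j)]
  simp only [if_true, Pi.zero_apply, zero_mul, zero_add]
  rw [add_comm]
  congr 1
  refine Finset.sum_congr rfl fun x hx => ?_
  simp [Finset.ne_of_mem_erase hx]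

/-- The quadratic form `η_j* Q_j η_j` of the `j`-th column in the resolvent without it. -/
noncomputable def leaveOutForm (S : Matrix (Fin N) (Fin n) ℂ) (z : ℂ) (j : Fin n) : ℂ :=
  star (S.col j) ⬝ᵥ (resolventMatrix (S.updateCol j 0) z *ᵥ S.col j)

lemma one_add_leaveOutForm_ne_zero (hz : z ∉ nonnegAxis) (S : Matrix (Fin N) (Fin n) ℂ)
    (j : Fin n) : 1 + leaveOutForm S z j ≠ 0 :=
  (resolventCone_dotProduct hz _ _).one_add_ne_zero hz

lemma gram_sub_eq_updateCol_add (S : Matrix (Fin N) (Fin n) ℂ) (z : ℂ) (j : Fin n) :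
    S * Sᴴ - z • (1 : Matrix (Fin N) (Fin N) ℂ) =
      (S.updateCol j 0 * (S.updateCol j 0)ᴴ - z • (1 : Matrix (Fin N) (Fin N) ℂ)) +
        vecMulVec (S.col j) (star (S.col j)) := by
  rw [gram_eq_updateCol_add S j]; abel

/-- Sherman–Morrison: SS* - z is the leave-out matrix plus η_jη_j*, so multiplying η_j*Q_j by it on
the right gives (1 + η_j*Q_jη_j) η_j*. -/
lemma star_col_vecMul_resolvent (hz : z ∉ nonnegAxis) (S : Matrix (Fin N) (Fin n) ℂ) (j : Fin n) :
    star (S.col j) ᵥ* resolventMatrix S z =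
      (1 + leaveOutForm S z j)⁻¹ •
        (star (S.col j) ᵥ* resolventMatrix (S.updateCol j 0) z) := by
  have h : (star (S.col j) ᵥ* resolventMatrix (S.updateCol j 0) z) ᵥ*
      (S * Sᴴ - z • (1 : Matrix (Fin N) (Fin N) ℂ)) =
      (1 + leaveOutForm S z j) • star (S.col j) := by
    rw [gram_sub_eq_updateCol_add S z j, Matrix.vecMul_add, Matrix.vecMul_vecMul,
      resolvent_mul_gram_sub hz, Matrix.vecMul_one, add_smul, one_smul, leaveOutForm,
      Matrix.vecMul_vecMulVec, Matrix.dotProduct_mulVec]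
  have h2 := congrArg (fun v => v ᵥ* resolventMatrix S z) h
  simp only [Matrix.vecMul_vecMul _ _ (resolventMatrix S z), gram_sub_mul_resolvent hz,
    Matrix.vecMul_one, Matrix.smul_vecMul] at h2
  rw [h2, smul_smul, inv_mul_cancel₀ (one_add_leaveOutForm_ne_zero hz S j), one_smul]

lemma resolvent_mulVec_col (hz : z ∉ nonnegAxis) (S : Matrix (Fin N) (Fin n) ℂ) (j : Fin n) :
    resolventMatrix S z *ᵥ S.col j =
      (1 + leaveOutForm S z j)⁻¹ • (resolventMatrix (S.updateCol j 0) z *ᵥ S.col j) := by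
  have h : (S * Sᴴ - z • (1 : Matrix (Fin N) (Fin N) ℂ)) *ᵥ
      (resolventMatrix (S.updateCol j 0) z *ᵥ S.col j) =
      (1 + leaveOutForm S z j) • S.col j := by
    rw [gram_sub_eq_updateCol_add S z j, Matrix.add_mulVec, Matrix.mulVec_mulVec,
      gram_sub_mul_resolvent hz, Matrix.one_mulVec, add_smul, one_smul, leaveOutForm,
      Matrix.vecMulVec_mulVec]
    simp
  have h2 := congrArg (fun v => resolventMatrix S z *ᵥ v) h
  simp only [Matrix.mulVec_mulVec _ (resolventMatrix S z), resolvent_mul_gram_sub hz,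
    Matrix.one_mulVec, Matrix.mulVec_smul] at h2
  rw [h2, smul_smul, inv_mul_cancel₀ (one_add_leaveOutForm_ne_zero hz S j), one_smul]

lemma resolvent_eq_sub (hz : z ∉ nonnegAxis) (S : Matrix (Fin N) (Fin n) ℂ) (j : Fin n) :
    resolventMatrix S z = resolventMatrix (S.updateCol j 0) z -
      (1 + leaveOutForm S z j)⁻¹ •
        vecMulVec (resolventMatrix (S.updateCol j 0) z *ᵥ S.col j)
          (star (S.col j) ᵥ* resolventMatrix (S.updateCol j 0) z) := by
  set Q0 := resolventMatrix (S.updateCol j 0) z with hQ0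
  have h1 : resolventMatrix S z * vecMulVec (S.col j) (star (S.col j)) * Q0 =
      Q0 - resolventMatrix S z := by
    have h := resolvent_mul_gram_sub hz S
    rw [gram_sub_eq_updateCol_add S z j, mul_add] at h
    rw [← eq_sub_iff_add_eq'] at h
    rw [h, sub_mul, one_mul, mul_assoc, hQ0, gram_sub_mul_resolvent hz, mul_one]
  rw [Matrix.mul_vecMulVec, Matrix.vecMulVec_mul, resolvent_mulVec_col hz S j] at h1
  rw [← hQ0, Matrix.smul_vecMulVec] at h1
  rw [h1]; abel

/-- With w the leave-out form, zQ̃ = S*QS - 1 and η_j*Qη_j = w/(1 + w), so -zQ̃_jj = 1 - w/(1 + w).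
-/
lemma neg_mul_coresolvent_apply (hz : z ∉ nonnegAxis) (S : Matrix (Fin N) (Fin n) ℂ) (j : Fin n) :
    -z * coresolventMatrix S z j j = (1 + leaveOutForm S z j)⁻¹ := by
  have h := congrFun (congrFun (smul_coresolvent hz S) j) j
  have h1 : (Sᴴ * resolventMatrix S z * S) j j =
      (star (S.col j) ᵥ* resolventMatrix S z) ⬝ᵥ S.col j := by
    rw [Matrix.mul_apply']
    rfl
  rw [Matrix.smul_apply, Matrix.sub_apply, h1, star_col_vecMul_resolvent hz, smul_dotProduct,
    ← Matrix.dotProduct_mulVec, ← leaveOutForm, Matrix.one_apply_eq, smul_eq_mul, smul_eq_mul] at h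
  have h0 := one_add_leaveOutForm_ne_zero hz S j
  rw [neg_mul, h]
  field_simp
  ring

end Resolvent

/-! ### Bounds in `L²` -/

section L2

variable {Ω : Type*} [MeasurableSpace Ω] {μ : Measure Ω}

/-- `f` is measurable with `L²` norm at most `c`. -/
def L2Bound (μ : Measure Ω) (f : Ω → ℂ) (c : ℝ) : Prop :=
  AEStronglyMeasurable f μ ∧ eLpNorm f 2 μ ≤ ENNReal.ofReal c

lemma eLpNorm_two_sq (f : Ω → ℂ) : eLpNorm f 2 μ ^ 2 = ∫⁻ ω, ‖f ω‖ₑ ^ 2 ∂μ := by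
  have h := eLpNorm_nnreal_pow_eq_lintegral (f := f) (μ := μ) (p := 2) (by norm_num)
  have h2 : ((2 : NNReal) : ℝ) = ((2 : ℕ) : ℝ) := by norm_num
  rw [h2] at h
  simp only [ENNReal.rpow_natCast] at h
  exact_mod_cast h

lemma l2Bound_iff_lintegral {f : Ω → ℂ} {c : ℝ} (hc : 0 ≤ c) (hf : AEStronglyMeasurable f μ) :
    L2Bound μ f c ↔ ∫⁻ ω, ‖f ω‖ₑ ^ 2 ∂μ ≤ ENNReal.ofReal (c ^ 2) := by
  rw [← eLpNorm_two_sq, ENNReal.ofReal_pow hc]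
  simp only [L2Bound, hf, true_and]
  exact (ENNReal.pow_le_pow_left_iff two_ne_zero).symm

namespace L2Bound

variable {f g : Ω → ℂ} {c c' : ℝ}

lemma memLp (h : L2Bound μ f c) : MemLp f 2 μ := ⟨h.1, h.2.trans_lt ENNReal.ofReal_lt_top⟩

lemma mono (h : L2Bound μ f c) (hc : c ≤ c') : L2Bound μ f c' :=
  ⟨h.1, h.2.trans (ENNReal.ofReal_le_ofReal hc)⟩

lemma congr (h : L2Bound μ f c) (hgf : ∀ ω, g ω = f ω) : L2Bound μ g c := by
  rwa [funext hgf]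

lemma of_integral (hf : MemLp f 2 μ) (hc : 0 ≤ c) (h : ∫ ω, ‖f ω‖ ^ 2 ∂μ ≤ c ^ 2) :
    L2Bound μ f c := by
  rw [l2Bound_iff_lintegral hc hf.1]
  have h1 : ∀ ω, ‖f ω‖ₑ ^ 2 = ENNReal.ofReal (‖f ω‖ ^ 2) := fun ω => by
    rw [ENNReal.ofReal_pow (norm_nonneg _), ofReal_norm]
  simp_rw [h1]
  rw [← ofReal_integral_eq_lintegral_ofReal hf.norm.integrable_sq
    (Filter.Eventually.of_forall fun ω => by positivity)]
  exact ENNReal.ofReal_le_ofReal h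

lemma integral_sq_le (h : L2Bound μ f c) (hc : 0 ≤ c) : ∫ ω, ‖f ω‖ ^ 2 ∂μ ≤ c ^ 2 := by
  have h2 := (l2Bound_iff_lintegral hc h.1).1 h
  have h1 : ∀ ω, ‖f ω‖ₑ ^ 2 = ENNReal.ofReal (‖f ω‖ ^ 2) := fun ω => by
    rw [ENNReal.ofReal_pow (norm_nonneg _), ofReal_norm]
  simp_rw [h1] at h2
  rw [← ofReal_integral_eq_lintegral_ofReal h.memLp.norm.integrable_sq
    (Filter.Eventually.of_forall fun ω => by positivity)] at h2
  exact (ENNReal.ofReal_le_ofReal_iff (by positivity)).1 h2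

lemma add (h : L2Bound μ f c) (h' : L2Bound μ g c') (hc : 0 ≤ c) (hc' : 0 ≤ c') :
    L2Bound μ (fun ω => f ω + g ω) (c + c') := by
  refine ⟨h.1.add h'.1, ?_⟩
  rw [ENNReal.ofReal_add hc hc']
  exact (eLpNorm_add_le h.1 h'.1 (by norm_num)).trans (add_le_add h.2 h'.2)

lemma sub (h : L2Bound μ f c) (h' : L2Bound μ g c') (hc : 0 ≤ c) (hc' : 0 ≤ c') :
    L2Bound μ (fun ω => f ω - g ω) (c + c') := by
  refine ⟨h.1.sub h'.1, ?_⟩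
  rw [ENNReal.ofReal_add hc hc']
  exact (eLpNorm_sub_le h.1 h'.1 (by norm_num)).trans (add_le_add h.2 h'.2)

lemma of_norm_le (h : L2Bound μ f c) (hg : AEStronglyMeasurable g μ) {b : ℝ} (hb : 0 ≤ b)
    (hgf : ∀ ω, ‖g ω‖ ≤ b * ‖f ω‖) : L2Bound μ g (b * c) := by
  refine ⟨hg, ?_⟩
  have h1 := eLpNorm_le_mul_eLpNorm_of_ae_le_mul (μ := μ) (p := 2)
    (Filter.Eventually.of_forall hgf)
  rw [ENNReal.ofReal_mul hb]
  exact h1.trans (by gcongr; exact h.2)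

lemma bdd_mul (h : L2Bound μ f c) (hg : AEStronglyMeasurable g μ) {b : ℝ} (hb : 0 ≤ b)
    (hgb : ∀ ω, ‖g ω‖ ≤ b) : L2Bound μ (fun ω => g ω * f ω) (b * c) :=
  h.of_norm_le (hg.mul h.1) hb fun ω => by
    rw [Pi.mul_apply, norm_mul]; gcongr; exact hgb ω

lemma of_bounded [IsProbabilityMeasure μ] (hf : AEStronglyMeasurable f μ)
    (h : ∀ ω, ‖f ω‖ ≤ c) : L2Bound μ f c := by
  refine ⟨hf, ?_⟩
  have := eLpNorm_le_of_ae_bound (p := 2) (Filter.Eventually.of_forall (f := ae μ) h)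
  simpa using this

lemma integrable [IsFiniteMeasure μ] (h : L2Bound μ f c) : Integrable f μ :=
  h.memLp.integrable (by norm_num)

lemma integrable_mul (h : L2Bound μ f c) (h' : L2Bound μ g c') :
    Integrable (fun ω => f ω * g ω) μ := h.memLp.integrable_mul h'.memLp

lemma norm_integral_mul_le (h : L2Bound μ f c) (h' : L2Bound μ g c') (hc : 0 ≤ c) (hc' : 0 ≤ c') :
    ‖∫ ω, f ω * g ω ∂μ‖ ≤ c * c' := by
  have h1 : ‖∫ ω, f ω * g ω ∂μ‖ₑ ≤ ENNReal.ofReal (c * c') := by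
    refine (enorm_integral_le_lintegral_enorm _).trans ?_
    have h2 := eLpNorm_smul_le_mul_eLpNorm (p := 2) (q := 2) (r := 1) h'.1 h.1
    rw [eLpNorm_one_eq_lintegral_enorm] at h2
    rw [ENNReal.ofReal_mul hc]
    exact h2.trans (mul_le_mul' h.2 h'.2)
  rw [← ofReal_norm] at h1
  exact (ENNReal.ofReal_le_ofReal_iff (mul_nonneg hc hc')).1 h1

end L2Bound

lemma integral_norm_sq_sum_of_orthogonal {ι : Type*} (s : Finset ι) (f : ι → Ω → ℂ)
    (hf : ∀ i ∈ s, MemLp (f i) 2 μ)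
    (ho : ∀ i ∈ s, ∀ k ∈ s, i ≠ k → ∫ ω, f i ω * star (f k ω) ∂μ = 0) (c : ι → ℂ) :
    ∫ ω, ‖∑ i ∈ s, c i * f i ω‖ ^ 2 ∂μ = ∑ i ∈ s, ‖c i‖ ^ 2 * ∫ ω, ‖f i ω‖ ^ 2 ∂μ := by
  classical
  have hInt : ∀ i ∈ s, ∀ k ∈ s, Integrable (fun ω => f i ω * star (f k ω)) μ := fun i hi k hk =>
    (hf i hi).integrable_mul (hf k hk).star
  have hsq : ∀ w : ℂ, ((‖w‖ ^ 2 : ℝ) : ℂ) = w * star w := fun w => by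
    rw [RCLike.star_def, Complex.mul_conj']; push_cast; rfl
  apply Complex.ofReal_injective
  rw [← integral_complex_ofReal]
  push_cast [← integral_complex_ofReal]
  have h1 : ∀ ω, ((‖∑ i ∈ s, c i * f i ω‖ : ℂ)) ^ 2 =
      ∑ i ∈ s, ∑ k ∈ s, (c i * star (c k)) * (f i ω * star (f k ω)) := fun ω => by
    have := hsq (∑ i ∈ s, c i * f i ω)
    push_cast at this
    rw [this, star_sum, Finset.sum_mul_sum]
    refine Finset.sum_congr rfl fun i _ => Finset.sum_congr rfl fun k _ => ?_
    rw [star_mul']; ring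
  simp_rw [h1]
  rw [integral_finsetSum _ fun i hi => integrable_finsetSum _ fun k hk =>
    (hInt i hi k hk).const_mul _]
  refine Finset.sum_congr rfl fun i hi => ?_
  rw [integral_finsetSum _ fun k hk => (hInt i hi k hk).const_mul _]
  simp_rw [integral_const_mul]
  rw [Finset.sum_eq_single_of_mem i hi fun k hk hki => by rw [ho i hi k hk (Ne.symm hki), mul_zero]]
  have h2 := hsq (c i)
  push_cast at h2
  rw [h2]
  congr 1
  refine integral_congr_ae (Filter.Eventually.of_forall fun ω => ?_)
  have h3 := hsq (f i ω)
  push_cast at h3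
  exact h3.symm

lemma l2Bound_sum_of_orthogonal {ι : Type*} (s : Finset ι) (f : ι → Ω → ℂ)
    (hf : ∀ i ∈ s, MemLp (f i) 2 μ)
    (ho : ∀ i ∈ s, ∀ k ∈ s, i ≠ k → ∫ ω, f i ω * star (f k ω) ∂μ = 0) (c : ι → ℂ)
    {t : ℝ} (ht : 0 ≤ t) (hv : ∀ i ∈ s, ∫ ω, ‖f i ω‖ ^ 2 ∂μ ≤ t) :
    L2Bound μ (fun ω => ∑ i ∈ s, c i * f i ω) √(t * ∑ i ∈ s, ‖c i‖ ^ 2) := by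
  refine L2Bound.of_integral (memLp_finsetSum _ fun i hi => (hf i hi).const_mul _)
    (Real.sqrt_nonneg _) ?_
  rw [Real.sq_sqrt (by positivity), integral_norm_sq_sum_of_orthogonal s f hf ho c, mul_comm,
    Finset.sum_mul]
  exact Finset.sum_le_sum fun i hi => by gcongr; exact hv i hi

end L2

/-! ### Linear and quadratic forms in i.i.d. variables -/

/-- A centred law on `ℂ` of variance one with fourth absolute moment at most `T`. -/
structure EntryLaw (ν : Measure ℂ) (T : ℝ) : Prop where
  mean : ∫ x, x ∂ν = 0
  variance : ∫ x, ‖x‖ ^ 2 ∂ν = 1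
  integrable_fourth : Integrable (fun x : ℂ => ‖x‖ ^ 4) ν
  fourth_le : ∫ x, ‖x‖ ^ 4 ∂ν ≤ T

set_option linter.unusedSectionVars false

namespace EntryLaw

variable {ν : Measure ℂ} [IsProbabilityMeasure ν] {T : ℝ} {N : ℕ}

lemma memLp_four (h : EntryLaw ν T) : MemLp (fun x : ℂ => x) 4 ν := by
  rw [← integrable_norm_rpow_iff (by fun_prop) (by norm_num) (by norm_num)]
  simpa using h.integrable_fourth

lemma memLp_two (h : EntryLaw ν T) : MemLp (fun x : ℂ => x) 2 ν :=
  h.memLp_four.mono_exponent (by norm_num)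

lemma integrable_sq (h : EntryLaw ν T) : Integrable (fun x : ℂ => ‖x‖ ^ 2) ν :=
  h.memLp_two.norm.integrable_sq

lemma integrable_id (h : EntryLaw ν T) : Integrable (fun x : ℂ => x) ν :=
  h.memLp_two.integrable (by norm_num)

lemma mean_star (h : EntryLaw ν T) : ∫ x, star x ∂ν = 0 := by
  have : ∫ x, star x ∂ν = (starRingEnd ℂ) (∫ x, x ∂ν) := integral_conj
  rw [this, h.mean, map_zero]

lemma variance_complex (h : EntryLaw ν T) : ∫ x, star x * x ∂ν = 1 := by
  have : ∀ x : ℂ, star x * x = ((‖x‖ ^ 2 : ℝ) : ℂ) := fun x => by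
    rw [RCLike.star_def, Complex.conj_mul']; push_cast; rfl
  simp_rw [this]
  rw [integral_complex_ofReal, h.variance, Complex.ofReal_one]

lemma integrable_eval {E : Type*} [NormedAddCommGroup E] {f : ℂ → E} (hf : Integrable f ν)
    (i : Fin N) : Integrable (fun x : Fin N → ℂ => f (x i)) (Measure.pi fun _ => ν) :=
  (measurePreserving_eval (fun _ : Fin N => ν) i).integrable_comp_of_integrable hf

lemma integral_eval {E : Type*} [NormedAddCommGroup E] [NormedSpace ℝ E] {f : ℂ → E}
    (hf : AEStronglyMeasurable f ν) (i : Fin N) :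
    ∫ x : Fin N → ℂ, f (x i) ∂(Measure.pi fun _ => ν) = ∫ x, f x ∂ν := by
  have h := (measurePreserving_eval (fun _ : Fin N => ν) i).map_eq
  conv_rhs => rw [← h]
  rw [integral_map (measurable_pi_apply i).aemeasurable (by rwa [h])]

lemma integrable_eval_mul {𝕜 : Type*} [RCLike 𝕜] {f g : ℂ → 𝕜} (hf : Integrable f ν)
    (hg : Integrable g ν) {i k : Fin N} (hik : i ≠ k) :
    Integrable (fun x : Fin N → ℂ => f (x i) * g (x k)) (Measure.pi fun _ => ν) := by
  have h := Integrable.fintype_prod (μ := fun _ : Fin N => ν)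
    (f := fun l x => (if l = i then f x else 1) * (if l = k then g x else 1)) (fun l => by
      by_cases h1 : l = i
      · simpa [h1, hik] using hf
      · by_cases h2 : l = k
        · simpa [h2, hik.symm] using hg
        · simp [h1, h2])
  refine h.congr (Filter.Eventually.of_forall fun x => ?_)
  simp only [Finset.prod_mul_distrib, Finset.prod_ite_eq']; simp

lemma integral_eval_mul {𝕜 : Type*} [RCLike 𝕜] {f g : ℂ → 𝕜} {i k : Fin N} (hik : i ≠ k) :
    ∫ x : Fin N → ℂ, f (x i) * g (x k) ∂(Measure.pi fun _ => ν) = (∫ x, f x ∂ν) * ∫ x, g x ∂ν := by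
  have h := integral_fintype_prod_eq_prod (𝕜 := 𝕜) (μ := fun _ : Fin N => ν)
    (fun l x => (if l = i then f x else 1) * (if l = k then g x else 1))
  have h2 : ∀ x : Fin N → ℂ, ∏ l, ((if l = i then f (x l) else 1) * (if l = k then g (x l) else 1))
      = f (x i) * g (x k) := fun x => by
    rw [Finset.prod_mul_distrib, Finset.prod_ite_eq', Finset.prod_ite_eq']; simp
  simp_rw [h2] at h
  rw [h]
  have h3 : ∀ l, ∫ x, (if l = i then f x else 1) * (if l = k then g x else 1) ∂ν =
      (if l = i then ∫ x, f x ∂ν else 1) * (if l = k then ∫ x, g x ∂ν else 1) := fun l => by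
    by_cases h1 : l = i
    · have : l ≠ k := fun h => hik (h1.symm.trans h)
      simp [h1, hik]
    · simp [h1]; split_ifs <;> simp
  simp_rw [h3]
  rw [Finset.prod_mul_distrib, Finset.prod_ite_eq', Finset.prod_ite_eq']; simp

/-- Some index carries exactly one factor, which integrates to zero. The ordering of both pairs is
essential: a pair and its reversal would leave a factor 𝔼x², which is not assumed to vanish. -/
lemma integral_four_eq_zero (h : EntryLaw ν T) {i k i' k' : Fin N} (hik : i < k) (hik' : i' < k')
    (hne : (i, k) ≠ (i', k')) :
    ∫ x : Fin N → ℂ, star (x i) * x k * star (star (x i') * x k') ∂(Measure.pi fun _ => ν) = 0 := by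
  have hp := integral_fintype_prod_eq_prod (𝕜 := ℂ) (μ := fun _ : Fin N => ν)
    (fun l x => (if l = i then star x else 1) * (if l = k then x else 1) *
      ((if l = i' then x else 1) * (if l = k' then star x else 1)))
  have h2 : ∀ x : Fin N → ℂ, ∏ l, ((if l = i then star (x l) else 1) * (if l = k then x l else 1) *
      ((if l = i' then x l else 1) * (if l = k' then star (x l) else 1)))
      = star (x i) * x k * star (star (x i') * x k') := fun x => by
    simp only [Finset.prod_mul_distrib, Finset.prod_ite_eq']; simp
  simp_rw [h2] at hp
  rw [hp]
  have hone : ∃ l, ∫ x, (if l = i then star x else 1) * (if l = k then x else 1) *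
      ((if l = i' then x else 1) * (if l = k' then star x else 1)) ∂ν = 0 := by
    rcases eq_or_ne i i' with rfl | hii
    · have hkk : k ≠ k' := fun hk => hne (by rw [hk])
      exact ⟨k, by simp [hik.ne', hkk, h.mean]⟩
    · rcases eq_or_ne i k' with rfl | hik2
      -- Here i' < k' = i < k, so i' occurs only once.
      · exact ⟨i', by simp [hii.symm, (hik'.trans hik).ne, h.mean]⟩
      · exact ⟨i, by simpa [hii, hik2, hik.ne] using h.mean_star⟩
  obtain ⟨l, hl⟩ := hone
  exact Finset.prod_eq_zero (Finset.mem_univ l) hl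

lemma memLp_eval (h : EntryLaw ν T) (i : Fin N) :
    MemLp (fun x : Fin N → ℂ => x i) 2 (Measure.pi fun _ => ν) :=
  h.memLp_two.comp_measurePreserving (measurePreserving_eval (fun _ : Fin N => ν) i)

lemma l2Bound_linear (h : EntryLaw ν T) (b : Fin N → ℂ) :
    L2Bound (Measure.pi fun _ => ν) (fun x : Fin N → ℂ => b ⬝ᵥ x) √(vecSq b) := by
  have := l2Bound_sum_of_orthogonal (μ := Measure.pi fun _ => ν) Finset.univ
    (fun (i : Fin N) (x : Fin N → ℂ) => x i) (fun i _ => h.memLp_eval i)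
    (fun i _ k _ hik => by
      rw [integral_eval_mul (f := fun x => x) (g := star) hik, h.mean, zero_mul]) b zero_le_one
    (fun i _ => by
      rw [integral_eval (f := fun x : ℂ => ‖x‖ ^ 2) (by fun_prop), h.variance])
  simpa [vecSq, dotProduct] using this

lemma l2Bound_star_linear (h : EntryLaw ν T) (b : Fin N → ℂ) :
    L2Bound (Measure.pi fun _ => ν) (fun x : Fin N → ℂ => star x ⬝ᵥ b) √(vecSq b) := by
  have h1 := h.l2Bound_linear (star b)
  rw [vecSq_star] at h1
  have h2 := h1.of_norm_le (g := fun x : Fin N → ℂ => star x ⬝ᵥ b) (by fun_prop) zero_le_one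
    (fun x => by rw [one_mul, Matrix.star_dotProduct, norm_star, dotProduct_comm])
  simpa using h2

lemma memLp_star_mul (h : EntryLaw ν T) {i k : Fin N} (hik : i ≠ k) :
    MemLp (fun x : Fin N → ℂ => star (x i) * x k) 2 (Measure.pi fun _ => ν) := by
  rw [memLp_two_iff_integrable_sq_norm (by fun_prop)]
  simp only [norm_mul, norm_star, mul_pow]
  exact integrable_eval_mul h.integrable_sq h.integrable_sq hik

lemma l2Bound_upper (h : EntryLaw ν T) (c : Fin N × Fin N → ℂ) :
    L2Bound (Measure.pi fun _ => ν)
      (fun x : Fin N → ℂ => ∑ p : Fin N × Fin N with p.1 < p.2, c p * (star (x p.1) * x p.2))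
      √(∑ p : Fin N × Fin N with p.1 < p.2, ‖c p‖ ^ 2) := by
  have := l2Bound_sum_of_orthogonal (μ := Measure.pi fun _ => ν)
    (Finset.univ.filter fun p : Fin N × Fin N => p.1 < p.2)
    (fun p (x : Fin N → ℂ) => star (x p.1) * x p.2)
    (fun p hp => h.memLp_star_mul (Finset.mem_filter.1 hp).2.ne)
    (fun p hp q hq hpq => h.integral_four_eq_zero (Finset.mem_filter.1 hp).2
      (Finset.mem_filter.1 hq).2 hpq) c zero_le_one
    (fun p hp => by
      simp only [norm_mul, norm_star, mul_pow]
      rw [integral_eval_mul (f := fun x : ℂ => ‖x‖ ^ 2) (g := fun x : ℂ => ‖x‖ ^ 2)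
        (Finset.mem_filter.1 hp).2.ne, h.variance, one_mul])
  simpa using this

lemma l2Bound_diag (h : EntryLaw ν T) (hT : 0 ≤ T) (c : Fin N → ℂ) :
    L2Bound (Measure.pi fun _ => ν)
      (fun x : Fin N → ℂ => ∑ i, c i * (star (x i) * x i - 1)) √(T * ∑ i, ‖c i‖ ^ 2) := by
  have hn : ∀ x : ℂ, ‖star x * x - 1‖ ^ 2 = ‖x‖ ^ 4 - 2 * ‖x‖ ^ 2 + 1 := fun x => by
    have : star x * x - 1 = ((‖x‖ ^ 2 - 1 : ℝ) : ℂ) := by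
      rw [RCLike.star_def, Complex.conj_mul']; push_cast; rfl
    rw [this, Complex.norm_real, Real.norm_eq_abs, sq_abs]; ring
  have hi : Integrable (fun x : ℂ => ‖x‖ ^ 4 - 2 * ‖x‖ ^ 2 + 1) ν :=
    (h.integrable_fourth.sub (h.integrable_sq.const_mul 2)).add (integrable_const 1)
  have hi' : Integrable (fun x : ℂ => star x * x) ν := by
    have := h.memLp_two.star.integrable_mul h.memLp_two
    exact this
  refine l2Bound_sum_of_orthogonal (μ := Measure.pi fun _ => ν) Finset.univ
    (fun (i : Fin N) (x : Fin N → ℂ) => star (x i) * x i - 1) (fun i _ => ?_)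
    (fun i _ k _ hik => ?_) c hT (fun i _ => ?_)
  · rw [memLp_two_iff_integrable_sq_norm (by fun_prop)]
    simp only [hn]
    exact integrable_eval hi i
  · rw [integral_eval_mul (f := fun x : ℂ => star x * x - 1)
      (g := fun x : ℂ => star (star x * x - 1)) hik, integral_sub hi' (integrable_const 1),
      h.variance_complex]
    simp
  · simp only [hn]
    rw [integral_eval (f := fun x : ℂ => ‖x‖ ^ 4 - 2 * ‖x‖ ^ 2 + 1) (by fun_prop),
      integral_add (f := fun x : ℂ => ‖x‖ ^ 4 - 2 * ‖x‖ ^ 2)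
        (h.integrable_fourth.sub (h.integrable_sq.const_mul 2)) (integrable_const 1),
      integral_sub h.integrable_fourth (h.integrable_sq.const_mul 2), integral_const_mul,
      h.variance]
    have := h.fourth_le
    simp
    linarith

/-- The form splits into its strictly upper, strictly lower and centred diagonal parts. Each is a
combination of orthogonal variables, of variance one off the diagonal and at most T on it; the lower
part is the conjugate of an upper part. The triangle inequality gives the factor 3. -/
lemma l2Bound_quadratic (h : EntryLaw ν T) (hT : 1 ≤ T) (B : Matrix (Fin N) (Fin N) ℂ) :
    L2Bound (Measure.pi fun _ => ν)
      (fun x : Fin N → ℂ => star x ⬝ᵥ (B *ᵥ x) - trace B) (3 * √(T * frobSq B)) := by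
  have hT0 : 0 ≤ T := zero_le_one.trans hT
  have hB := frobSq_nonneg B
  have hpair : frobSq B = ∑ p : Fin N × Fin N, ‖B p.1 p.2‖ ^ 2 := by
    rw [Fintype.sum_prod_type]; rfl
  have hTB : frobSq B ≤ T * frobSq B := le_mul_of_one_le_left hB hT
  have hu := (h.l2Bound_upper fun p => B p.1 p.2).mono (c' := √(T * frobSq B)) (by
    apply Real.sqrt_le_sqrt
    refine le_trans ?_ hTB
    rw [hpair]
    exact Finset.sum_le_sum_of_subset_of_nonneg (Finset.filter_subset _ _) fun _ _ _ => by positivity)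
  have hl := ((h.l2Bound_upper fun p => star (B p.2 p.1)).of_norm_le
      (g := fun x => ∑ p : Fin N × Fin N with p.2 < p.1, B p.1 p.2 * (star (x p.1) * x p.2))
      (by fun_prop) zero_le_one (fun x => by
        rw [one_mul, ← norm_star]
        apply le_of_eq
        congr 1
        rw [star_sum]
        refine Finset.sum_equiv (Equiv.prodComm _ _) (by simp) (fun p _ => ?_)
        simp [mul_comm])).mono (c' := √(T * frobSq B)) (by
    rw [one_mul]
    apply Real.sqrt_le_sqrt
    refine le_trans ?_ hTB
    rw [hpair, ← (Equiv.prodComm (Fin N) (Fin N)).sum_comp]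
    simp only [norm_star]
    exact Finset.sum_le_sum_of_subset_of_nonneg (Finset.filter_subset _ _) fun _ _ _ => by positivity)
  have hd := (h.l2Bound_diag hT0 fun i => B i i).mono (c' := √(T * frobSq B)) (by
    apply Real.sqrt_le_sqrt
    gcongr
    exact Finset.sum_le_sum fun i _ => Finset.single_le_sum (f := fun k => ‖B i k‖ ^ 2)
      (fun _ _ => by positivity) (Finset.mem_univ i))
  have hs := Real.sqrt_nonneg (T * frobSq B)
  have htot := (hu.add hl hs hs).add hd (by positivity) hs
  convert htot using 1
  · funext x
    have h1 : star x ⬝ᵥ (B *ᵥ x) = ∑ p : Fin N × Fin N, B p.1 p.2 * (star (x p.1) * x p.2) := by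
      simp only [dotProduct, mulVec, Fintype.sum_prod_type, Finset.mul_sum, Pi.star_apply]
      refine Finset.sum_congr rfl fun i _ => Finset.sum_congr rfl fun k _ => ?_
      ring
    have h2 : ∑ i, B i i * (star (x i) * x i - 1) =
        ∑ p : Fin N × Fin N with p.1 = p.2, B p.1 p.2 * (star (x p.1) * x p.2) - trace B := by
      simp only [mul_sub, mul_one, Finset.sum_sub_distrib, trace, diag_apply]
      congr 1
      refine Finset.sum_bij' (fun i _ => (i, i)) (fun p _ => p.1) ?_ ?_ ?_ ?_ ?_ <;> simp
    rw [h1, h2, ← Finset.sum_filter_add_sum_filter_not Finset.univ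
      (fun p : Fin N × Fin N => p.1 < p.2),
      ← Finset.sum_filter_add_sum_filter_not (Finset.univ.filter
        fun p : Fin N × Fin N => ¬ p.1 < p.2) (fun p : Fin N × Fin N => p.2 < p.1),
      Finset.filter_filter, Finset.filter_filter]
    have e1 : (Finset.univ.filter fun p : Fin N × Fin N => ¬ p.1 < p.2 ∧ p.2 < p.1) =
        Finset.univ.filter fun p : Fin N × Fin N => p.2 < p.1 := by
      ext p; simp; exact le_of_lt
    have e2 : (Finset.univ.filter fun p : Fin N × Fin N => ¬ p.1 < p.2 ∧ ¬ p.2 < p.1) =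
        Finset.univ.filter fun p : Fin N × Fin N => p.1 = p.2 := by
      ext p; simp; exact ⟨fun h => le_antisymm h.2 h.1, fun h => ⟨h.ge, h.le⟩⟩
    rw [e1, e2]
    ring
  · ring

lemma integral_linear (h : EntryLaw ν T) (b : Fin N → ℂ) :
    ∫ x : Fin N → ℂ, b ⬝ᵥ x ∂(Measure.pi fun _ => ν) = 0 := by
  simp only [dotProduct]
  rw [integral_finsetSum _ fun i _ => (integrable_eval h.integrable_id i).const_mul _]
  refine Finset.sum_eq_zero fun i _ => ?_
  rw [integral_const_mul, integral_eval (f := fun x => x) (by fun_prop), h.mean, mul_zero]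

lemma integral_star_linear (h : EntryLaw ν T) (b : Fin N → ℂ) :
    ∫ x : Fin N → ℂ, star x ⬝ᵥ b ∂(Measure.pi fun _ => ν) = 0 := by
  have h1 : ∀ x : Fin N → ℂ, star x ⬝ᵥ b = (starRingEnd ℂ) (star b ⬝ᵥ x) := fun x => by
    rw [Matrix.star_dotProduct, dotProduct_comm]; rfl
  simp_rw [h1]
  rw [integral_conj, h.integral_linear, map_zero]

lemma integral_quadratic (h : EntryLaw ν T) (B : Matrix (Fin N) (Fin N) ℂ) :
    ∫ x : Fin N → ℂ, (star x ⬝ᵥ (B *ᵥ x) - trace B) ∂(Measure.pi fun _ => ν) = 0 := by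
  have hi' : Integrable (fun x : ℂ => star x * x) ν := h.memLp_two.star.integrable_mul h.memLp_two
  have hInt : ∀ i k : Fin N, Integrable (fun x : Fin N → ℂ => star (x i) * x k)
      (Measure.pi fun _ => ν) := fun i k => by
    rcases eq_or_ne i k with rfl | hik
    · exact integrable_eval hi' i
    · exact (h.memLp_star_mul hik).integrable (by norm_num)
  have h1 : ∀ x : Fin N → ℂ, star x ⬝ᵥ (B *ᵥ x) = ∑ i, ∑ k, B i k * (star (x i) * x k) := by
    intro x
    simp only [dotProduct, mulVec, Finset.mul_sum, Pi.star_apply]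
    refine Finset.sum_congr rfl fun i _ => Finset.sum_congr rfl fun k _ => ?_
    ring
  have h2 : ∀ i k : Fin N, ∫ x : Fin N → ℂ, star (x i) * x k ∂(Measure.pi fun _ => ν) =
      if i = k then 1 else 0 := fun i k => by
    split_ifs with hik
    · subst hik
      rw [integral_eval (f := fun x => star x * x) (by fun_prop), h.variance_complex]
    · rw [integral_eval_mul (f := star) (g := fun x => x) hik, h.mean, mul_zero]
  have hrow : ∀ i : Fin N, Integrable (fun x : Fin N → ℂ => ∑ k, B i k * (star (x i) * x k))
      (Measure.pi fun _ => ν) := fun i =>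
    integrable_finsetSum _ fun k _ => (hInt i k).const_mul (B i k)
  simp_rw [h1]
  rw [integral_sub (f := fun x : Fin N → ℂ => ∑ i, ∑ k, B i k * (star (x i) * x k))
      (integrable_finsetSum _ fun i _ => hrow i) (integrable_const _),
    integral_finsetSum _ fun i _ => hrow i]
  have h3 : ∀ i : Fin N, ∫ x : Fin N → ℂ, ∑ k, B i k * (star (x i) * x k)
      ∂(Measure.pi fun _ => ν) = B i i := fun i => by
    rw [integral_finsetSum _ fun k _ => (hInt i k).const_mul (B i k)]
    simp_rw [integral_const_mul, h2]
    simp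
  simp_rw [h3]
  simp [trace]

end EntryLaw

/-! ### Resampling one coordinate of a product measure -/

section Resampling

variable {n : ℕ} {E : Type*} [MeasurableSpace E] {ν : Measure E} [IsProbabilityMeasure ν]

lemma measurable_update_pair (j : Fin n) :
    Measurable fun p : (Fin n → E) × E => Function.update p.1 j p.2 := by
  refine measurable_pi_iff.2 fun i => ?_
  rcases eq_or_ne i j with rfl | hij
  · simpa using measurable_snd
  · simp only [Function.update_of_ne hij]
    exact (measurable_pi_apply i).comp measurable_fst

/-- Replacing one coordinate by an independent copy preserves the product law. Integrating over the
copy alone plays the role of the conditional expectation given the other coordinates. -/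
lemma measurePreserving_update (j : Fin n) :
    MeasurePreserving (fun p : (Fin n → E) × E => Function.update p.1 j p.2)
      ((Measure.pi fun _ : Fin n => ν).prod ν) (Measure.pi fun _ => ν) := by
  refine ⟨measurable_update_pair j, (Measure.pi_eq fun s hs => ?_).symm⟩
  rw [Measure.map_apply (measurable_update_pair j) (MeasurableSet.univ_pi hs)]
  have h : (fun p : (Fin n → E) × E => Function.update p.1 j p.2) ⁻¹' (Set.univ.pi s) =
      (Set.univ.pi (Function.update s j Set.univ)) ×ˢ s j := by
    ext ⟨X, x⟩
    simp only [Set.mem_preimage, Set.mem_pi, Set.mem_univ, true_implies, Set.mem_prod]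
    constructor
    · intro h
      refine ⟨fun i => ?_, by simpa using h j⟩
      rcases eq_or_ne i j with rfl | hij
      · simp
      · simpa [hij] using h i
    · rintro ⟨h1, h2⟩ i
      rcases eq_or_ne i j with rfl | hij
      · simpa using h2
      · simpa [hij] using h1 i
  rw [h, Measure.prod_prod, Measure.pi_pi, ← Finset.mul_prod_erase _ _ (Finset.mem_univ j),
    ← Finset.mul_prod_erase (Finset.univ) (fun i => ν (s i)) (Finset.mem_univ j)]
  simp only [Function.update_self, measure_univ, one_mul]
  rw [mul_comm]
  congr 1
  refine Finset.prod_congr rfl fun i hi => ?_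
  rw [Function.update_of_ne (Finset.ne_of_mem_erase hi)]

lemma lintegral_update (j : Fin n) {F : (Fin n → E) → ENNReal} (hF : Measurable F) :
    ∫⁻ X, F X ∂(Measure.pi fun _ => ν) =
      ∫⁻ X, ∫⁻ x, F (Function.update X j x) ∂ν ∂(Measure.pi fun _ => ν) := by
  rw [← (measurePreserving_update (ν := ν) j).lintegral_comp hF]
  exact lintegral_prod _ (hF.comp (measurable_update_pair j)).aemeasurable

/-- No integrability is required: the integral of a non-integrable function is 0 by convention. -/
lemma integral_eq_zero_of_update (j : Fin n) {F : (Fin n → E) → ℂ}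
    (h : ∀ X, ∫ x, F (Function.update X j x) ∂ν = 0) :
    ∫ X, F X ∂(Measure.pi fun _ => ν) = 0 := by
  by_cases hF : Integrable F (Measure.pi fun _ => ν)
  · have hmp := measurePreserving_update (ν := ν) j
    have h1 : ∫ X, F X ∂(Measure.pi fun _ => ν) =
        ∫ p, F (Function.update p.1 j p.2) ∂((Measure.pi fun _ : Fin n => ν).prod ν) := by
      conv_lhs => rw [← hmp.map_eq]
      rw [integral_map hmp.measurable.aemeasurable (by rw [hmp.map_eq]; exact hF.1)]
    refine h1.trans ((integral_prod _ (hmp.integrable_comp_of_integrable hF)).trans ?_)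
    simp [h]
  · exact integral_undef hF

lemma l2Bound_of_update (j : Fin n) {F : (Fin n → E) → ℂ} (hF : Measurable F)
    {c : (Fin n → E) → ℝ} (hc : ∀ X, 0 ≤ c X)
    (h : ∀ X, L2Bound ν (fun x => F (Function.update X j x)) (c X)) {C : ℝ} (hC : 0 ≤ C)
    (hcC : ∫⁻ X, ENNReal.ofReal (c X ^ 2) ∂(Measure.pi fun _ => ν) ≤ ENNReal.ofReal (C ^ 2)) :
    L2Bound (Measure.pi fun _ => ν) F C := by
  rw [l2Bound_iff_lintegral hC hF.aestronglyMeasurable]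
  refine le_trans ?_ hcC
  rw [lintegral_update j (by fun_prop)]
  exact lintegral_mono fun X => (l2Bound_iff_lintegral (hc X) (h X).1).1 (h X)

lemma l2Bound_of_update_const (j : Fin n) {F : (Fin n → E) → ℂ} (hF : Measurable F)
    {C : ℝ} (hC : 0 ≤ C) (h : ∀ X, L2Bound ν (fun x => F (Function.update X j x)) C) :
    L2Bound (Measure.pi fun _ => ν) F C :=
  l2Bound_of_update j hF (fun _ => hC) h hC (by simp)

end Resampling

/-! ### The Efron–Stein inequality -/

section EfronStein

variable {Ω : Type*} [MeasurableSpace Ω] {μ : Measure Ω} [IsProbabilityMeasure μ]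

lemma norm_integral_sq_le {f : Ω → ℂ} (hf : MemLp f 2 μ) :
    ‖∫ ω, f ω ∂μ‖ ^ 2 ≤ ∫ ω, ‖f ω‖ ^ 2 ∂μ := by
  have h0 : 0 ≤ ∫ ω, ‖f ω‖ ^ 2 ∂μ := integral_nonneg fun ω => by positivity
  have h1 : L2Bound μ f √(∫ ω, ‖f ω‖ ^ 2 ∂μ) :=
    L2Bound.of_integral hf (Real.sqrt_nonneg _) (by rw [Real.sq_sqrt h0])
  have h2 : L2Bound μ (fun _ => (1 : ℂ)) 1 := L2Bound.of_bounded (by fun_prop) (by simp)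
  have h3 := h1.norm_integral_mul_le h2 (Real.sqrt_nonneg _) zero_le_one
  simp only [mul_one] at h3
  calc _ ≤ √(∫ ω, ‖f ω‖ ^ 2 ∂μ) ^ 2 := by gcongr
    _ = _ := Real.sq_sqrt h0

lemma integral_norm_sub_sq {f : Ω → ℂ} (hf : MemLp f 2 μ) (c : ℂ) :
    ∫ ω, ‖f ω - c‖ ^ 2 ∂μ =
      ∫ ω, ‖f ω - ∫ ω', f ω' ∂μ‖ ^ 2 ∂μ + ‖∫ ω, f ω ∂μ - c‖ ^ 2 := by
  set m := ∫ ω, f ω ∂μ with hm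
  have hi : Integrable f μ := hf.integrable (by norm_num)
  have hsub : MemLp (fun ω => f ω - m) 2 μ := hf.sub (memLp_const m)
  have hpt : ∀ ω, ‖f ω - c‖ ^ 2 =
      ‖f ω - m‖ ^ 2 + (2 * inner ℝ (f ω - m) (m - c) + ‖m - c‖ ^ 2) := fun ω => by
    have : f ω - c = (f ω - m) + (m - c) := by ring
    rw [this, @norm_add_sq_real]; ring
  simp_rw [hpt]
  have hinner : Integrable (fun ω => inner ℝ (f ω - m) (m - c)) μ :=
    (hi.sub (integrable_const m)).inner_const _
  rw [integral_add (g := fun ω => 2 * inner ℝ (f ω - m) (m - c) + ‖m - c‖ ^ 2)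
      hsub.norm.integrable_sq ((hinner.const_mul 2).add (integrable_const _)),
    integral_add (hinner.const_mul 2) (integrable_const _), integral_const_mul]
  have h0 : ∫ ω, inner ℝ (f ω - m) (m - c) ∂μ = 0 := by
    have h1 : ∀ ω, inner ℝ (f ω - m) (m - c) = inner ℝ (m - c) (f ω - m) := fun ω =>
      real_inner_comm _ _
    simp_rw [h1]
    rw [integral_inner (f := fun ω => f ω - m) (hi.sub (integrable_const m)), integral_sub hi (integrable_const m)]
    simp [hm]
  rw [h0]; simp

/-- Induction on the number of coordinates, splitting the variance into the part due to the first
coordinate and the variance of the partial mean h. The approximants g_j are arbitrary functions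
independent of coordinate j, since the conditional mean is a better approximation than any of them.
-/
theorem efron_stein {E : Type*} [MeasurableSpace E] {ν : Measure E} [IsProbabilityMeasure ν]
    {n : ℕ} {f : (Fin n → E) → ℂ} {g : Fin n → (Fin n → E) → ℂ} {b : ℝ}
    (hf : Measurable f) (hfb : ∀ X, ‖f X‖ ≤ b) (hg : ∀ j, Measurable (g j))
    (hgb : ∀ j X, ‖g j X‖ ≤ b) (hgu : ∀ j X x, g j (Function.update X j x) = g j X) :
    ∫ X, ‖f X - ∫ Y, f Y ∂(Measure.pi fun _ => ν)‖ ^ 2 ∂(Measure.pi fun _ => ν) ≤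
      ∑ j, ∫ X, ‖f X - g j X‖ ^ 2 ∂(Measure.pi fun _ => ν) := by
  induction n with
  | zero =>
    have : ∀ X : Fin 0 → E, ∫ Y, f Y ∂(Measure.pi fun _ : Fin 0 => ν) = f X := fun X => by
      have h : ∀ Y, f Y = f X := fun Y => congrArg f (Subsingleton.elim _ _)
      simp_rw [h]; simp
    have h0 : ∀ X : Fin 0 → E, ‖f X - ∫ Y, f Y ∂(Measure.pi fun _ : Fin 0 => ν)‖ ^ 2 = 0 :=
      fun X => by rw [this X]; simp
    rw [integral_congr_ae (Filter.Eventually.of_forall h0)]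
    simp
  | succ n ih =>
    have hmp := (measurePreserving_piFinSuccAbove (fun _ : Fin (n + 1) => ν) 0).symm
    set e : E × (Fin n → E) → (Fin (n + 1) → E) := fun p => Fin.cons p.1 p.2 with he
    have hee : ⇑(MeasurableEquiv.piFinSuccAbove (fun _ : Fin (n + 1) => E) 0).symm = e := by
      funext p
      simp [he, MeasurableEquiv.piFinSuccAbove_symm_apply, Fin.insertNthEquiv]
    have hem : MeasurePreserving e (ν.prod (Measure.pi fun _ : Fin n => ν))
        (Measure.pi fun _ : Fin (n + 1) => ν) := by
      rw [← hee]; exact hmp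
    have hemb : MeasurableEmbedding e := by
      rw [← hee]; exact MeasurableEquiv.measurableEmbedding _
    -- Fubini for bounded measurable functions
    have fub : ∀ {G : Type} [NormedAddCommGroup G] [NormedSpace ℝ G] [CompleteSpace G]
        (F : (Fin (n + 1) → E) → G), AEStronglyMeasurable F (Measure.pi fun _ => ν) →
        (∃ C, ∀ X, ‖F X‖ ≤ C) →
        Integrable (fun p => F (e p)) (ν.prod (Measure.pi fun _ : Fin n => ν)) ∧
        ∫ X, F X ∂(Measure.pi fun _ => ν) =
          ∫ r, ∫ x, F (e (x, r)) ∂ν ∂(Measure.pi fun _ : Fin n => ν) := by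
      intro G _ _ _ F hF ⟨C, hC⟩
      have hi : Integrable F (Measure.pi fun _ : Fin (n + 1) => ν) :=
        Integrable.of_bound hF C (Filter.Eventually.of_forall hC)
      have hie := hem.integrable_comp_of_integrable hi
      refine ⟨hie, ?_⟩
      rw [← hem.integral_comp hemb]
      exact integral_prod_symm _ hie
    have hfe : Measurable fun p => f (e p) := hf.comp hem.measurable
    have hge : ∀ j, Measurable fun p => g j (e p) := fun j => (hg j).comp hem.measurable
    have hme : ∀ r, Measurable fun x => e (x, r) := fun r =>
      hem.measurable.comp (measurable_id.prodMk measurable_const)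
    have memb : ∀ {F : E → ℂ}, Measurable F → ∀ {C : ℝ}, (∀ x, ‖F x‖ ≤ C) → MemLp F 2 ν :=
      fun {_} hF {C} hC => MemLp.of_bound hF.aestronglyMeasurable C (Filter.Eventually.of_forall hC)
    set h : (Fin n → E) → ℂ := fun r => ∫ x, f (e (x, r)) ∂ν with hh
    -- Averaging over the first coordinate keeps the independence of the corresponding later one, so
    -- the k_j are admissible for h in the induction hypothesis.
    set k : Fin n → (Fin n → E) → ℂ := fun j r => ∫ x, g j.succ (e (x, r)) ∂ν with hk
    have hhm : Measurable h :=
      (hfe.stronglyMeasurable.integral_prod_left' (μ := ν)).measurable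
    have hkm : ∀ j, Measurable (k j) := fun j =>
      ((hge j.succ).stronglyMeasurable.integral_prod_left' (μ := ν)).measurable
    have hbd : ∀ {F : E → ℂ}, (∀ x, ‖F x‖ ≤ b) → ‖∫ x, F x ∂ν‖ ≤ b := fun hF => by
      simpa using norm_integral_le_of_norm_le_const (μ := ν) (Filter.Eventually.of_forall hF)
    have IH := ih (f := h) (g := k) hhm (fun r => hbd fun x => hfb _) hkm
      (fun j r => hbd fun x => hgb _ _) (fun j r y => by
        simp only [hk]
        congr 1
        funext x
        have : e (x, Function.update r j y) = Function.update (e (x, r)) j.succ y := by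
          simp only [he]
          exact (Fin.cons_update _ _ _ _).trans rfl
        rw [this, hgu])
    set m := ∫ Y, f Y ∂(Measure.pi fun _ : Fin (n + 1) => ν) with hm
    have hmh : m = ∫ r, h r ∂(Measure.pi fun _ : Fin n => ν) :=
      (fub f hf.aestronglyMeasurable ⟨b, hfb⟩).2
    have hdb : ∀ (c : ℂ) X, ‖‖f X - c‖ ^ 2‖ ≤ (b + ‖c‖) ^ 2 := fun c X => by
      rw [Real.norm_of_nonneg (by positivity)]
      gcongr
      exact (norm_sub_le _ _).trans (by gcongr; exact hfb X)
    have hdg : ∀ j X, ‖‖f X - g j X‖ ^ 2‖ ≤ (b + b) ^ 2 := fun j X => by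
      rw [Real.norm_of_nonneg (by positivity)]
      gcongr
      exact (norm_sub_le _ _).trans (add_le_add (hfb X) (hgb j X))
    have hfm : ∀ r, MemLp (fun x => f (e (x, r))) 2 ν := fun r =>
      memb (hf.comp (hme r)) fun x => hfb _
    obtain ⟨i1, e1⟩ := fub (fun X => ‖f X - m‖ ^ 2) (by fun_prop) ⟨_, hdb m⟩
    have e2 : ∀ j, Integrable (fun p => ‖f (e p) - g j (e p)‖ ^ 2)
        (ν.prod (Measure.pi fun _ : Fin n => ν)) ∧ ∫ X, ‖f X - g j X‖ ^ 2 ∂(Measure.pi fun _ => ν) =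
          ∫ r, ∫ x, ‖f (e (x, r)) - g j (e (x, r))‖ ^ 2 ∂ν ∂(Measure.pi fun _ : Fin n => ν) :=
      fun j => fub (fun X => ‖f X - g j X‖ ^ 2) (by fun_prop) ⟨_, hdg j⟩
    rw [e1, Fin.sum_univ_succ, (e2 0).2]
    -- For fixed r the function g 0 is constant in the first coordinate, and the mean h r minimises
    -- the quadratic distance to constants.
    have hpt : ∀ r, ∫ x, ‖f (e (x, r)) - m‖ ^ 2 ∂ν ≤
        ∫ x, ‖f (e (x, r)) - g 0 (e (x, r))‖ ^ 2 ∂ν + ‖h r - m‖ ^ 2 := fun r => by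
      rw [integral_norm_sub_sq (hfm r) m]
      refine add_le_add ?_ le_rfl
      obtain ⟨x0⟩ : Nonempty E := nonempty_of_isProbabilityMeasure ν
      have hg0 : ∀ x, g 0 (e (x, r)) = g 0 (e (x0, r)) := fun x => by
        have : e (x, r) = Function.update (e (x0, r)) 0 x := by
          simp [he, Fin.update_cons_zero]
        rw [this, hgu]
      have hg1 : ∫ x, ‖f (e (x, r)) - g 0 (e (x, r))‖ ^ 2 ∂ν =
          ∫ x, ‖f (e (x, r)) - g 0 (e (x0, r))‖ ^ 2 ∂ν :=
        integral_congr_ae (Filter.Eventually.of_forall fun x => by simp only [hg0 x])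
      rw [hg1, integral_norm_sub_sq (hfm r) (g 0 (e (x0, r)))]
      exact le_add_of_nonneg_right (by positivity)
    have ihm : Integrable (fun r => ‖h r - m‖ ^ 2) (Measure.pi fun _ : Fin n => ν) :=
      Integrable.of_bound (by fun_prop) ((b + ‖m‖) ^ 2) (Filter.Eventually.of_forall fun r => by
        rw [Real.norm_of_nonneg (by positivity)]
        gcongr
        exact (norm_sub_le _ _).trans (by gcongr; exact hbd fun x => hfb _))
    refine (integral_mono i1.integral_prod_right ((e2 0).1.integral_prod_right.add ihm)
      hpt).trans ?_
    rw [integral_add' (e2 0).1.integral_prod_right ihm]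
    gcongr
    rw [hmh]
    refine IH.trans (Finset.sum_le_sum fun j _ => ?_)
    rw [(e2 j.succ).2]
    refine integral_mono ?_ (e2 j.succ).1.integral_prod_right fun r => ?_
    · exact Integrable.of_bound (by have := hkm j; fun_prop) ((b + b) ^ 2)
        (Filter.Eventually.of_forall fun r => by
          rw [Real.norm_of_nonneg (by positivity)]
          gcongr
          exact (norm_sub_le _ _).trans
            (add_le_add (hbd fun x => hfb _) (hbd fun x => hgb _ _)))
    -- Jensen: averaging over the first coordinate does not increase the quadratic distance between
    -- f and the approximant.
    · have hgm : MemLp (fun x => g j.succ (e (x, r))) 2 ν :=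
        memb ((hg _).comp (hme r)) fun x => hgb _ _
      have := norm_integral_sq_le ((hfm r).sub hgm)
      simp only [Pi.sub_apply] at this
      rw [integral_sub ((hfm r).integrable (by norm_num)) (hgm.integrable (by norm_num))] at this
      exact this

end EfronStein

/-! ### The column model -/

/-- The matrix `diag p · X · diag σ + A` built from i.i.d. entries `X j i` of law `ν`, at the spectral
parameter `z`, with all the parameters bounded in terms of `T` and of the dimension scale `m`. -/
structure ColumnModel (N n : ℕ) where
  p : Fin N → ℝ
  σ : Fin n → ℝ
  A : Matrix (Fin N) (Fin n) ℂ
  z : ℂ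
  ν : Measure ℂ
  T : ℝ
  m : ℝ
  prob : IsProbabilityMeasure ν
  law : EntryLaw ν T
  le_T : 16 ≤ T
  one_le_m : 1 ≤ m
  notMem_axis : z ∉ nonnegAxis
  norm_z_le : ‖z‖ ≤ T
  inv_delta_le : 1 / deltaZ z ≤ T
  norm_div_delta_le : ‖z‖ / deltaZ z ≤ T
  N_le : (N : ℝ) ≤ T * m
  n_le : (n : ℝ) ≤ T * m
  p_sq_le : ∀ i, p i ^ 2 ≤ T
  σ_sq_le : ∀ j, σ j ^ 2 ≤ T / m
  vecSq_col_le : ∀ j, vecSq (A.col j) ≤ T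

namespace ColumnModel

variable {N n : ℕ} (M : ColumnModel N n)

instance : IsProbabilityMeasure M.ν := M.prob

/-- The law of one column of entries. -/
noncomputable abbrev colLaw : Measure (Fin N → ℂ) := Measure.pi fun _ => M.ν

/-- The law of the array of entries. -/
noncomputable abbrev arrayLaw : Measure (Fin n → Fin N → ℂ) := Measure.pi fun _ => M.colLaw

/-- The covariance profile `diag p²` of the columns. -/
noncomputable def D : Matrix (Fin N) (Fin N) ℂ := realDiag fun i => M.p i ^ 2

/-- The random part of the `j`-th column. -/
noncomputable def noise (j : Fin n) (X : Fin n → Fin N → ℂ) : Fin N → ℂ :=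
  (M.σ j : ℂ) • (realDiag M.p *ᵥ X j)

/-- The model matrix. -/
noncomputable def S (X : Fin n → Fin N → ℂ) : Matrix (Fin N) (Fin n) ℂ :=
  Matrix.of fun i j => M.noise j X i + M.A i j

/-- The resolvent of the model matrix. -/
noncomputable def Q (X : Fin n → Fin N → ℂ) : Matrix (Fin N) (Fin N) ℂ :=
  resolventMatrix (M.S X) M.z

/-- The resolvent of the model matrix without its `j`-th column. -/
noncomputable def Q₀ (j : Fin n) (X : Fin n → Fin N → ℂ) : Matrix (Fin N) (Fin N) ℂ :=
  resolventMatrix ((M.S X).updateCol j 0) M.z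

/-- The random weight `(1 + η_j* Q_j η_j)⁻¹`. -/
noncomputable def q (j : Fin n) (X : Fin n → Fin N → ℂ) : ℂ :=
  (1 + leaveOutForm (M.S X) M.z j)⁻¹

/-- The average of `η_j* B η_j` over the `j`-th column. -/
noncomputable def avgForm (j : Fin n) (B : Matrix (Fin N) (Fin N) ℂ) : ℂ :=
  star (M.A.col j) ⬝ᵥ (B *ᵥ M.A.col j) + (M.σ j : ℂ) ^ 2 * trace (M.D * B)

/-- The weight `(1 + 𝔼_j η_j* Q_j η_j)⁻¹`. -/
noncomputable def qAvg (j : Fin n) (X : Fin n → Fin N → ℂ) : ℂ :=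
  (1 + M.avgForm j (M.Q₀ j X))⁻¹

/-! ### Elementary bounds, invariance under resampling, continuity -/

lemma T_pos : 0 < M.T := by linarith [M.le_T]

lemma one_le_T : 1 ≤ M.T := by linarith [M.le_T]

lemma m_pos : 0 < M.m := by linarith [M.one_le_m]

lemma sqrt_m_pos : 0 < √M.m := Real.sqrt_pos.2 M.m_pos

/-- Trades √T for T, so that only integer powers of T have to be tracked. -/
lemma sqrt_le_T_mul (c : ℝ) : √(M.T * c) ≤ M.T * √c := by
  rw [Real.sqrt_mul M.T_pos.le]
  gcongr
  exact Real.sqrt_le_left M.T_pos.le |>.2 (by nlinarith [M.one_le_T])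

lemma S_col (j : Fin n) (X : Fin n → Fin N → ℂ) : (M.S X).col j = M.A.col j + M.noise j X := by
  funext i; simp [S, Matrix.col_apply, add_comm]

lemma noise_update (j : Fin n) (X : Fin n → Fin N → ℂ) (x : Fin N → ℂ) :
    M.noise j (Function.update X j x) = (M.σ j : ℂ) • (realDiag M.p *ᵥ x) := by
  simp [noise]

lemma Q₀_update (j : Fin n) (X : Fin n → Fin N → ℂ) (x : Fin N → ℂ) :
    M.Q₀ j (Function.update X j x) = M.Q₀ j X := by
  unfold Q₀
  congr 1
  ext i k
  rw [Matrix.updateCol_apply, Matrix.updateCol_apply]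
  split_ifs with h
  · rfl
  · simp [S, noise, h]

lemma qAvg_update (j : Fin n) (X : Fin n → Fin N → ℂ) (x : Fin N → ℂ) :
    M.qAvg j (Function.update X j x) = M.qAvg j X := by
  unfold qAvg; rw [Q₀_update]

lemma norm_D_le : ‖M.D‖ ≤ M.T := by
  rw [D, realDiag, Matrix.l2_opNorm_diagonal]
  refine (pi_norm_le_iff_of_nonneg M.T_pos.le).2 fun i => ?_
  rw [Complex.norm_real, Real.norm_of_nonneg (by positivity)]
  exact M.p_sq_le i

lemma norm_realDiag_p_sq_le : ‖realDiag M.p‖ ^ 2 ≤ M.T := by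
  rw [realDiag, Matrix.l2_opNorm_diagonal]
  have h : ‖fun i => (M.p i : ℂ)‖ ≤ √M.T := by
    refine (pi_norm_le_iff_of_nonneg (Real.sqrt_nonneg _)).2 fun i => ?_
    rw [Complex.norm_real, Real.norm_eq_abs]
    exact Real.abs_le_sqrt (M.p_sq_le i)
  calc _ ≤ √M.T ^ 2 := by gcongr
    _ = _ := Real.sq_sqrt M.T_pos.le

lemma realDiag_mul_self : realDiag M.p * realDiag M.p = M.D := by
  simp [realDiag, D, Matrix.diagonal_mul_diagonal, sq]

lemma conjTranspose_realDiag : (realDiag M.p)ᴴ = realDiag M.p := by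
  rw [realDiag, Matrix.diagonal_conjTranspose]
  congr 1
  funext i
  simp

lemma norm_Q_le (X : Fin n → Fin N → ℂ) : ‖M.Q X‖ ≤ M.T :=
  (norm_resolvent_le M.notMem_axis _).trans M.inv_delta_le

lemma norm_Q₀_le (j : Fin n) (X : Fin n → Fin N → ℂ) : ‖M.Q₀ j X‖ ≤ M.T :=
  (norm_resolvent_le M.notMem_axis _).trans M.inv_delta_le

lemma norm_q_le (j : Fin n) (X : Fin n → Fin N → ℂ) : ‖M.q j X‖ ≤ M.T :=
  ((resolventCone_dotProduct M.notMem_axis _ _).norm_inv_one_add_le M.notMem_axis).trans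
    M.norm_div_delta_le

/-- The average is a form c*Q_jc plus a nonnegative combination of diagonal entries of Q_j, and the
cone is closed under both operations. Hence the averaged weight obeys the same bound as the random
one. -/
lemma resolventCone_avgForm (j : Fin n) (X : Fin n → Fin N → ℂ) :
    ResolventCone M.z (M.avgForm j (M.Q₀ j X)) := by
  refine (resolventCone_dotProduct M.notMem_axis _ _).add ?_
  have h : (M.σ j : ℂ) ^ 2 * trace (M.D * M.Q₀ j X) =
      ∑ i, ((M.σ j ^ 2 * M.p i ^ 2 : ℝ) : ℂ) * M.Q₀ j X i i := by
    simp only [trace, diag_apply, D, realDiag, Matrix.diagonal_mul, Finset.mul_sum]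
    refine Finset.sum_congr rfl fun i _ => ?_
    push_cast; ring
  rw [h]
  exact ResolventCone.sum _ fun i _ =>
    (resolventCone_apply M.notMem_axis _ i).ofReal_mul (by positivity)

lemma norm_qAvg_le (j : Fin n) (X : Fin n → Fin N → ℂ) : ‖M.qAvg j X‖ ≤ M.T :=
  ((M.resolventCone_avgForm j X).norm_inv_one_add_le M.notMem_axis).trans M.norm_div_delta_le

lemma one_add_avgForm_ne_zero (j : Fin n) (X : Fin n → Fin N → ℂ) :
    1 + M.avgForm j (M.Q₀ j X) ≠ 0 :=
  (M.resolventCone_avgForm j X).one_add_ne_zero M.notMem_axis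

@[fun_prop]
lemma continuous_noise (j : Fin n) : Continuous (M.noise j) := by
  unfold noise; fun_prop

@[fun_prop]
lemma continuous_S : Continuous M.S := by
  unfold S
  refine continuous_matrix fun i j => ?_
  have := M.continuous_noise j
  simp only [Matrix.of_apply]
  fun_prop

@[fun_prop]
lemma continuous_Q : Continuous M.Q :=
  (continuous_resolvent M.notMem_axis).comp M.continuous_S

@[fun_prop]
lemma continuous_Q₀ (j : Fin n) : Continuous (M.Q₀ j) :=
  (continuous_resolvent M.notMem_axis).comp (M.continuous_S.matrix_updateCol j continuous_const)

@[fun_prop]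
lemma continuous_q (j : Fin n) : Continuous (M.q j) := by
  refine Continuous.inv₀ ?_ fun X => one_add_leaveOutForm_ne_zero M.notMem_axis _ _
  have h : ∀ X, leaveOutForm (M.S X) M.z j =
      star (M.A.col j + M.noise j X) ⬝ᵥ (M.Q₀ j X *ᵥ (M.A.col j + M.noise j X)) := fun X => by
    rw [leaveOutForm, S_col]; rfl
  simp_rw [h]
  fun_prop

@[fun_prop]
lemma continuous_qAvg (j : Fin n) : Continuous (M.qAvg j) := by
  refine Continuous.inv₀ ?_ fun X => M.one_add_avgForm_ne_zero j X
  unfold avgForm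
  fun_prop

/-! ### Forms in one column -/

lemma star_noise_dotProduct_mulVec (j : Fin n) (B : Matrix (Fin N) (Fin N) ℂ) (x : Fin N → ℂ) :
    star ((M.σ j : ℂ) • (realDiag M.p *ᵥ x)) ⬝ᵥ (B *ᵥ ((M.σ j : ℂ) • (realDiag M.p *ᵥ x))) -
        (M.σ j : ℂ) ^ 2 * trace (M.D * B) =
      (M.σ j : ℂ) ^ 2 * (star x ⬝ᵥ ((realDiag M.p * B * realDiag M.p) *ᵥ x) -
        trace (realDiag M.p * B * realDiag M.p)) := by
  have h1 : trace (realDiag M.p * B * realDiag M.p) = trace (M.D * B) := by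
    rw [Matrix.trace_mul_comm, ← Matrix.mul_assoc, realDiag_mul_self]
  rw [h1, mul_sub]
  congr 1
  rw [star_smul, Matrix.mulVec_smul, smul_dotProduct, dotProduct_smul, Matrix.star_mulVec,
    conjTranspose_realDiag, ← Matrix.dotProduct_mulVec, Matrix.mulVec_mulVec,
    Matrix.mulVec_mulVec]
  simp [Matrix.mul_assoc]
  ring

/-- Since B ignores column j, it is a constant matrix while that column is resampled, and the bound
for i.i.d. forms applies. The factor 1/m is σ_j². -/
lemma l2Bound_quadratic (j : Fin n) {B : (Fin n → Fin N → ℂ) → Matrix (Fin N) (Fin N) ℂ}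
    (hB : Continuous B) (hBu : ∀ X x, B (Function.update X j x) = B X) {F : ℝ}
    (hF : ∀ X, frobSq (B X) ≤ F) :
    L2Bound M.arrayLaw (fun X => star (M.noise j X) ⬝ᵥ (B X *ᵥ M.noise j X) -
      (M.σ j : ℂ) ^ 2 * trace (M.D * B X)) (M.T ^ 4 * √F / M.m) := by
  have hT := M.T_pos
  have hm := M.m_pos
  have hc : Continuous fun X => star (M.noise j X) ⬝ᵥ (B X *ᵥ M.noise j X) -
      (M.σ j : ℂ) ^ 2 * trace (M.D * B X) := by fun_prop
  refine l2Bound_of_update_const j hc.measurable (by positivity) fun X => ?_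
  simp only [noise_update, hBu, star_noise_dotProduct_mulVec]
  refine ((M.law.l2Bound_quadratic M.one_le_T _).bdd_mul (g := fun _ => (M.σ j : ℂ) ^ 2)
    (by fun_prop) (b := M.T / M.m) (by positivity) (fun _ => ?_)).mono ?_
  · rw [norm_pow, Complex.norm_real, Real.norm_eq_abs, sq_abs]
    exact M.σ_sq_le j
  · have hp := M.norm_realDiag_p_sq_le
    have h1 : frobSq (realDiag M.p * B X * realDiag M.p) ≤ M.T ^ 2 * F := by
      calc _ ≤ frobSq (realDiag M.p * B X) * ‖realDiag M.p‖ ^ 2 := frobSq_mul_le_right _ _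
        _ ≤ (‖realDiag M.p‖ ^ 2 * frobSq (B X)) * ‖realDiag M.p‖ ^ 2 := by
            gcongr; exact frobSq_mul_le_left _ _
        _ ≤ (M.T * F) * M.T := by
            have := frobSq_nonneg (B X)
            have := hF X
            have hF0 : 0 ≤ F := this.trans' (by assumption)
            gcongr
        _ = _ := by ring
    have h2 : √(M.T * frobSq (realDiag M.p * B X * realDiag M.p)) ≤ M.T * (M.T * √F) := by
      refine (M.sqrt_le_T_mul _).trans ?_
      gcongr
      refine (Real.sqrt_le_sqrt h1).trans_eq ?_
      rw [Real.sqrt_mul (by positivity), Real.sqrt_sq hT.le]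
    calc _ ≤ M.T / M.m * (M.T * (M.T * (M.T * √F))) := by
          gcongr
          linarith [M.le_T]
      _ = _ := by ring

/-- Only the mean of ‖b‖² enters, not its supremum: for b built from a_j*Q_jK it is the mean that
has a useful sum over j. -/
lemma l2Bound_star_linear (j : Fin n) {b : (Fin n → Fin N → ℂ) → Fin N → ℂ}
    (hb : Continuous b) (hbu : ∀ X x, b (Function.update X j x) = b X)
    (hi : Integrable (fun X => vecSq (b X)) M.arrayLaw) {V : ℝ}
    (hV : ∫ X, vecSq (b X) ∂M.arrayLaw ≤ V) :
    L2Bound M.arrayLaw (fun X => star (M.noise j X) ⬝ᵥ b X) (M.T * √V / √M.m) := by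
  have hT := M.T_pos
  have hm := M.m_pos
  have hV0 : 0 ≤ V := (integral_nonneg fun X => vecSq_nonneg _).trans hV
  have hc : Continuous fun X => star (M.noise j X) ⬝ᵥ b X := by fun_prop
  have hTm : √(M.T / M.m) ^ 2 = M.T / M.m := Real.sq_sqrt (by positivity)
  refine l2Bound_of_update j hc.measurable
    (c := fun X => √(M.T / M.m) * √(M.T * vecSq (b X))) (fun X => by positivity)
    (fun X => ?_) (by positivity) ?_
  · simp only [noise_update, hbu]
    have h1 : ∀ x, star ((M.σ j : ℂ) • (realDiag M.p *ᵥ x)) ⬝ᵥ b X =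
        (M.σ j : ℂ) * (star x ⬝ᵥ (realDiag M.p *ᵥ b X)) := fun x => by
      rw [star_smul, smul_dotProduct, Matrix.star_mulVec, conjTranspose_realDiag,
        ← Matrix.dotProduct_mulVec]
      simp
    simp only [h1]
    refine ((M.law.l2Bound_star_linear _).bdd_mul (g := fun _ => (M.σ j : ℂ))
      (by fun_prop) (b := √(M.T / M.m)) (by positivity) (fun _ => ?_)).mono ?_
    · rw [Complex.norm_real, Real.norm_eq_abs]
      exact Real.abs_le_sqrt (M.σ_sq_le j)
    · gcongr
      refine (vecSq_mulVec_le _ _).trans ?_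
      have := vecSq_nonneg (b X)
      gcongr
      exact M.norm_realDiag_p_sq_le
  · have h2 : ∀ X, (√(M.T / M.m) * √(M.T * vecSq (b X))) ^ 2 = M.T ^ 2 / M.m * vecSq (b X) :=
      fun X => by
        have := vecSq_nonneg (b X)
        rw [mul_pow, hTm, Real.sq_sqrt (by positivity)]; ring
    simp_rw [h2]
    rw [← ofReal_integral_eq_lintegral_ofReal (hi.const_mul _)
      (Filter.Eventually.of_forall fun X => by have := vecSq_nonneg (b X); positivity),
      integral_const_mul]
    apply ENNReal.ofReal_le_ofReal
    rw [div_pow, mul_pow, Real.sq_sqrt hV0, Real.sq_sqrt hm.le]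
    calc _ ≤ M.T ^ 2 / M.m * V := by gcongr
      _ = _ := by ring

lemma l2Bound_star_linear_of_le (j : Fin n) {b : (Fin n → Fin N → ℂ) → Fin N → ℂ}
    (hb : Continuous b) (hbu : ∀ X x, b (Function.update X j x) = b X) {V : ℝ}
    (hV : ∀ X, vecSq (b X) ≤ V) :
    L2Bound M.arrayLaw (fun X => star (M.noise j X) ⬝ᵥ b X) (M.T * √V / √M.m) := by
  have hi : Integrable (fun X => vecSq (b X)) M.arrayLaw :=
    Integrable.of_bound (by unfold vecSq; fun_prop) V (Filter.Eventually.of_forall fun X => by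
      rw [Real.norm_of_nonneg (vecSq_nonneg _)]; exact hV X)
  refine M.l2Bound_star_linear j hb hbu hi ?_
  calc _ ≤ ∫ X, V ∂M.arrayLaw := integral_mono hi (integrable_const _) hV
    _ = V := by simp

lemma norm_dotProduct_noise (j : Fin n) (b : Fin N → ℂ) (X : Fin n → Fin N → ℂ) :
    ‖b ⬝ᵥ M.noise j X‖ = ‖star (M.noise j X) ⬝ᵥ star b‖ := by
  rw [Matrix.star_dotProduct_star, norm_star]

lemma l2Bound_linear (j : Fin n) {b : (Fin n → Fin N → ℂ) → Fin N → ℂ}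
    (hb : Continuous b) (hbu : ∀ X x, b (Function.update X j x) = b X)
    (hi : Integrable (fun X => vecSq (b X)) M.arrayLaw) {V : ℝ}
    (hV : ∫ X, vecSq (b X) ∂M.arrayLaw ≤ V) :
    L2Bound M.arrayLaw (fun X => b X ⬝ᵥ M.noise j X) (M.T * √V / √M.m) := by
  have hc : Continuous fun X => b X ⬝ᵥ M.noise j X := by fun_prop
  have h := (M.l2Bound_star_linear j (b := fun X => star (b X)) (by fun_prop)
    (fun X x => by rw [hbu]) (by simpa only [vecSq_star] using hi)
    (by simpa only [vecSq_star] using hV)).of_norm_le (g := fun X => b X ⬝ᵥ M.noise j X)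
    hc.aestronglyMeasurable zero_le_one (fun X => by rw [one_mul, norm_dotProduct_noise])
  simpa using h

lemma l2Bound_linear_of_le (j : Fin n) {b : (Fin n → Fin N → ℂ) → Fin N → ℂ}
    (hb : Continuous b) (hbu : ∀ X x, b (Function.update X j x) = b X) {V : ℝ}
    (hV : ∀ X, vecSq (b X) ≤ V) :
    L2Bound M.arrayLaw (fun X => b X ⬝ᵥ M.noise j X) (M.T * √V / √M.m) := by
  have hc : Continuous fun X => b X ⬝ᵥ M.noise j X := by fun_prop
  have h := (M.l2Bound_star_linear_of_le j (b := fun X => star (b X)) (by fun_prop)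
    (fun X x => by rw [hbu])
    (by simpa only [vecSq_star] using hV)).of_norm_le (g := fun X => b X ⬝ᵥ M.noise j X)
    hc.aestronglyMeasurable zero_le_one (fun X => by rw [one_mul, norm_dotProduct_noise])
  simpa using h

lemma frobSq_le_of_norm_le {B : Matrix (Fin N) (Fin N) ℂ} {β : ℝ} (h : ‖B‖ ≤ β) :
    frobSq B ≤ M.T * M.m * β ^ 2 := by
  refine (frobSq_le_card_mul B).trans ?_
  rw [Fintype.card_fin]
  have := M.T_pos
  have := M.m_pos
  gcongr
  exact M.N_le

lemma sqrt_frobSq_le_of_norm_le {B : Matrix (Fin N) (Fin N) ℂ} {β : ℝ} (h : ‖B‖ ≤ β) :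
    √(frobSq B) ≤ M.T * √M.m * β := by
  have hβ : 0 ≤ β := (norm_nonneg _).trans h
  have := M.m_pos
  refine (Real.sqrt_le_sqrt (M.frobSq_le_of_norm_le h)).trans ?_
  rw [mul_assoc, mul_assoc]
  refine (M.sqrt_le_T_mul _).trans_eq ?_
  rw [Real.sqrt_mul (by positivity), Real.sqrt_sq hβ]

/-- The trace is of order m and σ_j² of order 1/m, so the average stays bounded. -/
lemma norm_avgForm_le (j : Fin n) {B : Matrix (Fin N) (Fin N) ℂ} {β : ℝ} (h : ‖B‖ ≤ β) :
    ‖M.avgForm j B‖ ≤ M.T ^ 5 * β := by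
  have hT := M.T_pos
  have hm := M.m_pos
  have hβ : 0 ≤ β := (norm_nonneg _).trans h
  have h1 : ‖star (M.A.col j) ⬝ᵥ (B *ᵥ M.A.col j)‖ ≤ M.T * β := by
    refine (norm_dotProduct_le _ _).trans ?_
    rw [vecSq_star]
    have h2 : √(vecSq (B *ᵥ M.A.col j)) ≤ β * √(vecSq (M.A.col j)) := by
      rw [← Real.sqrt_sq hβ, ← Real.sqrt_mul (by positivity)]
      apply Real.sqrt_le_sqrt
      refine (vecSq_mulVec_le _ _).trans ?_
      have := vecSq_nonneg (M.A.col j)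
      gcongr
    calc _ ≤ √(vecSq (M.A.col j)) * (β * √(vecSq (M.A.col j))) := by gcongr
      _ = vecSq (M.A.col j) * β := by
        rw [mul_left_comm, Real.mul_self_sqrt (vecSq_nonneg _), mul_comm]
      _ ≤ _ := by gcongr; exact M.vecSq_col_le j
  have h2 : ‖(M.σ j : ℂ) ^ 2 * trace (M.D * B)‖ ≤ M.T ^ 4 * β := by
    rw [norm_mul, norm_pow, Complex.norm_real, Real.norm_eq_abs, sq_abs]
    calc _ ≤ M.T / M.m * ((M.T * √M.m * M.T) * (M.T * √M.m * β)) := by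
          gcongr
          · exact M.σ_sq_le j
          · refine (norm_trace_mul_le _ _).trans ?_
            gcongr
            · exact M.sqrt_frobSq_le_of_norm_le M.norm_D_le
            · exact M.sqrt_frobSq_le_of_norm_le h
      _ = M.T ^ 4 * β * (√M.m * √M.m) / M.m := by ring
      _ = _ := by rw [Real.mul_self_sqrt hm.le]; field_simp
  refine (norm_add_le _ _).trans ((add_le_add h1 h2).trans ?_)
  have h3 : M.T ≤ M.T ^ 4 := le_self_pow₀ M.one_le_T (by norm_num)
  calc M.T * β + M.T ^ 4 * β ≤ M.T ^ 4 * β + M.T ^ 4 * β := by gcongr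
    _ = 2 * (M.T ^ 4 * β) := by ring
    _ ≤ M.T * (M.T ^ 4 * β) := by gcongr; linarith [M.le_T]
    _ = _ := by ring

/-- Concentration of `η_j* B η_j` around its average over the `j`-th column. -/
lemma l2Bound_form_sub_avgForm (j : Fin n)
    {B : (Fin n → Fin N → ℂ) → Matrix (Fin N) (Fin N) ℂ}
    (hB : Continuous B) (hBu : ∀ X x, B (Function.update X j x) = B X) {β : ℝ}
    (hβ : ∀ X, ‖B X‖ ≤ β) (hβ0 : 0 ≤ β) :
    L2Bound M.arrayLaw (fun X => star ((M.S X).col j) ⬝ᵥ (B X *ᵥ (M.S X).col j) -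
      M.avgForm j (B X)) (M.T ^ 7 * β / √M.m) := by
  have hT := M.T_pos
  have hm := M.m_pos
  have hsm := M.sqrt_m_pos
  -- A bounded matrix has Frobenius norm of order √m, which turns the 1/m of the quadratic bound
  -- into m^(-1/2). The two cross terms between noise and a_j have the same order.
  have h1 := (M.l2Bound_quadratic j hB hBu (F := M.T * M.m * β ^ 2)
    fun X => M.frobSq_le_of_norm_le (hβ X)).mono (c' := M.T ^ 5 * β / √M.m) (by
      rw [mul_assoc M.T]
      calc _ ≤ M.T ^ 4 * (M.T * √(M.m * β ^ 2)) / M.m := by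
            gcongr; exact M.sqrt_le_T_mul _
        _ = M.T ^ 5 * β * √M.m / (√M.m * √M.m) := by
            rw [Real.sqrt_mul hm.le, Real.sqrt_sq hβ0, Real.mul_self_sqrt hm.le]; ring
        _ = _ := by field_simp)
  have hV : √(M.T * β ^ 2) ≤ M.T * β := by
    refine (M.sqrt_le_T_mul _).trans_eq ?_
    rw [Real.sqrt_sq hβ0]
  have h2 := (M.l2Bound_star_linear_of_le j (b := fun X => B X *ᵥ M.A.col j) (by fun_prop)
    (fun X x => by rw [hBu]) (V := M.T * β ^ 2) (fun X => by
      refine (vecSq_mulVec_le _ _).trans ?_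
      rw [mul_comm]
      have := vecSq_nonneg (M.A.col j)
      have := hβ X
      have := M.vecSq_col_le j
      gcongr)).mono (c' := M.T ^ 5 * β / √M.m) (by
        refine div_le_div_of_nonneg_right ?_ hsm.le
        calc M.T * √(M.T * β ^ 2) ≤ M.T * (M.T * β) := by gcongr
          _ = M.T ^ 2 * β := by ring
          _ ≤ _ := by gcongr; exacts [M.one_le_T, by norm_num])
  have h3 := (M.l2Bound_linear_of_le j (b := fun X => star (M.A.col j) ᵥ* B X) (by fun_prop)
    (fun X x => by rw [hBu]) (V := M.T * β ^ 2) (fun X => by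
      refine (vecSq_vecMul_le _ _).trans ?_
      rw [vecSq_star]
      have := vecSq_nonneg (M.A.col j)
      have := hβ X
      have := M.vecSq_col_le j
      gcongr)).mono (c' := M.T ^ 5 * β / √M.m) (by
        refine div_le_div_of_nonneg_right ?_ hsm.le
        calc M.T * √(M.T * β ^ 2) ≤ M.T * (M.T * β) := by gcongr
          _ = M.T ^ 2 * β := by ring
          _ ≤ _ := by gcongr; exacts [M.one_le_T, by norm_num])
  have hc : 0 ≤ M.T ^ 5 * β / √M.m := by positivity
  have h4 := (h1.add h2 hc hc).add h3 (by positivity) hc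
  refine (h4.congr fun X => ?_).mono ?_
  · rw [S_col, avgForm, star_add, add_dotProduct, Matrix.mulVec_add, dotProduct_add,
      dotProduct_add, Matrix.dotProduct_mulVec (star (M.A.col j)) (B X) (M.noise j X)]
    ring
  · calc _ = 3 * (M.T ^ 5 * β / √M.m) := by ring
      _ ≤ M.T ^ 2 * (M.T ^ 5 * β / √M.m) := by
        gcongr
        nlinarith [M.le_T]
      _ = _ := by ring

/-- A difference of inverses is minus their product times the difference of the denominators, and
that difference is a centred form of order m^(-1/2). -/
lemma l2Bound_q_sub_qAvg (j : Fin n) :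
    L2Bound M.arrayLaw (fun X => M.q j X - M.qAvg j X) (M.T ^ 10 / √M.m) := by
  have hT := M.T_pos
  have h := M.l2Bound_form_sub_avgForm j (M.continuous_Q₀ j) (M.Q₀_update j) (M.norm_Q₀_le j) hT.le
  refine (h.of_norm_le (g := fun X => M.q j X - M.qAvg j X) (b := M.T * M.T)
    (Continuous.aestronglyMeasurable (by fun_prop)) (by positivity) fun X => ?_).mono
      (le_of_eq (by ring))
  have h1 := one_add_leaveOutForm_ne_zero M.notMem_axis (M.S X) j
  have h2 := M.one_add_avgForm_ne_zero j X
  have h3 : M.q j X - M.qAvg j X = -(M.q j X * M.qAvg j X) *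
      (leaveOutForm (M.S X) M.z j - M.avgForm j (M.Q₀ j X)) := by
    unfold q qAvg
    field_simp
    ring
  rw [h3, norm_mul, norm_neg, norm_mul]
  refine mul_le_mul (mul_le_mul (M.norm_q_le j X) (M.norm_qAvg_le j X) (norm_nonneg _) hT.le)
    le_rfl (norm_nonneg _) (by positivity)

/-! ### Variance of linear statistics -/

lemma trace_D_mul_Q (j : Fin n) (X : Fin n → Fin N → ℂ) (C : Matrix (Fin N) (Fin N) ℂ) :
    trace (C * M.Q X) = trace (C * M.Q₀ j X) - M.q j X *
      (star ((M.S X).col j) ⬝ᵥ ((M.Q₀ j X * C * M.Q₀ j X) *ᵥ (M.S X).col j)) := by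
  have h := resolvent_eq_sub M.notMem_axis (M.S X) j
  rw [Q, h, mul_sub, trace_sub, mul_smul_comm, trace_smul, Matrix.mul_vecMulVec,
    Matrix.trace_vecMulVec, smul_eq_mul, dotProduct_comm, ← Matrix.dotProduct_mulVec,
    Matrix.mulVec_mulVec, Matrix.mulVec_mulVec]
  simp only [Q₀, q, Matrix.mul_assoc]

lemma norm_Q₀_mul_D_mul_Q₀_le (j : Fin n) (X : Fin n → Fin N → ℂ) :
    ‖M.Q₀ j X * M.D * M.Q₀ j X‖ ≤ M.T ^ 3 := by
  have := M.T_pos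
  calc _ ≤ ‖M.Q₀ j X‖ * ‖M.D‖ * ‖M.Q₀ j X‖ :=
        (norm_mul_le _ _).trans (by gcongr; exact norm_mul_le _ _)
    _ ≤ M.T * M.T * M.T := by gcongr; exacts [M.norm_Q₀_le j X, M.norm_D_le, M.norm_Q₀_le j X]
    _ = _ := by ring

lemma norm_trace_D_mul_le {B : Matrix (Fin N) (Fin N) ℂ} (h : ‖B‖ ≤ M.T) :
    ‖trace (M.D * B)‖ ≤ M.T ^ 4 * M.m := by
  have := M.T_pos
  have hm := M.m_pos
  calc _ ≤ √(frobSq M.D) * √(frobSq B) := norm_trace_mul_le _ _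
    _ ≤ (M.T * √M.m * M.T) * (M.T * √M.m * M.T) := by
      gcongr
      · exact M.sqrt_frobSq_le_of_norm_le M.norm_D_le
      · exact M.sqrt_frobSq_le_of_norm_le h
    _ = M.T ^ 4 * (√M.m * √M.m) := by ring
    _ = _ := by rw [Real.mul_self_sqrt hm.le]

/-- Efron–Stein over columns. By Sherman–Morrison Tr DQ = Tr DQ_j - q_j η_j*Q_jDQ_jη_j; replacing
the weight and the form by their column averages gives an approximant free of column j, with error
of order m^(-1/2) in L². The n squared errors add up to a bounded quantity. -/
lemma l2Bound_trace_D_Q_sub_integral :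
    L2Bound M.arrayLaw
      (fun X => trace (M.D * M.Q X) - ∫ Y, trace (M.D * M.Q Y) ∂M.arrayLaw) (M.T ^ 20) := by
  have hT := M.T_pos
  have hm := M.m_pos
  have hsm := M.sqrt_m_pos
  set B : Fin n → (Fin n → Fin N → ℂ) → Matrix (Fin N) (Fin N) ℂ :=
    fun j X => M.Q₀ j X * M.D * M.Q₀ j X with hB
  set g : Fin n → (Fin n → Fin N → ℂ) → ℂ :=
    fun j X => trace (M.D * M.Q₀ j X) - M.qAvg j X * M.avgForm j (B j X) with hg
  have hBc : ∀ j, Continuous (B j) := fun j => by simp only [hB]; fun_prop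
  have hgc : ∀ j, Continuous (g j) := fun j => by
    have := hBc j
    simp only [hg, avgForm]; fun_prop
  have hfc : Continuous fun X => trace (M.D * M.Q X) := by fun_prop
  have hdiff : ∀ j, L2Bound M.arrayLaw (fun X => trace (M.D * M.Q X) - g j X)
      (M.T ^ 19 / √M.m) := fun j => by
    have hτ := M.l2Bound_form_sub_avgForm j (hBc j) (fun X x => by simp only [hB, Q₀_update])
      (M.norm_Q₀_mul_D_mul_Q₀_le j) (by positivity)
    have h1 := hτ.bdd_mul (g := fun X => -M.q j X) (b := M.T)
      (Continuous.aestronglyMeasurable (by fun_prop)) hT.le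
      (fun X => by rw [norm_neg]; exact M.norm_q_le j X)
    have h2 := (M.l2Bound_q_sub_qAvg j).bdd_mul (g := fun X => M.avgForm j (B j X))
      (b := M.T ^ 8) (Continuous.aestronglyMeasurable (by have := hBc j; unfold avgForm; fun_prop))
      (by positivity) (fun X => (M.norm_avgForm_le j (M.norm_Q₀_mul_D_mul_Q₀_le j X)).trans_eq
        (by ring))
    have h3 := h1.sub h2 (by positivity) (by positivity)
    refine (h3.congr fun X => ?_).mono ?_
    · rw [trace_D_mul_Q M j X M.D]
      simp only [hg, hB]
      ring
    · have h11 : M.T ^ 11 ≤ M.T ^ 18 := pow_le_pow_right₀ M.one_le_T (by norm_num)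
      calc _ = (M.T ^ 11 + M.T ^ 18) / √M.m := by ring
        _ ≤ (M.T ^ 18 + M.T ^ 18) / √M.m := by gcongr
        _ = 2 * M.T ^ 18 / √M.m := by ring
        _ ≤ M.T * M.T ^ 18 / √M.m := by gcongr; linarith [M.le_T]
        _ = _ := by ring
  -- This crude bound, growing with m, serves only the boundedness hypotheses; it is padded so that
  -- one constant covers both the trace and the approximants.
  have hfb : ∀ X, ‖trace (M.D * M.Q X)‖ ≤ M.T ^ 4 * M.m + M.T * M.T ^ 8 := fun X =>
    (M.norm_trace_D_mul_le (M.norm_Q_le X)).trans (le_add_of_nonneg_right (by positivity))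
  have hgb : ∀ j X, ‖g j X‖ ≤ M.T ^ 4 * M.m + M.T * M.T ^ 8 := fun j X => by
    refine (norm_sub_le _ _).trans (add_le_add (M.norm_trace_D_mul_le (M.norm_Q₀_le j X)) ?_)
    rw [norm_mul]
    gcongr
    · exact M.norm_qAvg_le j X
    · exact (M.norm_avgForm_le j (M.norm_Q₀_mul_D_mul_Q₀_le j X)).trans_eq (by ring)
  have hES := efron_stein (ν := M.colLaw) hfc.measurable hfb (fun j => (hgc j).measurable) hgb
    (fun j X x => by simp only [hg, hB, Q₀_update, qAvg_update])
  refine L2Bound.of_integral (MemLp.of_bound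
    (Continuous.aestronglyMeasurable (by fun_prop))
    ((M.T ^ 4 * M.m + M.T * M.T ^ 8) + ‖∫ Y, trace (M.D * M.Q Y) ∂M.arrayLaw‖)
    (Filter.Eventually.of_forall fun X => (norm_sub_le _ _).trans (by gcongr; exact hfb X)))
    (by positivity) (hES.trans ?_)
  calc _ ≤ ∑ j : Fin n, (M.T ^ 19 / √M.m) ^ 2 :=
        Finset.sum_le_sum fun j _ => (hdiff j).integral_sq_le (by positivity)
    _ = n * (M.T ^ 38 / M.m) := by
        rw [Finset.sum_const, Finset.card_univ, Fintype.card_fin, nsmul_eq_mul, div_pow,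
          Real.sq_sqrt hm.le]; ring
    _ ≤ (M.T * M.m) * (M.T ^ 38 / M.m) := by gcongr; exact M.n_le
    _ = M.T ^ 39 := by field_simp
    _ ≤ M.T ^ 40 := pow_le_pow_right₀ M.one_le_T (by norm_num)
    _ = _ := by ring

end ColumnModel

namespace ColumnModel

variable {N n : ℕ} (M : ColumnModel N n)

/-! ### Centred forms have mean zero -/

lemma integral_mul_quadratic_eq_zero (j : Fin n) {f : (Fin n → Fin N → ℂ) → ℂ}
    {B : (Fin n → Fin N → ℂ) → Matrix (Fin N) (Fin N) ℂ}
    (hf : ∀ X x, f (Function.update X j x) = f X) (hB : ∀ X x, B (Function.update X j x) = B X) :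
    ∫ X, f X * (star (M.noise j X) ⬝ᵥ (B X *ᵥ M.noise j X) -
      (M.σ j : ℂ) ^ 2 * trace (M.D * B X)) ∂M.arrayLaw = 0 := by
  refine integral_eq_zero_of_update j fun X => ?_
  simp only [noise_update, hf, hB, star_noise_dotProduct_mulVec]
  rw [integral_const_mul, integral_const_mul, M.law.integral_quadratic]
  simp

lemma integral_mul_star_linear_eq_zero (j : Fin n) {f : (Fin n → Fin N → ℂ) → ℂ}
    {b : (Fin n → Fin N → ℂ) → Fin N → ℂ}
    (hf : ∀ X x, f (Function.update X j x) = f X) (hb : ∀ X x, b (Function.update X j x) = b X) :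
    ∫ X, f X * (star (M.noise j X) ⬝ᵥ b X) ∂M.arrayLaw = 0 := by
  refine integral_eq_zero_of_update j fun X => ?_
  have h1 : ∀ x, star ((M.σ j : ℂ) • (realDiag M.p *ᵥ x)) ⬝ᵥ b X =
      (M.σ j : ℂ) * (star x ⬝ᵥ (realDiag M.p *ᵥ b X)) := fun x => by
    rw [star_smul, smul_dotProduct, Matrix.star_mulVec, conjTranspose_realDiag,
      ← Matrix.dotProduct_mulVec]
    simp
  simp only [noise_update, hf, hb, h1]
  rw [integral_const_mul, integral_const_mul, M.law.integral_star_linear]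
  simp

lemma integral_mul_linear_eq_zero (j : Fin n) {f : (Fin n → Fin N → ℂ) → ℂ}
    {b : (Fin n → Fin N → ℂ) → Fin N → ℂ}
    (hf : ∀ X x, f (Function.update X j x) = f X) (hb : ∀ X x, b (Function.update X j x) = b X) :
    ∫ X, f X * (b X ⬝ᵥ M.noise j X) ∂M.arrayLaw = 0 := by
  refine integral_eq_zero_of_update j fun X => ?_
  have h1 : ∀ x, b X ⬝ᵥ ((M.σ j : ℂ) • (realDiag M.p *ᵥ x)) =
      (M.σ j : ℂ) * ((b X ᵥ* realDiag M.p) ⬝ᵥ x) := fun x => by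
    rw [dotProduct_smul, Matrix.dotProduct_mulVec, smul_eq_mul]
  simp only [noise_update, hf, hb, h1]
  rw [integral_const_mul, integral_const_mul, M.law.integral_linear]
  simp

/-! ### The deterministic equivalent -/

/-- The mean `𝔼 Tr D Q`. -/
noncomputable def meanTrace : ℂ := ∫ X, trace (M.D * M.Q X) ∂M.arrayLaw

/-- The deterministic weights `(1 + σ_j² 𝔼 Tr D Q)⁻¹`. -/
noncomputable def g (j : Fin n) : ℂ := (1 + (M.σ j : ℂ) ^ 2 * M.meanTrace)⁻¹

/-- The weighted sum of the random weights. -/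
noncomputable def lam (X : Fin n → Fin N → ℂ) : ℂ := ∑ j, (M.σ j : ℂ) ^ 2 * M.q j X

/-- The mean of the weighted sum of the random weights. -/
noncomputable def meanLam : ℂ := ∫ X, M.lam X ∂M.arrayLaw

/-- The inverse of the deterministic equivalent of the resolvent. -/
noncomputable def Rinv : Matrix (Fin N) (Fin N) ℂ :=
  (-M.z) • (1 : Matrix (Fin N) (Fin N) ℂ) + M.meanLam • M.D +
    M.A * Matrix.diagonal M.g * M.Aᴴ

lemma integrable_trace_D_Q : Integrable (fun X => trace (M.D * M.Q X)) M.arrayLaw :=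
  Integrable.of_bound (Continuous.aestronglyMeasurable (by fun_prop)) (M.T ^ 4 * M.m)
    (Filter.Eventually.of_forall fun X => M.norm_trace_D_mul_le (M.norm_Q_le X))

lemma trace_D_mul (B : Matrix (Fin N) (Fin N) ℂ) :
    trace (M.D * B) = ∑ i, ((M.p i ^ 2 : ℝ) : ℂ) * B i i := by
  simp [trace, D, realDiag, Matrix.diagonal_mul]

lemma resolventCone_meanTrace (j : Fin n) :
    ResolventCone M.z ((M.σ j : ℂ) ^ 2 * M.meanTrace) := by
  have h : ResolventCone M.z M.meanTrace :=
    ResolventCone.integral M.integrable_trace_D_Q fun X => by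
      rw [trace_D_mul]
      exact ResolventCone.sum _ fun i _ =>
        (resolventCone_apply M.notMem_axis _ i).ofReal_mul (by positivity)
  have h2 := h.ofReal_mul (sq_nonneg (M.σ j))
  push_cast at h2
  exact h2

lemma norm_g_le (j : Fin n) : ‖M.g j‖ ≤ M.T :=
  ((M.resolventCone_meanTrace j).norm_inv_one_add_le M.notMem_axis).trans M.norm_div_delta_le

/-- The fluctuation `y_j* Q_j η_j - σ_j² 𝔼 Tr D Q`. -/
noncomputable def s (j : Fin n) (X : Fin n → Fin N → ℂ) : ℂ :=
  star (M.noise j X) ⬝ᵥ (M.Q₀ j X *ᵥ (M.S X).col j) - (M.σ j : ℂ) ^ 2 * M.meanTrace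

/-- The bilinear form of `y_j` and `η_j` centred over the `j`-th column. -/
noncomputable def xi (K : Matrix (Fin N) (Fin N) ℂ) (j : Fin n) (X : Fin n → Fin N → ℂ) : ℂ :=
  star ((M.S X).col j) ⬝ᵥ ((M.Q₀ j X * K) *ᵥ M.noise j X) -
    (M.σ j : ℂ) ^ 2 * trace (M.D * (M.Q₀ j X * K))

@[fun_prop]
lemma continuous_lam : Continuous M.lam := by
  unfold lam; fun_prop

/-! ### Exact expansion of the error -/

lemma star_col_dotProduct_Q_mul (j : Fin n) (X : Fin n → Fin N → ℂ)
    (K : Matrix (Fin N) (Fin N) ℂ) (v : Fin N → ℂ) :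
    star ((M.S X).col j) ⬝ᵥ ((M.Q X * K) *ᵥ v) =
      M.q j X * (star ((M.S X).col j) ⬝ᵥ ((M.Q₀ j X * K) *ᵥ v)) := by
  have h := star_col_vecMul_resolvent M.notMem_axis (M.S X) j
  rw [← Matrix.mulVec_mulVec, Matrix.dotProduct_mulVec, Q, h, smul_dotProduct, smul_eq_mul,
    ← Matrix.dotProduct_mulVec, Matrix.mulVec_mulVec]
  rfl

/-- Put c = η_j*Q_jKa_j. Sherman–Morrison and the definitions of q_j and s_j give a_j*QKa_j = q_j(1
+ σ_j²𝔼Tr DQ + s_j) c - y_j*Q_jKa_j. Multiplying by g_j turns the deterministic factor into 1, and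
q_j c cancels against the same term of η_j*QKη_j. -/
lemma column_identity (K : Matrix (Fin N) (Fin N) ℂ) (j : Fin n) (X : Fin n → Fin N → ℂ) :
    M.g j * (star (M.A.col j) ⬝ᵥ ((M.Q X * K) *ᵥ M.A.col j)) -
        star ((M.S X).col j) ⬝ᵥ ((M.Q X * K) *ᵥ (M.S X).col j) =
      M.g j * (M.q j X * M.s j X * (star ((M.S X).col j) ⬝ᵥ ((M.Q₀ j X * K) *ᵥ M.A.col j)) -
        star (M.noise j X) ⬝ᵥ ((M.Q₀ j X * K) *ᵥ M.A.col j)) -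
      M.q j X * (star ((M.S X).col j) ⬝ᵥ ((M.Q₀ j X * K) *ᵥ M.noise j X)) := by
  have hq0 := one_add_leaveOutForm_ne_zero M.notMem_axis (M.S X) j
  have hg0 := (M.resolventCone_meanTrace j).one_add_ne_zero M.notMem_axis
  have hq : M.q j X * (1 + leaveOutForm (M.S X) M.z j) = 1 := inv_mul_cancel₀ hq0
  have hg : M.g j * (1 + (M.σ j : ℂ) ^ 2 * M.meanTrace) = 1 := inv_mul_cancel₀ hg0
  have h1 : star (M.A.col j) ⬝ᵥ ((M.Q X * K) *ᵥ M.A.col j) =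
      star (M.A.col j) ⬝ᵥ ((M.Q₀ j X * K) *ᵥ M.A.col j) - M.q j X *
        (star (M.A.col j) ⬝ᵥ (M.Q₀ j X *ᵥ (M.S X).col j)) *
        (star ((M.S X).col j) ⬝ᵥ ((M.Q₀ j X * K) *ᵥ M.A.col j)) := by
    have h := resolvent_eq_sub M.notMem_axis (M.S X) j
    rw [← Matrix.mulVec_mulVec, Q, h, Matrix.sub_mulVec, dotProduct_sub, Matrix.smul_mulVec,
      dotProduct_smul, Matrix.vecMulVec_mulVec, dotProduct_smul, ← Matrix.dotProduct_mulVec]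
    simp only [Matrix.mulVec_mulVec, Q₀, q, smul_eq_mul, MulOpposite.smul_eq_mul_unop,
      MulOpposite.unop_op]
    ring
  have h2 : star (M.noise j X) ⬝ᵥ (M.Q₀ j X *ᵥ (M.S X).col j) =
      leaveOutForm (M.S X) M.z j - star (M.A.col j) ⬝ᵥ (M.Q₀ j X *ᵥ (M.S X).col j) := by
    rw [leaveOutForm, ← Q₀, eq_sub_iff_add_eq', ← add_dotProduct, ← star_add, ← S_col]
  have h3 : star (M.noise j X) ⬝ᵥ ((M.Q₀ j X * K) *ᵥ M.A.col j) =
      star ((M.S X).col j) ⬝ᵥ ((M.Q₀ j X * K) *ᵥ M.A.col j) -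
        star (M.A.col j) ⬝ᵥ ((M.Q₀ j X * K) *ᵥ M.A.col j) := by
    rw [eq_sub_iff_add_eq', ← add_dotProduct, ← star_add, ← S_col]
  have h4 : star ((M.S X).col j) ⬝ᵥ ((M.Q X * K) *ᵥ (M.S X).col j) =
      M.q j X * (star ((M.S X).col j) ⬝ᵥ ((M.Q₀ j X * K) *ᵥ M.A.col j) +
        star ((M.S X).col j) ⬝ᵥ ((M.Q₀ j X * K) *ᵥ M.noise j X)) := by
    rw [star_col_dotProduct_Q_mul, ← dotProduct_add, ← Matrix.mulVec_add, ← S_col]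
  rw [h1, h4, s, h2, h3]
  generalize star ((M.S X).col j) ⬝ᵥ ((M.Q₀ j X * K) *ᵥ M.A.col j) = c2
  linear_combination (-(M.g j * c2)) * hq + (M.q j X * c2) * hg

lemma trace_mul_conj_diag (C : Matrix (Fin N) (Fin N) ℂ) (U : Matrix (Fin N) (Fin n) ℂ)
    (w : Fin n → ℂ) :
    trace (C * (U * Matrix.diagonal w * Uᴴ)) =
      ∑ j, w j * (star (U.col j) ⬝ᵥ (C *ᵥ U.col j)) := by
  rw [← Matrix.mul_assoc, Matrix.trace_mul_comm, ← Matrix.mul_assoc, ← Matrix.mul_assoc]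
  simp only [trace, diag_apply, Matrix.mul_diagonal]
  refine Finset.sum_congr rfl fun j _ => ?_
  rw [mul_comm, Matrix.mul_assoc, Matrix.mul_apply']
  rfl

/-- The quantity which measures the error of the deterministic equivalent. -/
noncomputable def errTrace (K : Matrix (Fin N) (Fin N) ℂ) (X : Fin n → Fin N → ℂ) : ℂ :=
  trace (K * (M.Rinv * M.Q X - 1))

/-- The contribution of the rank-one perturbations to the error. -/
noncomputable def rankOneErr (K : Matrix (Fin N) (Fin N) ℂ) (X : Fin n → Fin N → ℂ) : ℂ :=
  trace (K * (M.D * (M.Q X * M.S X) * Matrix.diagonal (fun j => (M.σ j : ℂ) ^ 2) *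
    ((M.S X)ᴴ * M.Q X)))

/-- The rank-one corrections reassemble into S diag(σ²) S*, so their sum can be bounded at once by
operator norms instead of term by term. -/
lemma rankOneErr_eq (K : Matrix (Fin N) (Fin N) ℂ) (X : Fin n → Fin N → ℂ) :
    M.rankOneErr K X =
      ∑ j, (M.σ j : ℂ) ^ 2 * M.q j X * (trace (K * M.D * M.Q₀ j X) - trace (K * M.D * M.Q X)) := by
  have h : M.rankOneErr K X = trace (M.Q X * K * M.D * M.Q X *
      (M.S X * Matrix.diagonal (fun j => (M.σ j : ℂ) ^ 2) * (M.S X)ᴴ)) := by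
    rw [rankOneErr]
    calc _ = trace ((K * (M.D * (M.Q X * M.S X) * Matrix.diagonal (fun j => (M.σ j : ℂ) ^ 2) *
          (M.S X)ᴴ)) * M.Q X) := by simp only [Matrix.mul_assoc]
      _ = _ := by rw [Matrix.trace_mul_comm]; simp only [Matrix.mul_assoc]
  rw [h, trace_mul_conj_diag]
  refine Finset.sum_congr rfl fun j _ => ?_
  rw [M.trace_D_mul_Q j X (K * M.D), Matrix.mul_assoc (M.Q X), Matrix.mul_assoc (M.Q X),
    star_col_dotProduct_Q_mul]
  have h2 := resolvent_mulVec_col M.notMem_axis (M.S X) j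
  have h3 : (M.Q₀ j X * (K * M.D * M.Q X)) *ᵥ (M.S X).col j =
      M.q j X • ((M.Q₀ j X * (K * M.D) * M.Q₀ j X) *ᵥ (M.S X).col j) := by
    rw [← Matrix.mul_assoc, ← Matrix.mulVec_mulVec, Q, h2, Matrix.mulVec_smul,
      Matrix.mulVec_mulVec]
    rfl
  rw [h3, dotProduct_smul, smul_eq_mul]
  ring

/-- SS*Q = 1 + zQ reduces R⁻¹Q - 1 to column terms plus 𝔼λ DQ. Centring η_j*Q_jKy_j in
`column_identity` produces σ_j²q_j Tr KDQ_j. Replacing Q_j by Q there costs `rankOneErr`, and what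
remains is λ Tr KDQ, which the term 𝔼λ Tr KDQ compensates. -/
lemma errTrace_eq (K : Matrix (Fin N) (Fin N) ℂ) (X : Fin n → Fin N → ℂ) :
    M.errTrace K X = -((M.lam X - M.meanLam) * trace (K * M.D * M.Q X)) - M.rankOneErr K X +
      ∑ j, (M.g j * (M.q j X * M.s j X *
          (star ((M.S X).col j) ⬝ᵥ ((M.Q₀ j X * K) *ᵥ M.A.col j))) -
        M.g j * (star (M.noise j X) ⬝ᵥ ((M.Q₀ j X * K) *ᵥ M.A.col j)) -
        M.q j X * M.xi K j X) := by
  have h1 : M.Rinv * M.Q X - 1 =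
      M.meanLam • (M.D * M.Q X) + M.A * Matrix.diagonal M.g * M.Aᴴ * M.Q X -
        M.S X * Matrix.diagonal (fun _ : Fin n => (1 : ℂ)) * (M.S X)ᴴ * M.Q X := by
    have h := gram_mul_resolvent M.notMem_axis (M.S X)
    rw [Matrix.diagonal_one, Matrix.mul_one, Rinv, Q, h]
    simp only [Matrix.add_mul, Matrix.smul_mul, Matrix.one_mul, neg_smul, Matrix.neg_mul]
    abel
  have h2 : ∀ (U : Matrix (Fin N) (Fin n) ℂ) (w : Fin n → ℂ),
      trace (K * (U * Matrix.diagonal w * Uᴴ * M.Q X)) =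
        ∑ j, w j * (star (U.col j) ⬝ᵥ ((M.Q X * K) *ᵥ U.col j)) := fun U w => by
    rw [← trace_mul_conj_diag, ← Matrix.mul_assoc, Matrix.trace_mul_comm]
    simp only [Matrix.mul_assoc]
  have h3 : M.errTrace K X = M.meanLam * trace (K * M.D * M.Q X) +
      ∑ j, (M.g j * (star (M.A.col j) ⬝ᵥ ((M.Q X * K) *ᵥ M.A.col j)) -
        star ((M.S X).col j) ⬝ᵥ ((M.Q X * K) *ᵥ (M.S X).col j)) := by
    rw [errTrace, h1, Matrix.mul_sub, Matrix.mul_add, trace_sub, trace_add, h2, h2,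
      Finset.sum_sub_distrib, Matrix.mul_smul, trace_smul, smul_eq_mul, ← Matrix.mul_assoc]
    simp only [one_mul]
    ring
  rw [h3, rankOneErr_eq, lam]
  simp only [column_identity, sub_mul, Finset.sum_mul, Finset.sum_sub_distrib, mul_sub, xi]
  have h4 : ∀ j, trace (K * M.D * M.Q₀ j X) = trace (M.D * (M.Q₀ j X * K)) := fun j => by
    rw [Matrix.mul_assoc, Matrix.trace_mul_comm, Matrix.mul_assoc]
  simp only [h4]
  have h5 : ∀ j, M.q j X * ((M.σ j : ℂ) ^ 2 * trace (M.D * (M.Q₀ j X * K))) =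
      (M.σ j : ℂ) ^ 2 * M.q j X * trace (M.D * (M.Q₀ j X * K)) := fun j => by ring
  simp only [h5]
  ring

end ColumnModel

/-! ### Bounds on the deterministic level for the terms of the expansion -/

lemma sum_sqrt_le {n : ℕ} {u : Fin n → ℝ} (hu : ∀ j, 0 ≤ u j) :
    ∑ j, √(u j) ≤ √n * √(∑ j, u j) := by
  have h := Real.sum_sqrt_mul_sqrt_le (f := fun _ : Fin n => (1 : ℝ)) (g := u) Finset.univ
    (fun _ => zero_le_one) hu
  simpa using h

namespace ColumnModel

variable {N n : ℕ} (M : ColumnModel N n)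

lemma pow_le {k l : ℕ} (h : k ≤ l) : M.T ^ k ≤ M.T ^ l := pow_le_pow_right₀ M.one_le_T h

lemma sqrt_n_le : √(n : ℝ) ≤ M.T * √M.m :=
  (Real.sqrt_le_sqrt M.n_le).trans (M.sqrt_le_T_mul _)

lemma norm_sq_conjTranspose_S_mul_Q_le (X : Fin n → Fin N → ℂ) :
    ‖(M.S X)ᴴ * M.Q X‖ ^ 2 ≤ M.T ^ 3 := by
  have h := norm_conjTranspose_mul_resolvent_sq_le M.notMem_axis (M.S X)
  have h1 := M.inv_delta_le
  have h2 := M.norm_div_delta_le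
  have h3 := deltaZ_pos M.notMem_axis
  have hT := M.T_pos
  calc _ ≤ _ := h
    _ ≤ M.T * (1 + M.T) := by gcongr
    _ ≤ M.T ^ 3 := by nlinarith [M.le_T, mul_pos hT hT]

lemma norm_sq_Q_mul_S_le (X : Fin n → Fin N → ℂ) : ‖M.Q X * M.S X‖ ^ 2 ≤ M.T ^ 3 := by
  have h := norm_resolvent_mul_sq_le M.notMem_axis (M.S X)
  have h1 := M.inv_delta_le
  have h2 := M.norm_div_delta_le
  have h3 := deltaZ_pos M.notMem_axis
  have hT := M.T_pos
  calc _ ≤ _ := h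
    _ ≤ M.T * (1 + M.T) := by gcongr
    _ ≤ M.T ^ 3 := by nlinarith [M.le_T, mul_pos hT hT]

/-- The matrix paired with K has operator norm of order 1/m, because QS and S*Q are bounded, hence
Frobenius norm of order m^(-1/2). -/
lemma norm_rankOneErr_le (K : Matrix (Fin N) (Fin N) ℂ) (X : Fin n → Fin N → ℂ) :
    ‖M.rankOneErr K X‖ ≤ M.T ^ 6 * √(frobSq K) / √M.m := by
  have hT := M.T_pos
  have hm := M.m_pos
  have hsm := M.sqrt_m_pos
  have h1 : ‖M.Q X * M.S X‖ * ‖(M.S X)ᴴ * M.Q X‖ ≤ M.T ^ 3 := by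
    nlinarith [M.norm_sq_Q_mul_S_le X, M.norm_sq_conjTranspose_S_mul_Q_le X,
      sq_nonneg (‖M.Q X * M.S X‖ - ‖(M.S X)ᴴ * M.Q X‖)]
  have hΘ : ‖Matrix.diagonal (fun j => (M.σ j : ℂ) ^ 2)‖ ≤ M.T / M.m := by
    rw [Matrix.l2_opNorm_diagonal]
    refine (pi_norm_le_iff_of_nonneg (by positivity)).2 fun j => ?_
    rw [norm_pow, Complex.norm_real, Real.norm_eq_abs, sq_abs]
    exact M.σ_sq_le j
  have h2 : ‖M.D * (M.Q X * M.S X) * Matrix.diagonal (fun j => (M.σ j : ℂ) ^ 2) *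
      ((M.S X)ᴴ * M.Q X)‖ ≤ M.T ^ 5 / M.m := by
    calc _ ≤ ‖M.D‖ * ‖M.Q X * M.S X‖ * ‖Matrix.diagonal (fun j => (M.σ j : ℂ) ^ 2)‖ *
          ‖(M.S X)ᴴ * M.Q X‖ := by
          refine (Matrix.l2_opNorm_mul _ _).trans ?_
          gcongr
          refine (Matrix.l2_opNorm_mul _ _).trans ?_
          gcongr
          exact Matrix.l2_opNorm_mul _ _
      _ ≤ M.T * ‖M.Q X * M.S X‖ * (M.T / M.m) * ‖(M.S X)ᴴ * M.Q X‖ := by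
          gcongr
          exact M.norm_D_le
      _ = M.T ^ 2 / M.m * (‖M.Q X * M.S X‖ * ‖(M.S X)ᴴ * M.Q X‖) := by ring
      _ ≤ M.T ^ 2 / M.m * M.T ^ 3 := by gcongr
      _ = _ := by ring
  calc _ ≤ √(frobSq K) * (M.T * √M.m * (M.T ^ 5 / M.m)) := by
        refine (norm_trace_mul_le _ _).trans ?_
        gcongr
        exact M.sqrt_frobSq_le_of_norm_le h2
    _ = M.T ^ 6 * √(frobSq K) * √M.m / (√M.m * √M.m) := by
        rw [Real.mul_self_sqrt hm.le]; ring
    _ = _ := by field_simp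

lemma norm_trace_K_D_Q_le (K : Matrix (Fin N) (Fin N) ℂ) (X : Fin n → Fin N → ℂ) :
    ‖trace (K * M.D * M.Q X)‖ ≤ M.T ^ 3 * √M.m * √(frobSq K) := by
  have hT := M.T_pos
  have h : ‖M.D * M.Q X‖ ≤ M.T ^ 2 := by
    refine (norm_mul_le _ _).trans ?_
    rw [sq]
    exact mul_le_mul M.norm_D_le (M.norm_Q_le X) (norm_nonneg _) hT.le
  rw [Matrix.mul_assoc]
  calc _ ≤ √(frobSq K) * (M.T * √M.m * M.T ^ 2) := by
        refine (norm_trace_mul_le _ _).trans ?_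
        gcongr
        exact M.sqrt_frobSq_le_of_norm_le h
    _ = _ := by ring

/-! ### The forms `a_j* Q_j K` -/

lemma vecSq_col_vecMul_Q₀_mul_le (K : Matrix (Fin N) (Fin N) ℂ) (j : Fin n)
    (X : Fin n → Fin N → ℂ) :
    vecSq (star (M.A.col j) ᵥ* (M.Q₀ j X * K)) ≤ M.T ^ 3 * frobSq K := by
  have hT := M.T_pos
  have hK := frobSq_nonneg K
  calc _ ≤ vecSq (star (M.A.col j)) * frobSq (M.Q₀ j X * K) := vecSq_vecMul_le_frobSq _ _
    _ ≤ M.T * (M.T ^ 2 * frobSq K) := by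
        rw [vecSq_star]
        gcongr
        · exact frobSq_nonneg _
        · exact M.vecSq_col_le j
        · refine (frobSq_mul_le_left _ _).trans ?_
          gcongr
          exact M.norm_Q₀_le j X
    _ = _ := by ring

lemma integrable_vecSq_col_vecMul (K : Matrix (Fin N) (Fin N) ℂ) (j : Fin n) :
    Integrable (fun X => vecSq (star (M.A.col j) ᵥ* (M.Q₀ j X * K))) M.arrayLaw := by
  have hc : Continuous fun X => star (M.A.col j) ᵥ* (M.Q₀ j X * K) := by fun_prop
  refine Integrable.of_bound (Continuous.aestronglyMeasurable (by unfold vecSq; fun_prop))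
    (M.T ^ 3 * frobSq K) (Filter.Eventually.of_forall fun X => ?_)
  rw [Real.norm_of_nonneg (vecSq_nonneg _)]
  exact M.vecSq_col_vecMul_Q₀_mul_le K j X

/-- Since η_j*QK = q_j(a_j + y_j)*Q_jK, the row r = a_j*Q_jK equals q̄_j⁻¹(η_j*QK + (q̄_j - q_j) r -
q_j y_j*Q_jK), with q̄_j the averaged weight. Unlike q_j⁻¹, q̄_j⁻¹ is bounded. The first row is
summable over j, and the other two are small on average. -/
lemma vecSq_col_vecMul_le_three (K : Matrix (Fin N) (Fin N) ℂ) (j : Fin n)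
    (X : Fin n → Fin N → ℂ) :
    vecSq (star (M.A.col j) ᵥ* (M.Q₀ j X * K)) ≤
      M.T ^ 15 * (vecSq (star ((M.S X).col j) ᵥ* (M.Q X * K)) +
        ‖M.q j X - M.qAvg j X‖ ^ 2 * (M.T ^ 3 * frobSq K) +
        M.T ^ 2 * vecSq (star (M.noise j X) ᵥ* (M.Q₀ j X * K))) := by
  have hT := M.T_pos
  set r := star (M.A.col j) ᵥ* (M.Q₀ j X * K) with hr
  set y := star (M.noise j X) ᵥ* (M.Q₀ j X * K) with hy
  have hη : star ((M.S X).col j) ᵥ* (M.Q X * K) = M.q j X • (r + y) := by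
    rw [← Matrix.vecMul_vecMul, Q, star_col_vecMul_resolvent M.notMem_axis, Matrix.smul_vecMul,
      Matrix.vecMul_vecMul, S_col, star_add, Matrix.add_vecMul]
    rfl
  have hne := M.one_add_avgForm_ne_zero j X
  have hq : (1 + M.avgForm j (M.Q₀ j X)) * M.qAvg j X = 1 := mul_inv_cancel₀ hne
  have hdec : r = (1 + M.avgForm j (M.Q₀ j X)) •
      (star ((M.S X).col j) ᵥ* (M.Q X * K) + (M.qAvg j X - M.q j X) • r + (-M.q j X) • y) := by
    rw [hη]
    have : M.q j X • (r + y) + (M.qAvg j X - M.q j X) • r + -M.q j X • y = M.qAvg j X • r := by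
      module
    rw [this, smul_smul, hq, one_smul]
  have hn : ‖1 + M.avgForm j (M.Q₀ j X)‖ ≤ M.T ^ 7 := by
    refine (norm_add_le _ _).trans ?_
    have h1 := M.norm_avgForm_le j (M.norm_Q₀_le j X)
    have h2 : (1 : ℝ) ≤ M.T ^ 6 := one_le_pow₀ M.one_le_T
    rw [norm_one]
    calc 1 + ‖M.avgForm j (M.Q₀ j X)‖ ≤ M.T ^ 6 + M.T ^ 5 * M.T := by gcongr
      _ = 2 * M.T ^ 6 := by ring
      _ ≤ M.T * M.T ^ 6 := by gcongr; linarith [M.le_T]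
      _ = _ := by ring
  have h3 := vecSq_add_three_le (star ((M.S X).col j) ᵥ* (M.Q X * K))
    ((M.qAvg j X - M.q j X) • r) ((-M.q j X) • y)
  have hv1 := vecSq_nonneg (star ((M.S X).col j) ᵥ* (M.Q X * K))
  have hv2 := vecSq_nonneg r
  have hv3 := vecSq_nonneg y
  calc vecSq r = ‖1 + M.avgForm j (M.Q₀ j X)‖ ^ 2 * vecSq (star ((M.S X).col j) ᵥ* (M.Q X * K) +
        (M.qAvg j X - M.q j X) • r + (-M.q j X) • y) := by
        conv_lhs => rw [hdec]
        rw [vecSq_smul]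
    _ ≤ (M.T ^ 7) ^ 2 * (3 * (vecSq (star ((M.S X).col j) ᵥ* (M.Q X * K)) +
        vecSq ((M.qAvg j X - M.q j X) • r) + vecSq ((-M.q j X) • y))) := by
        gcongr
        exact vecSq_nonneg _
    _ ≤ (M.T ^ 7) ^ 2 * (M.T * (vecSq (star ((M.S X).col j) ᵥ* (M.Q X * K)) +
        ‖M.q j X - M.qAvg j X‖ ^ 2 * (M.T ^ 3 * frobSq K) + M.T ^ 2 * vecSq y)) := by
        rw [vecSq_smul, vecSq_smul, norm_neg, norm_sub_rev]
        gcongr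
        · linarith [M.le_T]
        · exact M.vecSq_col_vecMul_Q₀_mul_le K j X
        · exact M.norm_q_le j X
    _ = _ := by ring

/-- One linear form in the noise for each column of K; their variances add up to the Frobenius norm.
-/
lemma integral_vecSq_noise_vecMul_le (K : Matrix (Fin N) (Fin N) ℂ) (j : Fin n) :
    Integrable (fun X => vecSq (star (M.noise j X) ᵥ* (M.Q₀ j X * K))) M.arrayLaw ∧
    ∫ X, vecSq (star (M.noise j X) ᵥ* (M.Q₀ j X * K)) ∂M.arrayLaw ≤ M.T ^ 4 * frobSq K / M.m := by
  have hT := M.T_pos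
  have hm := M.m_pos
  have h : ∀ k, L2Bound M.arrayLaw (fun X => star (M.noise j X) ⬝ᵥ (M.Q₀ j X *ᵥ K.col k))
      (M.T * √(M.T ^ 2 * vecSq (K.col k)) / √M.m) := fun k =>
    M.l2Bound_star_linear_of_le j (b := fun X => M.Q₀ j X *ᵥ K.col k) (by fun_prop)
      (fun X x => by rw [Q₀_update]) (fun X => by
        refine (vecSq_mulVec_le _ _).trans ?_
        have := vecSq_nonneg (K.col k)
        have := M.norm_Q₀_le j X
        gcongr)
  have he : ∀ X, vecSq (star (M.noise j X) ᵥ* (M.Q₀ j X * K)) =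
      ∑ k, ‖star (M.noise j X) ⬝ᵥ (M.Q₀ j X *ᵥ K.col k)‖ ^ 2 := fun X => rfl
  simp_rw [he]
  have hi : ∀ k, Integrable (fun X => ‖star (M.noise j X) ⬝ᵥ (M.Q₀ j X *ᵥ K.col k)‖ ^ 2)
      M.arrayLaw := fun k => (h k).memLp.norm.integrable_sq
  refine ⟨integrable_finsetSum _ fun k _ => hi k, ?_⟩
  rw [integral_finsetSum _ fun k _ => hi k]
  calc _ ≤ ∑ k, (M.T * √(M.T ^ 2 * vecSq (K.col k)) / √M.m) ^ 2 :=
        Finset.sum_le_sum fun k _ => (h k).integral_sq_le (by positivity)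
    _ = ∑ k, M.T ^ 4 / M.m * vecSq (K.col k) := by
        refine Finset.sum_congr rfl fun k _ => ?_
        have := vecSq_nonneg (K.col k)
        rw [div_pow, mul_pow, Real.sq_sqrt (by positivity), Real.sq_sqrt hm.le]
        ring
    _ = _ := by rw [← Finset.mul_sum, ← frobSq_eq_sum_col]; ring

lemma sum_vecSq_col_vecMul_Q (K : Matrix (Fin N) (Fin N) ℂ) (X : Fin n → Fin N → ℂ) :
    ∑ j, vecSq (star ((M.S X).col j) ᵥ* (M.Q X * K)) ≤ M.T ^ 3 * frobSq K := by
  have h : ∑ j, vecSq (star ((M.S X).col j) ᵥ* (M.Q X * K)) =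
      frobSq ((M.S X)ᴴ * M.Q X * K) := by
    rw [frobSq_eq_sum_row, Matrix.mul_assoc]; rfl
  rw [h]
  refine (frobSq_mul_le_left _ _).trans ?_
  have := frobSq_nonneg K
  gcongr
  exact M.norm_sq_conjTranspose_S_mul_Q_le X

/-- The rows η_j*QK are those of S*QK, whose Frobenius norm is controlled by that of K. Each of the
two corrections is of order ‖K‖_F²/m in the mean, so summing n of them loses nothing. Bounding every
row by `vecSq_col_vecMul_Q₀_mul_le` would instead cost a factor n. -/
lemma sum_integral_vecSq_col_vecMul_le (K : Matrix (Fin N) (Fin N) ℂ) :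
    ∑ j, ∫ X, vecSq (star (M.A.col j) ᵥ* (M.Q₀ j X * K)) ∂M.arrayLaw ≤ M.T ^ 40 * frobSq K := by
  have hT := M.T_pos
  have hm := M.m_pos
  have hK := frobSq_nonneg K
  have hn := M.n_le
  have i1 : ∀ j, Integrable (fun X => vecSq (star ((M.S X).col j) ᵥ* (M.Q X * K)))
      M.arrayLaw := fun j => by
    have hc : Continuous fun X => star ((M.S X).col j) ᵥ* (M.Q X * K) := by
      simp_rw [S_col]; fun_prop
    refine Integrable.of_bound (Continuous.aestronglyMeasurable (by unfold vecSq; fun_prop))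
      (M.T ^ 3 * frobSq K) (Filter.Eventually.of_forall fun X => ?_)
    rw [Real.norm_of_nonneg (vecSq_nonneg _)]
    exact (Finset.single_le_sum (f := fun j => vecSq (star ((M.S X).col j) ᵥ* (M.Q X * K)))
      (fun _ _ => vecSq_nonneg _) (Finset.mem_univ j)).trans (M.sum_vecSq_col_vecMul_Q K X)
  have i2 : ∀ j, Integrable (fun X => ‖M.q j X - M.qAvg j X‖ ^ 2 * (M.T ^ 3 * frobSq K))
      M.arrayLaw := fun j => (M.l2Bound_q_sub_qAvg j).memLp.norm.integrable_sq.mul_const _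
  have i3 : ∀ j, Integrable (fun X => M.T ^ 2 * vecSq (star (M.noise j X) ᵥ* (M.Q₀ j X * K)))
      M.arrayLaw := fun j => (M.integral_vecSq_noise_vecMul_le K j).1.const_mul _
  have hj : ∀ j, ∫ X, vecSq (star (M.A.col j) ᵥ* (M.Q₀ j X * K)) ∂M.arrayLaw ≤
      M.T ^ 15 * (∫ X, vecSq (star ((M.S X).col j) ᵥ* (M.Q X * K)) ∂M.arrayLaw +
        M.T ^ 23 * frobSq K / M.m + M.T ^ 6 * frobSq K / M.m) := fun j => by
    refine (integral_mono (M.integrable_vecSq_col_vecMul K j)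
      ((((i1 j).add (i2 j)).add (i3 j)).const_mul (M.T ^ 15))
      (fun X => M.vecSq_col_vecMul_le_three K j X)).trans ?_
    rw [integral_const_mul, integral_add' ((i1 j).add (i2 j)) (i3 j), integral_add' (i1 j) (i2 j),
      integral_mul_const, integral_const_mul]
    have h2 := (M.l2Bound_q_sub_qAvg j).integral_sq_le (by positivity)
    rw [div_pow, Real.sq_sqrt hm.le] at h2
    have h3 := (M.integral_vecSq_noise_vecMul_le K j).2
    gcongr
    · calc _ ≤ (M.T ^ 10) ^ 2 / M.m * (M.T ^ 3 * frobSq K) := by gcongr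
        _ = _ := by ring
    · calc _ ≤ M.T ^ 2 * (M.T ^ 4 * frobSq K / M.m) := by gcongr
        _ = _ := by ring
  calc _ ≤ ∑ j, M.T ^ 15 * (∫ X, vecSq (star ((M.S X).col j) ᵥ* (M.Q X * K)) ∂M.arrayLaw +
        M.T ^ 23 * frobSq K / M.m + M.T ^ 6 * frobSq K / M.m) := Finset.sum_le_sum fun j _ => hj j
    _ = M.T ^ 15 * (∫ X, ∑ j, vecSq (star ((M.S X).col j) ᵥ* (M.Q X * K)) ∂M.arrayLaw +
        n * (M.T ^ 23 * frobSq K / M.m) + n * (M.T ^ 6 * frobSq K / M.m)) := by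
        rw [integral_finsetSum _ fun j _ => i1 j, ← Finset.mul_sum, Finset.sum_add_distrib,
          Finset.sum_add_distrib]
        simp
    _ ≤ M.T ^ 15 * (M.T ^ 3 * frobSq K + (M.T * M.m) * (M.T ^ 23 * frobSq K / M.m) +
          (M.T * M.m) * (M.T ^ 6 * frobSq K / M.m)) := by
        gcongr
        calc _ ≤ ∫ X, M.T ^ 3 * frobSq K ∂M.arrayLaw :=
              integral_mono (integrable_finsetSum _ fun j _ => i1 j) (integrable_const _)
                fun X => M.sum_vecSq_col_vecMul_Q K X
          _ = _ := by simp
    _ = M.T ^ 15 * (M.T ^ 3 + M.T ^ 24 + M.T ^ 7) * frobSq K := by field_simp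
    _ ≤ M.T ^ 15 * (M.T ^ 24 + M.T ^ 24 + M.T ^ 24) * frobSq K := by
        gcongr <;> first | exact M.one_le_T | norm_num
    _ = 3 * (M.T ^ 39 * frobSq K) := by ring
    _ ≤ M.T * (M.T ^ 39 * frobSq K) := by gcongr; linarith [M.le_T]
    _ = _ := by ring

end ColumnModel

/-! ### Fluctuations of the leave-one-out forms -/

namespace ColumnModel

variable {N n : ℕ} (M : ColumnModel N n)

/-- The part of `s_j` centred over the `j`-th column. -/
noncomputable def eps (j : Fin n) (X : Fin n → Fin N → ℂ) : ℂ :=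
  (star (M.noise j X) ⬝ᵥ (M.Q₀ j X *ᵥ M.noise j X) - (M.σ j : ℂ) ^ 2 * trace (M.D * M.Q₀ j X)) +
    star (M.noise j X) ⬝ᵥ (M.Q₀ j X *ᵥ M.A.col j)

/-- The part of `s_j` which does not depend on the `j`-th column. -/
noncomputable def kap (j : Fin n) (X : Fin n → Fin N → ℂ) : ℂ :=
  (M.σ j : ℂ) ^ 2 * (trace (M.D * M.Q₀ j X) - M.meanTrace)

lemma s_eq (j : Fin n) (X : Fin n → Fin N → ℂ) : M.s j X = M.eps j X + M.kap j X := by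
  rw [s, eps, kap, S_col, Matrix.mulVec_add, dotProduct_add]
  ring

lemma l2Bound_eps (j : Fin n) : L2Bound M.arrayLaw (M.eps j) (M.T ^ 7 / √M.m) := by
  have hT := M.T_pos
  have hm := M.m_pos
  have hsm := M.sqrt_m_pos
  have h1 := (M.l2Bound_quadratic j (M.continuous_Q₀ j) (M.Q₀_update j)
    (F := M.T * M.m * M.T ^ 2) fun X => M.frobSq_le_of_norm_le (M.norm_Q₀_le j X)).mono
    (c' := M.T ^ 6 / √M.m) (by
      calc _ = M.T ^ 4 * √(M.T * (M.m * M.T ^ 2)) / M.m := by rw [mul_assoc M.T]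
        _ ≤ M.T ^ 4 * (M.T * √(M.m * M.T ^ 2)) / M.m := by
            gcongr; exact M.sqrt_le_T_mul _
        _ = M.T ^ 6 * √M.m / (√M.m * √M.m) := by
            rw [Real.sqrt_mul hm.le, Real.sqrt_sq hT.le, Real.mul_self_sqrt hm.le]; ring
        _ = _ := by field_simp)
  have h2 := (M.l2Bound_star_linear_of_le j (b := fun X => M.Q₀ j X *ᵥ M.A.col j) (by fun_prop)
    (fun X x => by rw [Q₀_update]) (V := M.T * M.T ^ 2) (fun X => by
      refine (vecSq_mulVec_le _ _).trans ?_
      rw [mul_comm]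
      have := vecSq_nonneg (M.A.col j)
      have := M.norm_Q₀_le j X
      have := M.vecSq_col_le j
      gcongr)).mono (c' := M.T ^ 6 / √M.m) (by
        refine div_le_div_of_nonneg_right ?_ hsm.le
        calc M.T * √(M.T * M.T ^ 2) ≤ M.T * (M.T * √(M.T ^ 2)) := by
              gcongr; exact M.sqrt_le_T_mul _
          _ = M.T ^ 3 := by rw [Real.sqrt_sq hT.le]; ring
          _ ≤ _ := M.pow_le (by norm_num))
  refine ((h1.add h2 (by positivity) (by positivity)).congr fun X => rfl).mono ?_
  calc _ = 2 * (M.T ^ 6 / √M.m) := by ring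
    _ ≤ M.T * (M.T ^ 6 / √M.m) := by gcongr; linarith [M.le_T]
    _ = _ := by ring

/-- Tr DQ_j - 𝔼Tr DQ is the rank-one correction plus the fluctuation of Tr DQ, both bounded in L²;
σ_j² supplies the 1/m. This part is not centred, so it must be smaller than `eps`. -/
lemma l2Bound_kap (j : Fin n) : L2Bound M.arrayLaw (M.kap j) (M.T ^ 22 / M.m) := by
  have hT := M.T_pos
  have hm := M.m_pos
  have hsm := M.sqrt_m_pos
  have hs1 : 1 ≤ √M.m := Real.one_le_sqrt.2 M.one_le_m
  have hBc : Continuous fun X => M.Q₀ j X * M.D * M.Q₀ j X := by fun_prop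
  have hτ := M.l2Bound_form_sub_avgForm j hBc (fun X x => by simp only [Q₀_update])
    (M.norm_Q₀_mul_D_mul_Q₀_le j) (by positivity)
  have ha : L2Bound M.arrayLaw (fun X => M.avgForm j (M.Q₀ j X * M.D * M.Q₀ j X)) (M.T ^ 8) :=
    L2Bound.of_bounded (Continuous.aestronglyMeasurable (by unfold avgForm; fun_prop)) fun X =>
      (M.norm_avgForm_le j (M.norm_Q₀_mul_D_mul_Q₀_le j X)).trans_eq (by ring)
  have h1 := ((hτ.add ha (by positivity) (by positivity)).bdd_mul (g := M.q j)
    (Continuous.aestronglyMeasurable (by fun_prop)) hT.le (M.norm_q_le j)).mono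
    (c' := M.T ^ 20) (by
      calc _ ≤ M.T * (M.T ^ 7 * M.T ^ 3 / 1 + M.T ^ 8) := by gcongr
        _ = M.T ^ 11 + M.T ^ 9 := by ring
        _ ≤ M.T ^ 11 + M.T ^ 11 := add_le_add le_rfl (M.pow_le (by norm_num))
        _ = 2 * M.T ^ 11 := by ring
        _ ≤ M.T * M.T ^ 11 := by gcongr; linarith [M.le_T]
        _ = M.T ^ 12 := by ring
        _ ≤ _ := M.pow_le (by norm_num))
  have h2 := (h1.add M.l2Bound_trace_D_Q_sub_integral (by positivity) (by positivity)).bdd_mul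
    (g := fun _ => (M.σ j : ℂ) ^ 2) (b := M.T / M.m) (by fun_prop) (by positivity) (fun _ => by
      rw [norm_pow, Complex.norm_real, Real.norm_eq_abs, sq_abs]
      exact M.σ_sq_le j)
  refine (h2.congr fun X => ?_).mono ?_
  · rw [kap, M.trace_D_mul_Q j X M.D, meanTrace]
    ring
  · calc _ = 2 * (M.T ^ 21 / M.m) := by ring
      _ ≤ M.T * (M.T ^ 21 / M.m) := by gcongr; linarith [M.le_T]
      _ = _ := by ring

lemma l2Bound_s (j : Fin n) : L2Bound M.arrayLaw (M.s j) (M.T ^ 23 / √M.m) := by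
  have hT := M.T_pos
  have hm := M.m_pos
  have hsm := M.sqrt_m_pos
  have hs1 : √M.m ≤ M.m := by
    rw [Real.sqrt_le_left hm.le]; nlinarith [M.one_le_m]
  refine (((M.l2Bound_eps j).add (M.l2Bound_kap j) (by positivity) (by positivity)).congr
    (M.s_eq j)).mono ?_
  have h7 := M.pow_le (show 7 ≤ 22 by norm_num)
  calc _ ≤ M.T ^ 22 / √M.m + M.T ^ 22 / √M.m := by gcongr
    _ = 2 * (M.T ^ 22 / √M.m) := by ring
    _ ≤ M.T * (M.T ^ 22 / √M.m) := by gcongr; linarith [M.le_T]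
    _ = _ := by ring

/-! ### The main error terms -/

lemma vecSq_Q₀_mul_mulVec_le (K : Matrix (Fin N) (Fin N) ℂ) (j : Fin n) (X : Fin n → Fin N → ℂ)
    (v : Fin N → ℂ) : vecSq ((M.Q₀ j X * K) *ᵥ v) ≤ M.T ^ 2 * vecSq (K *ᵥ v) := by
  rw [← Matrix.mulVec_mulVec]
  refine (vecSq_mulVec_le _ _).trans ?_
  have := vecSq_nonneg (K *ᵥ v)
  have := M.norm_Q₀_le j X
  gcongr

lemma norm_col_dotProduct_le (K : Matrix (Fin N) (Fin N) ℂ) (j : Fin n) (X : Fin n → Fin N → ℂ) :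
    ‖star (M.A.col j) ⬝ᵥ ((M.Q₀ j X * K) *ᵥ M.A.col j)‖ ≤ M.T ^ 2 * √(vecSq (K *ᵥ M.A.col j)) := by
  have hT := M.T_pos
  refine (norm_dotProduct_le _ _).trans ?_
  rw [vecSq_star]
  have h1 : √(vecSq (M.A.col j)) ≤ M.T := by
    refine (Real.sqrt_le_sqrt (M.vecSq_col_le j)).trans ?_
    rw [Real.sqrt_le_left hT.le]; nlinarith [M.one_le_T]
  have h2 : √(vecSq ((M.Q₀ j X * K) *ᵥ M.A.col j)) ≤ M.T * √(vecSq (K *ᵥ M.A.col j)) := by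
    refine (Real.sqrt_le_sqrt (M.vecSq_Q₀_mul_mulVec_le K j X _)).trans_eq ?_
    rw [Real.sqrt_mul (by positivity), Real.sqrt_sq hT.le]
  calc _ ≤ M.T * (M.T * √(vecSq (K *ᵥ M.A.col j))) := by gcongr
    _ = _ := by ring

lemma norm_integral_q_s_le (K : Matrix (Fin N) (Fin N) ℂ) (j : Fin n) :
    Integrable (fun X => M.q j X * M.s j X *
      (star ((M.S X).col j) ⬝ᵥ ((M.Q₀ j X * K) *ᵥ M.A.col j))) M.arrayLaw ∧
    ‖∫ X, M.q j X * M.s j X *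
      (star ((M.S X).col j) ⬝ᵥ ((M.Q₀ j X * K) *ᵥ M.A.col j)) ∂M.arrayLaw‖ ≤
      M.T ^ 37 * √(vecSq (K *ᵥ M.A.col j)) / M.m := by
  have hT := M.T_pos
  have hm := M.m_pos
  have hsm := M.sqrt_m_pos
  set w := √(vecSq (K *ᵥ M.A.col j)) with hw
  have hw0 : 0 ≤ w := Real.sqrt_nonneg _
  have hmm : √M.m * √M.m = M.m := Real.mul_self_sqrt hm.le
  set β : (Fin n → Fin N → ℂ) → ℂ :=
    fun X => star (M.A.col j) ⬝ᵥ ((M.Q₀ j X * K) *ᵥ M.A.col j) with hβ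
  have hβc : Continuous β := by simp only [hβ]; fun_prop
  have hβb : ∀ X, ‖β X‖ ≤ M.T ^ 2 * w := M.norm_col_dotProduct_le K j
  have hβu : ∀ X x, β (Function.update X j x) = β X := fun X x => by simp only [hβ, Q₀_update]
  have hqs := (M.l2Bound_s j).bdd_mul (g := M.q j)
    (Continuous.aestronglyMeasurable (by fun_prop)) hT.le (M.norm_q_le j)
  have hlin := (M.l2Bound_star_linear_of_le j (b := fun X => (M.Q₀ j X * K) *ᵥ M.A.col j)
    (by fun_prop) (fun X x => by rw [Q₀_update])
    (fun X => M.vecSq_Q₀_mul_mulVec_le K j X _)).mono (c' := M.T ^ 2 * w / √M.m) (by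
      rw [Real.sqrt_mul (by positivity), Real.sqrt_sq hT.le, ← hw]
      apply le_of_eq; ring)
  have hβs := (M.l2Bound_s j).bdd_mul (g := β) hβc.aestronglyMeasurable (by positivity) hβb
  have hβκ := (M.l2Bound_kap j).bdd_mul (g := β) hβc.aestronglyMeasurable (by positivity) hβb
  have hq : L2Bound M.arrayLaw (M.qAvg j) M.T :=
    L2Bound.of_bounded (Continuous.aestronglyMeasurable (by fun_prop)) (M.norm_qAvg_le j)
  have hfq : ∀ X x, M.qAvg j (Function.update X j x) * β (Function.update X j x) =
      M.qAvg j X * β X := fun X x => by rw [hβu, qAvg_update]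
  have hβε := (M.l2Bound_eps j).bdd_mul (g := fun X => M.qAvg j X * β X)
    (Continuous.aestronglyMeasurable (by fun_prop)) (b := M.T * (M.T ^ 2 * w)) (by positivity)
    (fun X => by
      rw [norm_mul]
      exact mul_le_mul (M.norm_qAvg_le j X) (hβb X) (norm_nonneg _) hT.le)
  have hquad : L2Bound M.arrayLaw (fun X => star (M.noise j X) ⬝ᵥ (M.Q₀ j X *ᵥ M.noise j X) -
      (M.σ j : ℂ) ^ 2 * trace (M.D * M.Q₀ j X)) _ :=
    M.l2Bound_quadratic j (M.continuous_Q₀ j) (M.Q₀_update j)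
      (F := M.T * M.m * M.T ^ 2) fun X => M.frobSq_le_of_norm_le (M.norm_Q₀_le j X)
  have hεzero : ∫ X, M.qAvg j X * β X * M.eps j X ∂M.arrayLaw = 0 := by
    have h1 := M.integral_mul_quadratic_eq_zero j (f := fun X => M.qAvg j X * β X) hfq
      (M.Q₀_update j)
    have h2 := M.integral_mul_star_linear_eq_zero j (f := fun X => M.qAvg j X * β X)
      (b := fun X => M.Q₀ j X *ᵥ M.A.col j) hfq (fun X x => by rw [Q₀_update])
    have hb : ∀ X, ‖M.qAvg j X * β X‖ ≤ M.T * (M.T ^ 2 * w) := fun X => by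
      rw [norm_mul]
      exact mul_le_mul (M.norm_qAvg_le j X) (hβb X) (norm_nonneg _) hT.le
    have i1 := (hquad.bdd_mul (g := fun X => M.qAvg j X * β X)
      (Continuous.aestronglyMeasurable (by fun_prop)) (by positivity) hb).integrable
    have i2 : Integrable (fun X => M.qAvg j X * β X *
        (star (M.noise j X) ⬝ᵥ (M.Q₀ j X *ᵥ M.A.col j))) M.arrayLaw := by
      refine (hβε.integrable.sub i1).congr (Filter.Eventually.of_forall fun X => ?_)
      simp only [Pi.sub_apply, eps]
      ring
    simp only [eps, mul_add]
    rw [integral_add i1 i2, h1, h2, add_zero]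
  -- Three of the four terms have mean of order 1/m, as products of two m^(-1/2) factors or through
  -- `kap`. The remaining one, with the averaged weight, β and `eps`, is only of order m^(-1/2) but
  -- has mean zero.
  have hsplit : ∀ X, M.q j X * M.s j X *
      (star ((M.S X).col j) ⬝ᵥ ((M.Q₀ j X * K) *ᵥ M.A.col j)) =
      (M.q j X * M.s j X) * (star (M.noise j X) ⬝ᵥ ((M.Q₀ j X * K) *ᵥ M.A.col j)) +
        ((M.q j X - M.qAvg j X) * (β X * M.s j X) +
        (M.qAvg j X * β X * M.eps j X + M.qAvg j X * (β X * M.kap j X))) := fun X => by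
    rw [S_col, star_add, add_dotProduct]
    have := M.s_eq j X
    simp only [hβ]
    linear_combination (M.qAvg j X * (star (M.A.col j) ⬝ᵥ ((M.Q₀ j X * K) *ᵥ M.A.col j))) * this
  simp_rw [hsplit]
  have i1 := hqs.integrable_mul hlin
  have i2 := (M.l2Bound_q_sub_qAvg j).integrable_mul hβs
  have i3 := hβε.integrable
  have i4 := hq.integrable_mul hβκ
  refine ⟨i1.fun_add (i2.fun_add (i3.fun_add i4)), ?_⟩
  rw [integral_add i1 (i2.fun_add (i3.fun_add i4)), integral_add i2 (i3.fun_add i4),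
    integral_add i3 i4, hεzero, zero_add]
  have b1 := hqs.norm_integral_mul_le hlin (by positivity) (by positivity)
  have b2 := (M.l2Bound_q_sub_qAvg j).norm_integral_mul_le hβs (by positivity) (by positivity)
  have b4 := hq.norm_integral_mul_le hβκ hT.le (by positivity)
  refine (norm_add_le _ _).trans ((add_le_add b1 ((norm_add_le _ _).trans
    (add_le_add b2 b4))).trans ?_)
  have e1 : M.T * (M.T ^ 23 / √M.m) * (M.T ^ 2 * w / √M.m) = M.T ^ 26 * (w / M.m) := by
    conv_rhs => rw [← hmm]
    field_simp
  have e2 : M.T ^ 10 / √M.m * (M.T ^ 2 * w * (M.T ^ 23 / √M.m)) = M.T ^ 35 * (w / M.m) := by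
    conv_rhs => rw [← hmm]
    field_simp
  have e4 : M.T * (M.T ^ 2 * w * (M.T ^ 22 / M.m)) = M.T ^ 25 * (w / M.m) := by ring
  rw [e1, e2, e4]
  have p1 := M.pow_le (show 26 ≤ 35 by norm_num)
  have p2 := M.pow_le (show 25 ≤ 35 by norm_num)
  calc _ ≤ M.T ^ 35 * (w / M.m) + (M.T ^ 35 * (w / M.m) + M.T ^ 35 * (w / M.m)) := by gcongr
    _ = 3 * (M.T ^ 35 * (w / M.m)) := by ring
    _ ≤ M.T ^ 2 * (M.T ^ 35 * (w / M.m)) := by gcongr; nlinarith [M.le_T]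
    _ = _ := by ring

lemma norm_integral_q_xi_le (K : Matrix (Fin N) (Fin N) ℂ) (j : Fin n) :
    Integrable (fun X => M.q j X * M.xi K j X) M.arrayLaw ∧
    ‖∫ X, M.q j X * M.xi K j X ∂M.arrayLaw‖ ≤
      M.T ^ 15 * √(frobSq K) / (M.m * √M.m) +
        M.T ^ 11 * √(∫ X, vecSq (star (M.A.col j) ᵥ* (M.Q₀ j X * K)) ∂M.arrayLaw) / M.m := by
  have hT := M.T_pos
  have hm := M.m_pos
  have hsm := M.sqrt_m_pos
  have hmm : √M.m * √M.m = M.m := Real.mul_self_sqrt hm.le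
  have hK := frobSq_nonneg K
  have hu : ∀ X x, M.Q₀ j (Function.update X j x) * K = M.Q₀ j X * K := fun X x => by
    rw [Q₀_update]
  have hquad := (M.l2Bound_quadratic j (B := fun X => M.Q₀ j X * K) (by fun_prop) hu
    (F := M.T ^ 2 * frobSq K) (fun X => by
      refine (frobSq_mul_le_left _ _).trans ?_
      gcongr
      exact M.norm_Q₀_le j X)).mono (c' := M.T ^ 5 * √(frobSq K) / M.m) (by
        rw [Real.sqrt_mul (by positivity), Real.sqrt_sq hT.le]
        apply le_of_eq; ring)
  have hlin := M.l2Bound_linear j (b := fun X => star (M.A.col j) ᵥ* (M.Q₀ j X * K))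
    (by fun_prop) (fun X x => by rw [Q₀_update]) (M.integrable_vecSq_col_vecMul K j) le_rfl
  have hxi : ∀ X, M.xi K j X = (star (M.noise j X) ⬝ᵥ ((M.Q₀ j X * K) *ᵥ M.noise j X) -
      (M.σ j : ℂ) ^ 2 * trace (M.D * (M.Q₀ j X * K))) +
      (star (M.A.col j) ᵥ* (M.Q₀ j X * K)) ⬝ᵥ M.noise j X := fun X => by
    rw [xi, S_col, star_add, add_dotProduct, ← Matrix.dotProduct_mulVec]
    ring
  have hqm : AEStronglyMeasurable (M.qAvg j) M.arrayLaw :=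
    Continuous.aestronglyMeasurable (by fun_prop)
  have i1 := (hquad.bdd_mul hqm hT.le (M.norm_qAvg_le j)).integrable
  have i2 := (hlin.bdd_mul hqm hT.le (M.norm_qAvg_le j)).integrable
  have i3 := (M.l2Bound_q_sub_qAvg j).integrable_mul hquad
  have i4 := (M.l2Bound_q_sub_qAvg j).integrable_mul hlin
  have z1 := M.integral_mul_quadratic_eq_zero j (M.qAvg_update j)
    (B := fun X => M.Q₀ j X * K) hu
  have z2 := M.integral_mul_linear_eq_zero j (M.qAvg_update j)
    (b := fun X => star (M.A.col j) ᵥ* (M.Q₀ j X * K)) (fun X x => by rw [Q₀_update])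
  -- The averaged weight ignores column j, so its product with the centred ξ has mean zero; only the
  -- difference of weights, of order m^(-1/2), contributes.
  have hsplit : ∀ X, M.q j X * M.xi K j X =
      (M.q j X - M.qAvg j X) * (star (M.noise j X) ⬝ᵥ ((M.Q₀ j X * K) *ᵥ M.noise j X) -
        (M.σ j : ℂ) ^ 2 * trace (M.D * (M.Q₀ j X * K))) +
      ((M.q j X - M.qAvg j X) * ((star (M.A.col j) ᵥ* (M.Q₀ j X * K)) ⬝ᵥ M.noise j X) +
      (M.qAvg j X * (star (M.noise j X) ⬝ᵥ ((M.Q₀ j X * K) *ᵥ M.noise j X) -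
        (M.σ j : ℂ) ^ 2 * trace (M.D * (M.Q₀ j X * K))) +
      M.qAvg j X * ((star (M.A.col j) ᵥ* (M.Q₀ j X * K)) ⬝ᵥ M.noise j X))) := fun X => by
    rw [hxi]; ring
  simp_rw [hsplit]
  refine ⟨i3.fun_add (i4.fun_add (i1.fun_add i2)), ?_⟩
  rw [integral_add i3 (i4.fun_add (i1.fun_add i2)), integral_add i4 (i1.fun_add i2),
    integral_add i1 i2, z1, z2, add_zero, add_zero]
  have b1 := (M.l2Bound_q_sub_qAvg j).norm_integral_mul_le hquad (by positivity) (by positivity)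
  have b2 := (M.l2Bound_q_sub_qAvg j).norm_integral_mul_le hlin (by positivity) (by positivity)
  refine (norm_add_le _ _).trans ((add_le_add b1 b2).trans (le_of_eq ?_))
  congr 1
  · field_simp
  · conv_rhs => rw [← hmm]
    field_simp

/-- The deterministic equivalent inverts the mean resolvent up to an error of order `m ^ (-1/2)` in
Frobenius norm. -/
theorem norm_integral_errTrace_le (hA : ‖M.A‖ ≤ M.T)
    (hlam : L2Bound M.arrayLaw (fun X => M.lam X - M.meanLam) (M.T ^ 22 / M.m))
    (K : Matrix (Fin N) (Fin N) ℂ) :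
    ‖∫ X, M.errTrace K X ∂M.arrayLaw‖ ≤ M.T ^ 42 * √(frobSq K) / √M.m := by
  have hT := M.T_pos
  have hm := M.m_pos
  have hsm := M.sqrt_m_pos
  have hmm : √M.m * √M.m = M.m := Real.mul_self_sqrt hm.le
  have hdiv : ∀ x : ℝ, x / M.m = x / (√M.m * √M.m) := fun x => by rw [hmm]
  have hK := frobSq_nonneg K
  set k := √(frobSq K) with hk
  have hk0 : 0 ≤ k := Real.sqrt_nonneg _
  have hn := M.n_le
  simp_rw [errTrace_eq]
  have htr : L2Bound M.arrayLaw (fun X => trace (K * M.D * M.Q X)) (M.T ^ 3 * √M.m * k) :=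
    L2Bound.of_bounded (Continuous.aestronglyMeasurable (by fun_prop)) (M.norm_trace_K_D_Q_le K)
  have i1 := (hlam.integrable_mul htr).fun_neg
  have b1 := hlam.norm_integral_mul_le htr (by positivity) (by positivity)
  have i2 : Integrable (M.rankOneErr K) M.arrayLaw :=
    Integrable.of_bound (Continuous.aestronglyMeasurable (by unfold rankOneErr; fun_prop)) _
      (Filter.Eventually.of_forall (M.norm_rankOneErr_le K))
  have b2 : ‖∫ X, M.rankOneErr K X ∂M.arrayLaw‖ ≤ M.T ^ 6 * k / √M.m := by
    simpa using norm_integral_le_of_norm_le_const (μ := M.arrayLaw)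
      (Filter.Eventually.of_forall (M.norm_rankOneErr_le K))
  have i3 := fun j => ((M.norm_integral_q_s_le K j).1.const_mul (M.g j))
  have hlin : ∀ j, L2Bound M.arrayLaw
      (fun X => star (M.noise j X) ⬝ᵥ ((M.Q₀ j X * K) *ᵥ M.A.col j)) _ := fun j =>
    M.l2Bound_star_linear_of_le j (b := fun X => (M.Q₀ j X * K) *ᵥ M.A.col j)
      (by fun_prop) (fun X x => by rw [Q₀_update])
      (fun X => M.vecSq_Q₀_mul_mulVec_le K j X _)
  have i4 := fun j => (hlin j).integrable.const_mul (M.g j)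
  have z4 : ∀ j, ∫ X, M.g j * (star (M.noise j X) ⬝ᵥ ((M.Q₀ j X * K) *ᵥ M.A.col j))
      ∂M.arrayLaw = 0 := fun j =>
    M.integral_mul_star_linear_eq_zero j (f := fun _ => M.g j)
      (b := fun X => (M.Q₀ j X * K) *ᵥ M.A.col j) (fun _ _ => rfl) (fun X x => by rw [Q₀_update])
  have i5 := fun j => (M.norm_integral_q_xi_le K j).1
  have hj : ∀ j, Integrable (fun X => M.g j * (M.q j X * M.s j X *
          (star ((M.S X).col j) ⬝ᵥ ((M.Q₀ j X * K) *ᵥ M.A.col j))) -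
        M.g j * (star (M.noise j X) ⬝ᵥ ((M.Q₀ j X * K) *ᵥ M.A.col j)) -
        M.q j X * M.xi K j X) M.arrayLaw ∧
      ‖∫ X, (M.g j * (M.q j X * M.s j X *
          (star ((M.S X).col j) ⬝ᵥ ((M.Q₀ j X * K) *ᵥ M.A.col j))) -
        M.g j * (star (M.noise j X) ⬝ᵥ ((M.Q₀ j X * K) *ᵥ M.A.col j)) -
        M.q j X * M.xi K j X) ∂M.arrayLaw‖ ≤
      M.T * (M.T ^ 37 * √(vecSq (K *ᵥ M.A.col j)) / M.m) + (M.T ^ 15 * k / (M.m * √M.m) +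
        M.T ^ 11 * √(∫ X, vecSq (star (M.A.col j) ᵥ* (M.Q₀ j X * K)) ∂M.arrayLaw) / M.m) := by
    intro j
    have i34 : Integrable (fun X => M.g j * (M.q j X * M.s j X *
          (star ((M.S X).col j) ⬝ᵥ ((M.Q₀ j X * K) *ᵥ M.A.col j))) -
        M.g j * (star (M.noise j X) ⬝ᵥ ((M.Q₀ j X * K) *ᵥ M.A.col j))) M.arrayLaw :=
      (i3 j).sub (i4 j)
    refine ⟨i34.sub (i5 j), ?_⟩
    rw [integral_sub i34 (i5 j), integral_sub (i3 j) (i4 j), z4, sub_zero, integral_const_mul]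
    refine (norm_sub_le _ _).trans (add_le_add ?_ (M.norm_integral_q_xi_le K j).2)
    rw [norm_mul]
    exact mul_le_mul (M.norm_g_le j) (M.norm_integral_q_s_le K j).2 (norm_nonneg _) hT.le
  have iS := integrable_finsetSum Finset.univ fun j _ => (hj j).1
  have i12 : Integrable (fun X => -((M.lam X - M.meanLam) * trace (K * M.D * M.Q X)) -
      M.rankOneErr K X) M.arrayLaw := i1.sub i2
  rw [integral_add i12 iS, integral_sub i1 i2, integral_neg,
    integral_finsetSum _ fun j _ => (hj j).1]
  -- Cauchy–Schwarz over the columns costs √n, of order √m, for a summable family of squares. The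
  -- per-column factor 1/m therefore becomes m^(-1/2) after summation, here and in the next sum.
  have hS1 : ∑ j, √(vecSq (K *ᵥ M.A.col j)) ≤ M.T ^ 2 * √M.m * k := by
    refine (sum_sqrt_le fun j => vecSq_nonneg _).trans ?_
    have h1 : ∑ j, vecSq (K *ᵥ M.A.col j) = frobSq (K * M.A) := by
      rw [frobSq_eq_sum_col]; rfl
    have h2 : √(frobSq (K * M.A)) ≤ k * M.T := by
      refine (Real.sqrt_le_sqrt (frobSq_mul_le_right _ _)).trans ?_
      rw [Real.sqrt_mul hK, Real.sqrt_sq (norm_nonneg _)]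
      gcongr
    rw [h1]
    calc _ ≤ (M.T * √M.m) * (k * M.T) := by gcongr; exact M.sqrt_n_le
      _ = _ := by ring
  have hS2 : ∑ j, √(∫ X, vecSq (star (M.A.col j) ᵥ* (M.Q₀ j X * K)) ∂M.arrayLaw) ≤
      M.T ^ 21 * √M.m * k := by
    refine (sum_sqrt_le fun j => integral_nonneg fun X => vecSq_nonneg _).trans ?_
    have h2 := Real.sqrt_le_sqrt (M.sum_integral_vecSq_col_vecMul_le K)
    rw [Real.sqrt_mul (by positivity), show M.T ^ 40 = (M.T ^ 20) ^ 2 by ring,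
      Real.sqrt_sq (by positivity)] at h2
    calc _ ≤ (M.T * √M.m) * (M.T ^ 20 * k) := by gcongr; exact M.sqrt_n_le
      _ = _ := by ring
  have hsum : ‖∑ j, ∫ X, (M.g j * (M.q j X * M.s j X *
          (star ((M.S X).col j) ⬝ᵥ ((M.Q₀ j X * K) *ᵥ M.A.col j))) -
        M.g j * (star (M.noise j X) ⬝ᵥ ((M.Q₀ j X * K) *ᵥ M.A.col j)) -
        M.q j X * M.xi K j X) ∂M.arrayLaw‖ ≤
      M.T ^ 40 * (k / √M.m) + (M.T ^ 16 * (k / √M.m) + M.T ^ 32 * (k / √M.m)) := by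
    refine (norm_sum_le _ _).trans ((Finset.sum_le_sum fun j _ => (hj j).2).trans ?_)
    rw [Finset.sum_add_distrib, Finset.sum_add_distrib]
    refine add_le_add ?_ (add_le_add ?_ ?_)
    · calc _ = M.T ^ 38 / M.m * ∑ j, √(vecSq (K *ᵥ M.A.col j)) := by
            rw [Finset.mul_sum]; exact Finset.sum_congr rfl fun j _ => by ring
        _ ≤ M.T ^ 38 / M.m * (M.T ^ 2 * √M.m * k) := by gcongr
        _ = _ := by rw [hdiv]; field_simp
    · rw [Finset.sum_const, Finset.card_univ, Fintype.card_fin, nsmul_eq_mul]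
      calc _ ≤ (M.T * M.m) * (M.T ^ 15 * k / (M.m * √M.m)) := by gcongr
        _ = _ := by field_simp
    · calc _ = M.T ^ 11 / M.m *
            ∑ j, √(∫ X, vecSq (star (M.A.col j) ᵥ* (M.Q₀ j X * K)) ∂M.arrayLaw) := by
            rw [Finset.mul_sum]; exact Finset.sum_congr rfl fun j _ => by ring
        _ ≤ M.T ^ 11 / M.m * (M.T ^ 21 * √M.m * k) := by gcongr
        _ = _ := by rw [hdiv]; field_simp
  have e1 : M.T ^ 22 / M.m * (M.T ^ 3 * √M.m * k) = M.T ^ 25 * (k / √M.m) := by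
    rw [hdiv]; field_simp
  rw [e1] at b1
  have e2 : M.T ^ 6 * k / √M.m = M.T ^ 6 * (k / √M.m) := by ring
  rw [e2] at b2
  refine (norm_add_le _ _).trans ((add_le_add ((norm_sub_le _ _).trans
    (add_le_add ((norm_neg _).trans_le b1) b2)) hsum).trans ?_)
  have p1 := M.pow_le (show 25 ≤ 40 by norm_num)
  have p2 := M.pow_le (show 6 ≤ 40 by norm_num)
  have p3 := M.pow_le (show 16 ≤ 40 by norm_num)
  have p4 := M.pow_le (show 32 ≤ 40 by norm_num)
  set c := k / √M.m with hc
  have hc0 : 0 ≤ c := by positivity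
  calc _ ≤ M.T ^ 40 * c + M.T ^ 40 * c + (M.T ^ 40 * c + (M.T ^ 40 * c + M.T ^ 40 * c)) := by
        gcongr
    _ = 5 * (M.T ^ 40 * c) := by ring
    _ ≤ M.T ^ 2 * (M.T ^ 40 * c) := by gcongr; nlinarith [M.le_T]
    _ = _ := by rw [hc]; ring

end ColumnModel

/-! ### Arrays of i.i.d. variables -/

section Arrays

variable {Ω : Type*} [MeasurableSpace Ω] {μ : Measure Ω}

lemma measurePreserving_array [IsProbabilityMeasure μ] {a b : ℕ} {Y : Ω → Fin a → Fin b → ℂ}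
    (hm : ∀ i j, Measurable fun ω => Y ω i j)
    (hi : iIndepFun (fun (p : Fin a × Fin b) ω => Y ω p.1 p.2) μ) {ν : Measure ℂ}
    [IsProbabilityMeasure ν] (hν : ∀ i j, μ.map (fun ω => Y ω i j) = ν) :
    MeasurePreserving Y μ (Measure.pi fun _ => Measure.pi fun _ => ν) := by
  refine ⟨by fun_prop, ?_⟩
  have h1 : μ.map (fun ω (p : Fin a × Fin b) => Y ω p.1 p.2) =
      Measure.infinitePi fun _ : Fin a × Fin b => ν := by
    rw [(iIndepFun_iff_map_fun_eq_infinitePi_map (by fun_prop)).1 hi]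
    simp_rw [hν]
  have h2 := Measure.infinitePi_map_curry (fun (_ : Fin a) (_ : Fin b) => ν)
  rw [← h1, Measure.map_map (by fun_prop) (by fun_prop)] at h2
  simp_rw [Measure.infinitePi_eq_pi] at h2
  exact h2

lemma measurePreserving_swap_array (a b : ℕ) (ν : Measure ℂ) [IsProbabilityMeasure ν] :
    MeasurePreserving (fun (X : Fin a → Fin b → ℂ) i j => X j i)
      (Measure.pi fun _ => Measure.pi fun _ => ν) (Measure.pi fun _ => Measure.pi fun _ => ν) := by
  refine measurePreserving_array (by fun_prop) ?_ fun i j => ?_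
  · have h := iIndepFun_uncurry_infinitePi' (Ω := fun (_ : Fin a) (_ : Fin b) => ℂ)
      (X := fun _ _ x => x) (fun _ _ => ν) (fun _ _ => measurable_id)
    simp_rw [Measure.infinitePi_eq_pi] at h
    exact h.precomp (g := Prod.swap) Prod.swap_injective
  · exact ((measurePreserving_eval (fun _ : Fin b => ν) i).comp
      (measurePreserving_eval (fun _ : Fin a => Measure.pi fun _ : Fin b => ν) j)).map_eq

lemma L2Bound.comp_measurePreserving {Ω' : Type*} [MeasurableSpace Ω'] {μ' : Measure Ω'}
    {φ : Ω → Ω'} {f : Ω' → ℂ} {c : ℝ} (h : L2Bound μ' f c) (hφ : MeasurePreserving φ μ μ') :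
    L2Bound μ (fun ω => f (φ ω)) c := by
  refine ⟨h.1.comp_measurePreserving hφ, ?_⟩
  have := eLpNorm_comp_measurePreserving (p := 2) h.1 hφ
  rw [Function.comp_def] at this
  rw [this]
  exact h.2

lemma integral_comp_measurePreserving {Ω' : Type*} [MeasurableSpace Ω'] {μ' : Measure Ω'}
    {φ : Ω → Ω'} (hφ : MeasurePreserving φ μ μ') {f : Ω' → ℂ} (hf : AEStronglyMeasurable f μ') :
    ∫ ω, f (φ ω) ∂μ = ∫ x, f x ∂μ' := by
  rw [← hφ.map_eq] at hf ⊢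
  exact (integral_map hφ.aemeasurable hf).symm

end Arrays

/-! ### Models with bounded parameters and their transposes -/

/-- Bounds on the parameters of `m ^ (-1/2) D ^ (1/2) X D̃ ^ (1/2) + A`, symmetric in rows and
columns. -/
structure BoundedModel {N n : ℕ} (κ m : ℝ) (ν : Measure ℂ) (d : Fin N → ℝ) (d' : Fin n → ℝ)
    (A : Matrix (Fin N) (Fin n) ℂ) : Prop where
  prob : IsProbabilityMeasure ν
  law : EntryLaw ν κ
  le_κ : 16 ≤ κ
  one_le_m : 1 ≤ m
  N_le : (N : ℝ) ≤ κ * m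
  n_le : (n : ℝ) ≤ κ * m
  d_nonneg : ∀ i, 0 ≤ d i
  d'_nonneg : ∀ j, 0 ≤ d' j
  d_le : ∀ i, d i ≤ κ
  d'_le : ∀ j, d' j ≤ κ
  vecSq_row_le : ∀ i, vecSq (Aᵀ.col i) ≤ κ
  vecSq_col_le : ∀ j, vecSq (A.col j) ≤ κ

namespace BoundedModel

variable {N n : ℕ} {κ m : ℝ} {ν : Measure ℂ} {d : Fin N → ℝ} {d' : Fin n → ℝ}
  {A : Matrix (Fin N) (Fin n) ℂ}

lemma transpose (h : BoundedModel κ m ν d d' A) : BoundedModel κ m ν d' d Aᵀ where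
  prob := h.prob
  law := h.law
  le_κ := h.le_κ
  one_le_m := h.one_le_m
  N_le := h.n_le
  n_le := h.N_le
  d_nonneg := h.d'_nonneg
  d'_nonneg := h.d_nonneg
  d_le := h.d'_le
  d'_le := h.d_le
  vecSq_row_le := h.vecSq_col_le
  vecSq_col_le := h.vecSq_row_le

/-- The common bound of all the parameters at the spectral parameter `z`. -/
noncomputable def bound (κ : ℝ) (z : ℂ) : ℝ := κ * (1 + ‖z‖) * (1 + 1 / deltaZ z)

variable {z : ℂ}

lemma m_pos (h : BoundedModel κ m ν d d' A) : 0 < m := by linarith [h.one_le_m]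

lemma κ_pos (h : BoundedModel κ m ν d d' A) : 0 < κ := by linarith [h.le_κ]

lemma le_bound (h : BoundedModel κ m ν d d' A) (hz : z ∉ nonnegAxis) : κ ≤ bound κ z := by
  have h1 := deltaZ_pos hz
  have h2 := h.κ_pos
  have h3 : 1 ≤ (1 + ‖z‖) * (1 + 1 / deltaZ z) :=
    one_le_mul_of_one_le_of_one_le (by simp) (by simp [h1.le])
  unfold bound
  rw [mul_assoc]
  exact le_mul_of_one_le_right h2.le h3

/-- The column model with the given parameters. -/
noncomputable def model (h : BoundedModel κ m ν d d' A) (hz : z ∉ nonnegAxis) :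
    ColumnModel N n where
  p i := √(d i)
  σ j := √(d' j / m)
  A := A
  z := z
  ν := ν
  T := bound κ z
  m := m
  prob := h.prob
  law := ⟨h.law.mean, h.law.variance, h.law.integrable_fourth,
    h.law.fourth_le.trans (h.le_bound hz)⟩
  le_T := h.le_κ.trans (h.le_bound hz)
  one_le_m := h.one_le_m
  notMem_axis := hz
  norm_z_le := by
    have h1 := deltaZ_pos hz
    have := h.le_κ
    have h0 := norm_nonneg z
    calc ‖z‖ ≤ 1 * (1 + ‖z‖) * (1 + 0) := by linarith
      _ ≤ _ := by unfold bound; gcongr; exacts [by linarith, by positivity]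
  inv_delta_le := by
    have h1 := deltaZ_pos hz
    have := h.le_κ
    have h0 := norm_nonneg z
    have h2 : 0 ≤ 1 / deltaZ z := by positivity
    calc 1 / deltaZ z ≤ 1 * (1 + 0) * (1 + 1 / deltaZ z) := by linarith
      _ ≤ _ := by unfold bound; gcongr; linarith
  norm_div_delta_le := by
    have h1 := deltaZ_pos hz
    have := h.le_κ
    have h0 := norm_nonneg z
    have h2 : 0 ≤ 1 / deltaZ z := by positivity
    calc ‖z‖ / deltaZ z = 1 * ‖z‖ * (1 / deltaZ z) := by ring
      _ ≤ _ := by unfold bound; gcongr <;> linarith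
  N_le := h.N_le.trans (by
    have := h.one_le_m
    gcongr
    exact h.le_bound hz)
  n_le := h.n_le.trans (by
    have := h.one_le_m
    gcongr
    exact h.le_bound hz)
  p_sq_le i := by
    rw [Real.sq_sqrt (h.d_nonneg i)]
    exact (h.d_le i).trans (h.le_bound hz)
  σ_sq_le j := by
    have := h.one_le_m
    rw [Real.sq_sqrt (div_nonneg (h.d'_nonneg j) (by linarith))]
    gcongr
    exact (h.d'_le j).trans (h.le_bound hz)
  vecSq_col_le j := (h.vecSq_col_le j).trans (h.le_bound hz)

variable (h : BoundedModel κ m ν d d' A) (hz : z ∉ nonnegAxis)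

lemma model_D : (h.model hz).D = realDiag d := by
  simp only [ColumnModel.D, model]
  congr 1
  funext i
  exact Real.sq_sqrt (h.d_nonneg i)

lemma model_σ_sq (j : Fin n) : (((h.model hz).σ j : ℂ)) ^ 2 = (d' j : ℂ) / (m : ℂ) := by
  simp only [model]
  rw [← Complex.ofReal_pow, Real.sq_sqrt (div_nonneg (h.d'_nonneg j) h.m_pos.le)]
  push_cast; rfl

lemma model_S_apply (X : Fin n → Fin N → ℂ) (i : Fin N) (j : Fin n) :
    (h.model hz).S X i j = (√(d i) : ℂ) * (√(d' j / m) : ℂ) * X j i + A i j := by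
  simp only [ColumnModel.S, ColumnModel.noise, model, Matrix.of_apply, Pi.smul_apply, realDiag,
    Matrix.mulVec_diagonal, smul_eq_mul]
  ring

lemma transpose_S (X : Fin n → Fin N → ℂ) :
    (h.transpose.model hz).S (fun i j => X j i) = ((h.model hz).S X)ᵀ := by
  ext j i
  rw [Matrix.transpose_apply, model_S_apply, model_S_apply, Real.sqrt_div (h.d_nonneg i),
    Real.sqrt_div (h.d'_nonneg j), Matrix.transpose_apply]
  push_cast
  ring

lemma q_eq (X : Fin n → Fin N → ℂ) (j : Fin n) :
    (h.model hz).q j X = -z * coresolventMatrix ((h.model hz).S X) z j j :=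
  (neg_mul_coresolvent_apply hz _ j).symm

lemma lam_eq (X : Fin n → Fin N → ℂ) :
    (h.model hz).lam X = (-z / m) * trace (realDiag d' * coresolventMatrix ((h.model hz).S X) z) := by
  simp only [ColumnModel.lam, trace, diag_apply, realDiag, Matrix.diagonal_mul, Finset.mul_sum]
  refine Finset.sum_congr rfl fun j _ => ?_
  rw [q_eq, model_σ_sq]
  ring

/-- The q_j are the diagonal entries of -zQ̃, and Q̃ is the transposed resolvent of Sᵀ, itself a
model of the same kind with D and D̃ exchanged. The variance bound for Tr DQ thus covers λ as well.
-/
lemma lam_eq_transpose (X : Fin n → Fin N → ℂ) :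
    (h.model hz).lam X = (-z / m) * trace ((h.transpose.model hz).D *
      (h.transpose.model hz).Q fun i j => X j i) := by
  have h1 : (h.transpose.model hz).z = z := rfl
  rw [lam_eq, model_D, ColumnModel.Q, transpose_S h, coresolvent_eq_transpose, h1]
  simp [trace, realDiag, Matrix.diagonal_mul]

/-- The weighted sum of the random weights concentrates, by the variance bound for the transposed
model. -/
lemma l2Bound_lam_sub_meanLam :
    L2Bound (h.model hz).arrayLaw (fun X => (h.model hz).lam X - (h.model hz).meanLam)
      ((h.model hz).T ^ 22 / m) := by
  have := h.prob
  set M := h.model hz with hM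
  set M' := h.transpose.model hz with hM'
  have hsw : MeasurePreserving (fun (X : Fin n → Fin N → ℂ) i j => X j i) M.arrayLaw M'.arrayLaw :=
    measurePreserving_swap_array n N ν
  have hmean : M.meanLam = (-z / m) * M'.meanTrace := by
    rw [ColumnModel.meanLam, ColumnModel.meanTrace,
      ← integral_comp_measurePreserving hsw (Continuous.aestronglyMeasurable (by fun_prop)),
      ← integral_const_mul]
    exact integral_congr_ae (Filter.Eventually.of_forall fun X => h.lam_eq_transpose hz X)
  have hT : M'.T = M.T := rfl
  have hm := h.m_pos
  have hb : ‖-z / (m : ℂ)‖ ≤ M.T / m := by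
    rw [norm_div, norm_neg, Complex.norm_real, Real.norm_of_nonneg hm.le]
    gcongr
    exact M.norm_z_le
  have hTp := M.T_pos
  refine (((M'.l2Bound_trace_D_Q_sub_integral.comp_measurePreserving hsw).bdd_mul
    (g := fun _ => -z / (m : ℂ)) aestronglyMeasurable_const (b := M.T / m) (by positivity)
    fun _ => hb).congr fun X => ?_).mono ?_
  · rw [hmean, h.lam_eq_transpose hz X, mul_sub]
    rfl
  · rw [hT]
    calc M.T / m * M.T ^ 20 = M.T ^ 21 / m := by ring
      _ ≤ _ := by gcongr; exacts [M.one_le_T, by norm_num]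

end BoundedModel

/-! ### Coercivity of the inverse of the deterministic equivalent -/

/-- The imaginary parts of -zb and W do not have opposite signs, so |Im| is at least b|Im z|, which
suffices when Re z ≥ 0. When Re z < 0 the real parts also agree in sign, so adding W cannot decrease
the modulus below b|z|. -/
lemma deltaZ_mul_le_norm_of_cone {z W : ℂ} {b : ℝ} (hb : 0 ≤ b) (him : z.im * W.im ≤ 0)
    (hre : z.re < 0 → 0 ≤ W.re) : deltaZ z * b ≤ ‖-z * b + W‖ := by
  rcases le_or_gt 0 z.re with hz | hz
  · refine (mul_le_mul_of_nonneg_right (deltaZ_le_abs_im hz) hb).trans ?_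
    refine le_trans ?_ (Complex.abs_im_le_norm _)
    rw [← abs_of_nonneg hb, ← abs_mul]
    apply sq_le_sq.1
    simp only [Complex.add_im, Complex.mul_im, Complex.neg_im, Complex.neg_re, Complex.ofReal_re,
      Complex.ofReal_im, abs_of_nonneg hb]
    nlinarith [sq_nonneg W.im, mul_nonneg hb (neg_nonneg.2 him)]
  · refine (mul_le_mul_of_nonneg_right (deltaZ_le_norm z) hb).trans ?_
    have hn : ‖z‖ * b = ‖z * (b : ℂ)‖ := by simp [abs_of_nonneg hb]
    rw [hn, ← abs_of_nonneg (norm_nonneg (z * b)), ← abs_of_nonneg (norm_nonneg (-z * _ + W))]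
    apply sq_le_sq.1
    rw [← Complex.normSq_eq_norm_sq, ← Complex.normSq_eq_norm_sq, Complex.normSq_apply,
      Complex.normSq_apply]
    simp only [Complex.add_im, Complex.mul_im, Complex.neg_im, Complex.neg_re, Complex.ofReal_re,
      Complex.ofReal_im, Complex.add_re, Complex.mul_re]
    nlinarith [sq_nonneg W.im, sq_nonneg W.re, mul_nonneg hb (neg_nonneg.2 him),
      mul_nonneg hb (mul_nonneg (neg_nonneg.2 hz.le) (hre hz))]

lemma ResolventCone.im_inv_one_add {z w : ℂ} (h : ResolventCone z w) :
    z.im * ((1 + w)⁻¹).im ≤ 0 := by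
  have h1 := h.im_nonneg
  rw [Complex.inv_im, mul_div_assoc', Complex.add_im, Complex.one_im, zero_add]
  exact div_nonpos_of_nonpos_of_nonneg (by linarith) (Complex.normSq_nonneg _)

lemma ResolventCone.re_inv_one_add {z w : ℂ} (h : ResolventCone z w) (hz : z.re < 0) :
    0 ≤ ((1 + w)⁻¹).re := by
  have h1 := h.re_nonneg hz
  rw [Complex.inv_re, Complex.add_re, Complex.one_re]
  exact div_nonneg (by linarith) (Complex.normSq_nonneg _)

/-- The quadratic form at v is -z‖v‖² + W, with W a nonnegative combination of L and the g_j, so W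
inherits their sign conditions and the form is coercive with constant δ_z. -/
lemma isUnit_and_norm_inv_le_of_cone {N n : ℕ} {z L : ℂ} (hz : z ∉ nonnegAxis) {e : Fin N → ℝ}
    (he : ∀ i, 0 ≤ e i) (A : Matrix (Fin N) (Fin n) ℂ) {g : Fin n → ℂ} (hLim : z.im * L.im ≤ 0)
    (hLre : z.re < 0 → 0 ≤ L.re) (hgim : ∀ j, z.im * (g j).im ≤ 0)
    (hgre : z.re < 0 → ∀ j, 0 ≤ (g j).re) :
    IsUnit ((-z) • (1 : Matrix (Fin N) (Fin N) ℂ) + L • realDiag e + A * diagonal g * Aᴴ) ∧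
      ‖((-z) • (1 : Matrix (Fin N) (Fin N) ℂ) + L • realDiag e + A * diagonal g * Aᴴ)⁻¹‖
        ≤ 1 / deltaZ z := by
  refine isUnit_and_norm_inv_le_of_coercive _ (deltaZ_pos hz) fun v => ?_
  have h1 : star v ⬝ᵥ (realDiag e *ᵥ v) = ((∑ i, e i * ‖v i‖ ^ 2 : ℝ) : ℂ) := by
    simp only [dotProduct, realDiag, Matrix.mulVec_diagonal, Pi.star_apply]
    push_cast
    refine Finset.sum_congr rfl fun i _ => ?_
    rw [← Complex.conj_mul', RCLike.star_def]
    ring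
  have h2 : star v ⬝ᵥ ((A * diagonal g * Aᴴ) *ᵥ v) =
      ∑ j, ((‖(Aᴴ *ᵥ v) j‖ ^ 2 : ℝ) : ℂ) * g j := by
    rw [← Matrix.mulVec_mulVec, ← Matrix.mulVec_mulVec, Matrix.dotProduct_mulVec,
      show star v ᵥ* A = star (Aᴴ *ᵥ v) by rw [Matrix.star_mulVec, conjTranspose_conjTranspose]]
    simp only [dotProduct, Matrix.mulVec_diagonal, Pi.star_apply]
    refine Finset.sum_congr rfl fun j _ => ?_
    push_cast
    rw [← Complex.conj_mul', RCLike.star_def]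
    ring
  have h3 : (0 : ℝ) ≤ ∑ i, e i * ‖v i‖ ^ 2 :=
    Finset.sum_nonneg fun i _ => mul_nonneg (he i) (by positivity)
  rw [Matrix.add_mulVec, Matrix.add_mulVec, dotProduct_add, dotProduct_add, Matrix.smul_mulVec,
    Matrix.smul_mulVec, Matrix.one_mulVec, dotProduct_smul, dotProduct_smul, star_dotProduct_self,
    h1, h2, smul_eq_mul, smul_eq_mul, add_assoc]
  refine deltaZ_mul_le_norm_of_cone (vecSq_nonneg v) ?_ fun hre => ?_
  · rw [Complex.add_im, Complex.im_mul_ofReal, Complex.im_sum, mul_add, ← mul_assoc,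
      Finset.mul_sum (f := fun j => (((‖(Aᴴ *ᵥ v) j‖ ^ 2 : ℝ) : ℂ) * g j).im)]
    refine add_nonpos (mul_nonpos_of_nonpos_of_nonneg hLim h3) (Finset.sum_nonpos fun j _ => ?_)
    rw [Complex.im_ofReal_mul, mul_left_comm]
    exact mul_nonpos_of_nonneg_of_nonpos (by positivity) (hgim j)
  · rw [Complex.add_re, Complex.re_mul_ofReal, Complex.re_sum]
    refine add_nonneg (mul_nonneg (hLre hre) h3) (Finset.sum_nonneg fun j _ => ?_)
    rw [Complex.re_ofReal_mul]
    exact mul_nonneg (by positivity) (hgre hre j)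

/-! ### Entries and columns under the operator norm, integrals of traces -/

lemma norm_apply_le_l2_opNorm {ι κ : Type*} [Fintype ι] [Fintype κ] [DecidableEq κ]
    (B : Matrix ι κ ℂ) (i : ι) (k : κ) : ‖B i k‖ ≤ ‖B‖ := by
  have h := vecSq_mulVec_le B (Pi.single k 1)
  have h1 : vecSq (Pi.single k (1 : ℂ)) = 1 := by
    simp [vecSq, Pi.single_apply, apply_ite, ite_pow]
  rw [h1, mul_one, Matrix.mulVec_single_one] at h
  refine le_of_sq_le_sq ((Finset.single_le_sum (f := fun i => ‖B.col k i‖ ^ 2)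
    (fun _ _ => by positivity) (Finset.mem_univ i)).trans h) (norm_nonneg _)

lemma vecSq_col_le_norm_sq {ι κ : Type*} [Fintype ι] [Fintype κ] [DecidableEq κ]
    (B : Matrix ι κ ℂ) (k : κ) : vecSq (B.col k) ≤ ‖B‖ ^ 2 := by
  have h := vecSq_mulVec_le B (Pi.single k 1)
  have h1 : vecSq (Pi.single k (1 : ℂ)) = 1 := by
    simp [vecSq, Pi.single_apply, apply_ite, ite_pow]
  rwa [h1, mul_one, Matrix.mulVec_single_one] at h

lemma vecSq_col_transpose_le_norm_sq {ι κ : Type*} [Fintype ι] [Fintype κ] [DecidableEq κ]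
    [DecidableEq ι] (B : Matrix ι κ ℂ) (i : ι) : vecSq (Bᵀ.col i) ≤ ‖B‖ ^ 2 := by
  have h := vecSq_col_le_norm_sq Bᴴ i
  rw [Matrix.l2_opNorm_conjTranspose] at h
  refine le_of_eq_of_le ?_ h
  simp [vecSq, Matrix.col_apply]

lemma trace_mul_integral {Ω : Type*} [MeasurableSpace Ω] {μ : Measure Ω} {k : ℕ}
    {F : Ω → Matrix (Fin k) (Fin k) ℂ} (hF : ∀ i j, Integrable (fun ω => F ω i j) μ)
    (B : Matrix (Fin k) (Fin k) ℂ) :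
    trace (B * Matrix.of fun i j => ∫ ω, F ω i j ∂μ) = ∫ ω, trace (B * F ω) ∂μ := by
  have h1 : ∀ i j, Integrable (fun ω => B i j * F ω j i) μ := fun i j => (hF j i).const_mul _
  have h2 : ∀ i, Integrable (fun ω => ∑ j, B i j * F ω j i) μ := fun i =>
    integrable_finsetSum _ fun j _ => h1 i j
  calc _ = ∑ i, ∑ j, B i j * ∫ ω, F ω j i ∂μ := rfl
    _ = ∑ i, ∫ ω, ∑ j, B i j * F ω j i ∂μ := Finset.sum_congr rfl fun i _ => by
      rw [integral_finsetSum _ fun j _ => h1 i j]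
      exact Finset.sum_congr rfl fun j _ => (integral_const_mul _ _).symm
    _ = ∫ ω, ∑ i, ∑ j, B i j * F ω j i ∂μ := (integral_finsetSum _ fun i _ => h2 i).symm

/-! ### Transfer to the random matrix of the statement -/

namespace BoundedModel

section Transfer

variable {N n : ℕ} {κ : ℝ} {ν : Measure ℂ} {d : Fin N → ℝ} {d' : Fin n → ℝ}
  {A : Matrix (Fin N) (Fin n) ℂ} {z : ℂ} {Ω : Type*} [MeasurableSpace Ω] {μ : Measure Ω}
  [IsProbabilityMeasure μ] {X : Ω → Matrix (Fin N) (Fin n) ℂ}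
  (h : BoundedModel κ n ν d d' A) (hz : z ∉ nonnegAxis)

/-- The scale is m = n here. The array is indexed by column first, so that one coordinate of the
product law is a whole column. -/
lemma sigmaMatrix_eq (Y : Matrix (Fin N) (Fin n) ℂ) :
    sigmaMatrix d d' Y A = (h.model hz).S fun j i => Y i j := by
  ext i j
  rw [model_S_apply, Real.sqrt_div (h.d'_nonneg j)]
  simp only [sigmaMatrix, realDiag, Matrix.add_apply, Matrix.smul_apply, Matrix.mul_diagonal,
    Matrix.diagonal_mul, smul_eq_mul]
  push_cast
  ring

lemma integrable_resolvent
    (hX : MeasurePreserving (fun ω j i => X ω i j) μ (h.model hz).arrayLaw) (i k : Fin N) :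
    Integrable (fun ω => resolventMatrix (sigmaMatrix d d' (X ω) A) z i k) μ := by
  have hc : Continuous fun Y => (h.model hz).Q Y i k :=
    (h.model hz).continuous_Q.matrix_elem i k
  refine Integrable.of_bound ?_ (1 / deltaZ z) (Filter.Eventually.of_forall fun ω =>
    (norm_apply_le_l2_opNorm _ i k).trans (norm_resolvent_le hz _))
  simp_rw [h.sigmaMatrix_eq hz]
  exact (hc.measurable.comp hX.measurable).aestronglyMeasurable

lemma integrable_coresolvent
    (hX : MeasurePreserving (fun ω j i => X ω i j) μ (h.model hz).arrayLaw) (j k : Fin n) :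
    Integrable (fun ω => coresolventMatrix (sigmaMatrix d d' (X ω) A) z j k) μ := by
  have hc : Continuous fun Y => resolventMatrix ((h.model hz).S Y)ᴴ z j k :=
    ((continuous_resolvent hz).comp (h.model hz).continuous_S.matrix_conjTranspose).matrix_elem j k
  simp_rw [coresolvent_eq]
  refine Integrable.of_bound ?_ (1 / deltaZ z) (Filter.Eventually.of_forall fun ω =>
    (norm_apply_le_l2_opNorm _ j k).trans (norm_resolvent_le hz _))
  simp_rw [h.sigmaMatrix_eq hz]
  exact (hc.measurable.comp hX.measurable).aestronglyMeasurable

lemma trace_mul_expResolvent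
    (hX : MeasurePreserving (fun ω j i => X ω i j) μ (h.model hz).arrayLaw)
    (B : Matrix (Fin N) (Fin N) ℂ) :
    trace (B * expResolvent μ X d d' A z) =
      ∫ Y, trace (B * (h.model hz).Q Y) ∂(h.model hz).arrayLaw := by
  rw [expResolvent, trace_mul_integral (h.integrable_resolvent hz hX),
    ← integral_comp_measurePreserving hX (Continuous.aestronglyMeasurable (by fun_prop))]
  simp_rw [h.sigmaMatrix_eq hz]
  rfl

lemma alphaFn_eq (hX : MeasurePreserving (fun ω j i => X ω i j) μ (h.model hz).arrayLaw) :
    alphaFn μ X d d' A z = (h.model hz).meanTrace / n := by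
  rw [alphaFn, h.trace_mul_expResolvent hz hX, ColumnModel.meanTrace, model_D]
  ring

lemma neg_mul_alphaTildeFn
    (hX : MeasurePreserving (fun ω j i => X ω i j) μ (h.model hz).arrayLaw) :
    -z * alphaTildeFn μ X d d' A z = (h.model hz).meanLam := by
  rw [alphaTildeFn, expCoresolvent, trace_mul_integral (h.integrable_coresolvent hz hX),
    ColumnModel.meanLam,
    ← integral_comp_measurePreserving hX (Continuous.aestronglyMeasurable (by fun_prop))]
  simp_rw [h.lam_eq hz, h.sigmaMatrix_eq hz]
  rw [integral_const_mul]
  push_cast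
  ring

lemma resolventCone_alphaTildeFn
    (hX : MeasurePreserving (fun ω j i => X ω i j) μ (h.model hz).arrayLaw) :
    ResolventCone z (alphaTildeFn μ X d d' A z) := by
  have h1 : alphaTildeFn μ X d d' A z = ((1 / (n : ℝ) : ℝ) : ℂ) * ∑ j, ((d' j : ℝ) : ℂ) *
      ∫ ω, coresolventMatrix (sigmaMatrix d d' (X ω) A) z j j ∂μ := by
    simp only [alphaTildeFn, trace, diag_apply, realDiag, Matrix.diagonal_mul, expCoresolvent,
      Matrix.of_apply]
    push_cast
    rfl
  rw [h1]
  refine (ResolventCone.sum _ fun j _ => (ResolventCone.integral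
    (h.integrable_coresolvent hz hX j j) fun ω => ?_).ofReal_mul (h.d'_nonneg j)).ofReal_mul
    (by positivity)
  rw [coresolvent_eq]
  exact resolventCone_apply hz _ j

lemma innerR_eq (hX : MeasurePreserving (fun ω j i => X ω i j) μ (h.model hz).arrayLaw) :
    innerR μ X d d' A z =
      diagonal fun j => 1 + ((h.model hz).σ j : ℂ) ^ 2 * (h.model hz).meanTrace := by
  rw [innerR, h.alphaFn_eq hz hX, realDiag, ← Matrix.diagonal_one, ← Matrix.diagonal_smul,
    Matrix.diagonal_add]
  congr 1
  funext j
  rw [model_σ_sq, Pi.smul_apply, smul_eq_mul]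
  push_cast
  ring

lemma diagonal_mul_diagonal_g :
    (diagonal fun j => 1 + ((h.model hz).σ j : ℂ) ^ 2 * (h.model hz).meanTrace) *
      diagonal (h.model hz).g = 1 := by
  rw [Matrix.diagonal_mul_diagonal, ← Matrix.diagonal_one]
  congr 1
  funext j
  exact mul_inv_cancel₀ (((h.model hz).resolventCone_meanTrace j).one_add_ne_zero hz)

lemma isUnit_innerR (hX : MeasurePreserving (fun ω j i => X ω i j) μ (h.model hz).arrayLaw) :
    IsUnit (innerR μ X d d' A z) := by
  rw [h.innerR_eq hz hX]
  exact IsUnit.of_mul_eq_one _ (h.diagonal_mul_diagonal_g hz)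

lemma preR_eq (hX : MeasurePreserving (fun ω j i => X ω i j) μ (h.model hz).arrayLaw) :
    preR μ X d d' A z = (h.model hz).Rinv := by
  rw [preR, h.innerR_eq hz hX, Matrix.inv_eq_right_inv (h.diagonal_mul_diagonal_g hz), smul_add,
    smul_smul, h.neg_mul_alphaTildeFn hz hX, ColumnModel.Rinv, model_D]
  rfl

/-- The four cone conditions are all used: those on zw for the coefficient -zα̃ of D, those on w for
the weights (1 + σ_j²𝔼Tr DQ)⁻¹. -/
lemma isUnit_preR_and_norm_le
    (hX : MeasurePreserving (fun ω j i => X ω i j) μ (h.model hz).arrayLaw) :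
    IsUnit (preR μ X d d' A z) ∧ ‖matrixR μ X d d' A z‖ ≤ 1 / deltaZ z := by
  have hα := h.resolventCone_alphaTildeFn hz hX
  have hg := (h.model hz).resolventCone_meanTrace
  rw [matrixR, h.preR_eq hz hX, ColumnModel.Rinv, model_D, ← h.neg_mul_alphaTildeFn hz hX]
  refine isUnit_and_norm_inv_le_of_cone hz h.d_nonneg _ ?_ (fun hre => ?_)
    (fun j => (hg j).im_inv_one_add) (fun hre j => (hg j).re_inv_one_add hre)
  · rw [neg_mul, Complex.neg_im, mul_neg]
    exact neg_nonpos.2 hα.im_mul_nonneg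
  · rw [neg_mul, Complex.neg_re]
    exact neg_nonneg.2 (hα.re_mul_nonpos hre)

/-- The mean resolvent is close to its deterministic equivalent, in Frobenius duality. -/
theorem norm_trace_mul_expResolvent_sub_le
    (hX : MeasurePreserving (fun ω j i => X ω i j) μ (h.model hz).arrayLaw) (hA : ‖A‖ ≤ κ)
    (B : Matrix (Fin N) (Fin N) ℂ) :
    ‖trace (B * expResolvent μ X d d' A z) - trace (B * matrixR μ X d d' A z)‖ ≤
      bound κ z ^ 43 * √(frobSq B) / √n := by
  have := h.prob
  obtain ⟨hU, hR⟩ := h.isUnit_preR_and_norm_le hz hX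
  have hRT : ‖matrixR μ X d d' A z‖ ≤ bound κ z := hR.trans (h.model hz).inv_delta_le
  set M := h.model hz with hM
  set R := matrixR μ X d d' A z with hRdef
  have hRR : R * M.Rinv = 1 := by
    rw [hM, ← h.preR_eq hz hX]
    exact Matrix.nonsing_inv_mul _ ((Matrix.isUnit_iff_isUnit_det _).1 hU)
  -- Testing against K = BR cancels R⁻¹, at the cost of one more factor T from ‖BR‖_F ≤ ‖B‖_F ‖R‖.
  have herr : ∀ Y, M.errTrace (B * R) Y = trace (B * M.Q Y) - trace (B * R) := fun Y => by
    rw [ColumnModel.errTrace, Matrix.mul_sub, Matrix.mul_one, Matrix.mul_assoc, ← Matrix.mul_assoc R,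
      hRR, Matrix.one_mul, trace_sub]
  have hInt : Integrable (fun Y => trace (B * M.Q Y)) M.arrayLaw :=
    Integrable.of_bound (Continuous.aestronglyMeasurable (by fun_prop))
      (√(frobSq B) * √(N * M.T ^ 2)) (Filter.Eventually.of_forall fun Y => by
        refine (norm_trace_mul_le _ _).trans ?_
        gcongr
        refine (frobSq_le_card_mul _).trans ?_
        rw [Fintype.card_fin]
        gcongr
        exact M.norm_Q_le Y)
  have hmain := M.norm_integral_errTrace_le (hA.trans (h.le_bound hz))
    (h.l2Bound_lam_sub_meanLam hz) (B * R)
  simp_rw [herr] at hmain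
  rw [integral_sub hInt (integrable_const _), integral_const, probReal_univ, one_smul,
    ← h.trace_mul_expResolvent hz hX] at hmain
  refine hmain.trans ?_
  have hT : 0 < bound κ z := M.T_pos
  have hF : √(frobSq (B * R)) ≤ √(frobSq B) * bound κ z := by
    refine (Real.sqrt_le_sqrt (frobSq_mul_le_right B R)).trans ?_
    rw [Real.sqrt_mul (frobSq_nonneg B), Real.sqrt_sq (norm_nonneg _)]
    gcongr
  calc bound κ z ^ 42 * √(frobSq (B * R)) / √n
      ≤ bound κ z ^ 42 * (√(frobSq B) * bound κ z) / √n := by gcongr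
    _ = _ := by ring

end Transfer

end BoundedModel

/-! ### The theorem -/

/-- The constant which dominates all the parameters of the model. -/
noncomputable def modelConst (lmax dmax dmax' amax mom : ℝ) : ℝ :=
  17 + |lmax| + |dmax| + |dmax'| + amax ^ 2 + |mom|

namespace ModelAssumptions

variable {lmin lmax dmin dmax dmin' dmax' amax mom : ℝ} {p N n : ℕ} {Ω : Type*}
  [MeasurableSpace Ω] {μ : Measure Ω}
  {X : Ω → Matrix (Fin N) (Fin n) ℂ} {d : Fin N → ℝ} {d' : Fin n → ℝ}
  {A : Matrix (Fin N) (Fin n) ℂ}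

lemma N_pos (h : ModelAssumptions lmin lmax dmin dmax dmin' dmax' amax mom p μ X d d' A)
    (hlmin : 0 < lmin) : 0 < N := by
  rcases Nat.eq_zero_or_pos N with rfl | h0
  · have := h.ratio_ge
    simp only [Nat.cast_zero, zero_div] at this
    linarith
  · exact h0

/-- From t⁴ ≤ 1 + t^(8p) for t ≥ 0: the moment hypothesis enters only through the fourth moment. -/
lemma entryLaw [IsProbabilityMeasure μ]
    (h : ModelAssumptions lmin lmax dmin dmax dmin' dmax' amax mom p μ X d d' A)
    (hp : 1 ≤ p) (i : Fin N) (j : Fin n) :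
    EntryLaw (μ.map fun ω => X ω i j) (1 + mom) := by
  have hm : AEMeasurable (fun ω => X ω i j) μ := (h.measurable_X i j).aemeasurable
  have hle : ∀ ω, ‖X ω i j‖ ^ 4 ≤ 1 + ‖X ω i j‖ ^ (8 * p) := fun ω => by
    rcases le_total ‖X ω i j‖ 1 with h1 | h1
    · exact (pow_le_one₀ (norm_nonneg _) h1).trans (by simp)
    · exact (pow_le_pow_right₀ h1 (show 4 ≤ 8 * p by omega)).trans (by simp)
  have hInt : Integrable (fun ω => 1 + ‖X ω i j‖ ^ (8 * p)) μ :=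
    (integrable_const _).add (h.integrable_moment_X i j)
  have h4 : Integrable (fun ω => ‖X ω i j‖ ^ 4) μ :=
    hInt.mono' ((h.measurable_X i j).norm.pow_const 4).aestronglyMeasurable
      (Filter.Eventually.of_forall fun ω => by
        rw [Real.norm_of_nonneg (by positivity)]
        exact hle ω)
  refine ⟨?_, ?_, ?_, ?_⟩
  · rw [integral_map hm (by fun_prop)]
    exact h.mean_X i j
  · rw [integral_map hm (by fun_prop)]
    exact h.variance_X i j
  · rw [integrable_map_measure (by fun_prop) hm]
    exact h4
  · rw [integral_map hm (by fun_prop)]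
    refine (integral_mono h4 hInt hle).trans ?_
    rw [integral_add (integrable_const _) (h.integrable_moment_X i j)]
    simpa using h.moment_X i j

lemma le_of_norm_realDiag_le {k : ℕ} {e : Fin k → ℝ} {c : ℝ} (h : ‖realDiag e‖ ≤ c) (i : Fin k) :
    e i ≤ c := by
  rw [realDiag, Matrix.l2_opNorm_diagonal] at h
  refine (le_abs_self _).trans ?_
  rw [← Real.norm_eq_abs, ← Complex.norm_real]
  exact (norm_le_pi_norm (fun i => (e i : ℂ)) i).trans h

lemma boundedModel [IsProbabilityMeasure μ]
    (h : ModelAssumptions lmin lmax dmin dmax dmin' dmax' amax mom p μ X d d' A)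
    (hp : 1 ≤ p) (i : Fin N) (j : Fin n) :
    BoundedModel (modelConst lmax dmax dmax' amax mom) n (μ.map fun ω => X ω i j) d d' A := by
  have a1 := le_abs_self lmax
  have a2 := le_abs_self dmax
  have a3 := le_abs_self dmax'
  have a4 := le_abs_self mom
  have b1 := abs_nonneg lmax
  have b2 := abs_nonneg dmax
  have b3 := abs_nonneg dmax'
  have b4 := abs_nonneg mom
  have b5 := sq_nonneg amax
  have hn : (1 : ℝ) ≤ n := by exact_mod_cast h.n_pos
  have hA : ‖A‖ ^ 2 ≤ amax ^ 2 := pow_le_pow_left₀ (norm_nonneg _) h.norm_A 2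
  have hlaw := h.entryLaw hp i j
  have hratio := h.ratio_le
  rw [div_le_iff₀ (by linarith)] at hratio
  unfold modelConst
  exact
  { prob := Measure.isProbabilityMeasure_map (h.measurable_X i j).aemeasurable
    law := ⟨hlaw.mean, hlaw.variance, hlaw.integrable_fourth, hlaw.fourth_le.trans (by linarith)⟩
    le_κ := by linarith
    one_le_m := hn
    N_le := hratio.trans (mul_le_mul_of_nonneg_right (by linarith) (by linarith))
    n_le := le_mul_of_one_le_left (by linarith) (by linarith)
    d_nonneg := h.d_nonneg
    d'_nonneg := h.d'_nonneg
    d_le := fun i => (le_of_norm_realDiag_le h.norm_D i).trans (by linarith)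
    d'_le := fun j => (le_of_norm_realDiag_le h.norm_D' j).trans (by linarith)
    vecSq_row_le := fun i => (vecSq_col_transpose_le_norm_sq A i).trans (by linarith)
    vecSq_col_le := fun j => (vecSq_col_le_norm_sq A j).trans (by linarith) }

lemma norm_A_le_modelConst
    (h : ModelAssumptions lmin lmax dmin dmax dmin' dmax' amax mom p μ X d d' A) :
    ‖A‖ ≤ modelConst lmax dmax dmax' amax mom := by
  refine h.norm_A.trans ?_
  unfold modelConst
  -- The constant contains amax² but not amax; (amax - 1)² ≥ 0 bounds the latter by the former.
  nlinarith [abs_nonneg lmax, abs_nonneg dmax, abs_nonneg dmax', abs_nonneg mom,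
    sq_nonneg (amax - 1), sq_nonneg amax]

lemma measurePreserving_array [IsProbabilityMeasure μ]
    (h : ModelAssumptions lmin lmax dmin dmax dmin' dmax' amax mom p μ X d d' A)
    (i₀ : Fin N) (j₀ : Fin n) :
    MeasurePreserving (fun ω j i => X ω i j) μ
      (Measure.pi fun _ => Measure.pi fun _ => μ.map fun ω => X ω i₀ j₀) := by
  have : IsProbabilityMeasure (μ.map fun ω => X ω i₀ j₀) :=
    Measure.isProbabilityMeasure_map (h.measurable_X i₀ j₀).aemeasurable
  exact _root_.measurePreserving_array (fun j i => h.measurable_X i j)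
    (h.indep_X.precomp (g := Prod.swap) Prod.swap_injective)
    fun j i => (h.identDistrib_X i j i₀ j₀).map_eq

end ModelAssumptions

lemma hasNonnegCoeffs_C_mul_one_add_X_pow {c : ℝ} (hc : 0 ≤ c) (k : ℕ) :
    HasNonnegCoeffs (Polynomial.C c * (1 + Polynomial.X) ^ k) := fun l => by
  rw [Polynomial.coeff_C_mul, Polynomial.coeff_one_add_X_pow]
  positivity

lemma star_dotProduct_mulVec_eq_trace {ι : Type*} [Fintype ι] (B : Matrix ι ι ℂ) (u v : ι → ℂ) :
    star u ⬝ᵥ (B *ᵥ v) = trace (vecMulVec v (star u) * B) := by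
  rw [Matrix.vecMulVec_mul, Matrix.trace_vecMulVec, dotProduct_comm v, ← Matrix.dotProduct_mulVec]

theorem mainTheorem3
    (lmin lmax dmin dmax dmin' dmax' amax mom : ℝ) (p : ℕ)
    (hlmin : 0 < lmin) (hdmin : 0 < dmin) (hdmin' : 0 < dmin') (hp : 1 ≤ p) :
    ∃ Φ₁ Ψ₁ Φ₂ Ψ₂ : Polynomial ℝ,
      HasNonnegCoeffs Φ₁ ∧ HasNonnegCoeffs Ψ₁ ∧ HasNonnegCoeffs Φ₂ ∧ HasNonnegCoeffs Ψ₂ ∧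
      ∀ (N n : ℕ) (Ω : Type*) [MeasurableSpace Ω] (μ : Measure Ω) [IsProbabilityMeasure μ]
        (X : Ω → Matrix (Fin N) (Fin n) ℂ) (d : Fin N → ℝ) (d' : Fin n → ℝ)
        (A : Matrix (Fin N) (Fin n) ℂ),
        ModelAssumptions lmin lmax dmin dmax dmin' dmax' amax mom p μ X d d' A →
        ∀ z : ℂ, z ∉ nonnegAxis →
          -- all the objects involved are well defined
          ((∀ ω, IsUnit (sigmaMatrix d d' (X ω) A * (sigmaMatrix d d' (X ω) A)ᴴ
                - z • (1 : Matrix (Fin N) (Fin N) ℂ))) ∧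
            (∀ ω, IsUnit ((sigmaMatrix d d' (X ω) A)ᴴ * sigmaMatrix d d' (X ω) A
                - z • (1 : Matrix (Fin n) (Fin n) ℂ))) ∧
            (∀ i j, Integrable
              (fun ω => resolventMatrix (sigmaMatrix d d' (X ω) A) z i j) μ) ∧
            (∀ i j, Integrable
              (fun ω => coresolventMatrix (sigmaMatrix d d' (X ω) A) z i j) μ) ∧
            IsUnit (innerR μ X d d' A z) ∧ IsUnit (preR μ X d d' A z)) ∧
          -- (i) bilinear forms
          (∀ u v : EuclideanSpace ℂ (Fin N),
            ‖star u.ofLp ⬝ᵥ ((expResolvent μ X d d' A z - matrixR μ X d d' A z) *ᵥ v.ofLp)‖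
              ≤ (1 / Real.sqrt n) * Φ₁.eval ‖z‖ * Ψ₁.eval (1 / deltaZ z) * ‖u‖ * ‖v‖) ∧
          -- (ii) normalized traces
          (∀ M : Matrix (Fin N) (Fin N) ℂ,
            ‖(1 / (n : ℂ)) * Matrix.trace (M * expResolvent μ X d d' A z)
                - (1 / (n : ℂ)) * Matrix.trace (M * matrixR μ X d d' A z)‖
              ≤ (1 / (n : ℝ)) * Φ₂.eval ‖z‖ * Ψ₂.eval (1 / deltaZ z) * ‖M‖) := by
  set κ := modelConst lmax dmax dmax' amax mom with hκdef
  have hκ : 17 ≤ κ := by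
    have := sq_nonneg amax
    have := abs_nonneg lmax
    have := abs_nonneg dmax
    have := abs_nonneg dmax'
    have := abs_nonneg mom
    rw [hκdef, modelConst]
    linarith
  have hκ0 : 0 ≤ κ := by linarith
  -- The 43rd power of κ(1+|z|)(1+1/δ_z), split into its two variables. The extra κ in the third
  -- polynomial comes from ‖M‖_F ≤ κ√n ‖M‖.
  refine ⟨Polynomial.C (κ ^ 43) * (1 + Polynomial.X) ^ 43, Polynomial.C 1 * (1 + Polynomial.X) ^ 43,
    Polynomial.C (κ ^ 44) * (1 + Polynomial.X) ^ 43, Polynomial.C 1 * (1 + Polynomial.X) ^ 43,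
    hasNonnegCoeffs_C_mul_one_add_X_pow (by positivity) _,
    hasNonnegCoeffs_C_mul_one_add_X_pow zero_le_one _,
    hasNonnegCoeffs_C_mul_one_add_X_pow (by positivity) _,
    hasNonnegCoeffs_C_mul_one_add_X_pow zero_le_one _, ?_⟩
  intro N n Ω _ μ _ X d d' A hmod z hz
  -- A reference entry is needed to name the common law; N > 0 because N/n ≥ lmin > 0.
  have i₀ : Fin N := ⟨0, hmod.N_pos hlmin⟩
  have j₀ : Fin n := ⟨0, hmod.n_pos⟩
  have h := hmod.boundedModel hp i₀ j₀
  have hX : MeasurePreserving (fun ω j i => X ω i j) μ (h.model hz).arrayLaw :=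
    hmod.measurePreserving_array i₀ j₀
  have hmain := h.norm_trace_mul_expResolvent_sub_le hz hX hmod.norm_A_le_modelConst
  have hn : (0 : ℝ) < n := by exact_mod_cast hmod.n_pos
  have hsn : 0 < √(n : ℝ) := Real.sqrt_pos.2 hn
  have hT : 0 < BoundedModel.bound κ z := (h.model hz).T_pos
  have hbound : BoundedModel.bound κ z ^ 43 =
      κ ^ 43 * (1 + ‖z‖) ^ 43 * (1 * (1 + 1 / deltaZ z) ^ 43) := by
    rw [BoundedModel.bound, mul_pow, mul_pow, one_mul]
  simp only [Polynomial.eval_mul, Polynomial.eval_C, Polynomial.eval_pow, Polynomial.eval_add,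
    Polynomial.eval_one, Polynomial.eval_X]
  generalize (1 + ‖z‖) ^ 43 = a at hbound ⊢
  generalize (1 + 1 / deltaZ z) ^ 43 = b at hbound ⊢
  refine ⟨⟨fun ω => (gram_sub_isUnit_and_norm_le hz _).1, fun ω => ?_,
    h.integrable_resolvent hz hX, h.integrable_coresolvent hz hX, h.isUnit_innerR hz hX,
    (h.isUnit_preR_and_norm_le hz hX).1⟩, fun u v => ?_, fun M => ?_⟩
  · simpa using (gram_sub_isUnit_and_norm_le hz (sigmaMatrix d d' (X ω) A)ᴴ).1
  · rw [star_dotProduct_mulVec_eq_trace, Matrix.mul_sub, trace_sub]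
    refine (hmain _).trans_eq ?_
    rw [frobSq_vecMulVec, vecSq_star, vecSq_eq_norm_sq, vecSq_eq_norm_sq, WithLp.toLp_ofLp,
      WithLp.toLp_ofLp, ← mul_pow, Real.sqrt_sq (by positivity), hbound]
    ring
  · rw [← mul_sub, norm_mul]
    have h1 : ‖(1 / (n : ℂ))‖ = 1 / (n : ℝ) := by simp
    -- ‖M‖_F² ≤ N‖M‖² with N ≤ κn ≤ κ²n. The √n cancels the n^(-1/2) of the main bound, leaving the
    -- prefactor 1/n.
    have h2 : √(frobSq M) ≤ κ * √n * ‖M‖ := by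
      rw [← Real.sqrt_sq (show 0 ≤ κ * √n * ‖M‖ by positivity)]
      refine Real.sqrt_le_sqrt ((frobSq_le_card_mul M).trans ?_)
      rw [Fintype.card_fin, mul_pow, mul_pow, Real.sq_sqrt hn.le]
      gcongr
      exact h.N_le.trans (mul_le_mul_of_nonneg_right (by nlinarith) hn.le)
    rw [h1]
    calc _ ≤ 1 / (n : ℝ) * (BoundedModel.bound κ z ^ 43 * (κ * √n * ‖M‖) / √n) := by
          gcongr
          refine (hmain M).trans ?_
          gcongr
      _ = _ := by
          rw [hbound]
          field_simp
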